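/- Cops and Robber is the following problem: given a finite connected simple graph $G$ with $n$ vertices and an integer $k \ge 0$ (written in binary), decide whether $k$ cops have a winning strategy on $G$. In the game, the $k$ cops are first placed on vertices (several may share a vertex), then the robber is placed on a vertex; afterwards the cops and the robber move alternately with full information, starting with the cops, where in a move every agent concerned stays or moves to an adjacent vertex. The cops win if at some time a cop and the robber are on the same vertex. Let $\mathsf{vcn}$ be the minimum size of a vertex cover of $G$; it is not part of the input. (1) Cops and Robber is fixed-parameter tractable parameterized by $\mathsf{vcn}$: there are an algorithm, a computable function $f$ and a constant $c$ such that the algorithm decides every instance $I=(G,k)$ in time at most $f(\mathsf{vcn}) \cdot |I|^{c}$. (2) There is an algorithm that decides every instance $(G,k)$ in time $$\Big(\mathsf{vcn}+\frac{2^{\mathsf{vcn}}}{\sqrt{\mathsf{vcn}}}\Big)^{\frac{\mathsf{vcn}}{3}+2}\cdot n^{\mathcal{O}(1)},$$ where $n^{\mathcal{O}(1)}$ means at most $C\cdot n^{c}$ for constants $C$ and $c$, and the quotient is read as $1$ if $\mathsf{vcn}=0$ (the one-vertex graph). Time is measured on a random access machine with logarithmic cost. -/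

import Mathlib

namespace CopsRobber

/-! ### The machine model: random access machines with logarithmic cost -/

/-- The length `l(i) = ⌊log₂ i⌋ + 1` of a natural number (and `l(0) = 1`). -/
def len (i : ℕ) : ℕ := Nat.log 2 i + 1

/-- Instructions of a random access machine. The machine has registers, addressed directly,
and an unbounded memory, addressed indirectly through the contents of registers. -/
inductive Instr where
  /-- `r[d] := c` -/
  | const (d c : ℕ)
  /-- `r[d] := r[a] + r[b]` -/
  | add (d a b : ℕ)
  /-- `r[d] := r[a] - r[b]`, truncated at `0` -/
  | sub (d a b : ℕ)
  /-- `r[d] := r[a] * r[b]` -/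
  | mul (d a b : ℕ)
  /-- `r[d] := ⌊r[a] / r[b]⌋` -/
  | div (d a b : ℕ)
  /-- `r[d] := mem[r[a]]` -/
  | load (d a : ℕ)
  /-- `mem[r[a]] := r[b]` -/
  | store (a b : ℕ)
  /-- continue at instruction `p` -/
  | jump (p : ℕ)
  /-- continue at instruction `p` if `r[a] = 0` -/
  | jz (a p : ℕ)

/-- A program is a finite list of instructions. -/
abbrev Program : Type := List Instr

/-- A configuration: the program counter, the registers and the memory. -/
structure Config where
  pc : ℕ
  reg : ℕ → ℕ
  mem : ℕ → ℕ

/-- Write `v` to register `d` and go on to the next instruction. -/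
def Config.setReg (s : Config) (d v : ℕ) : Config :=
  { pc := s.pc + 1, reg := Function.update s.reg d v, mem := s.mem }

/-- The effect of one instruction. -/
def Instr.exec : Instr → Config → Config
  | .const d c, s => s.setReg d c
  | .add d a b, s => s.setReg d (s.reg a + s.reg b)
  | .sub d a b, s => s.setReg d (s.reg a - s.reg b)
  | .mul d a b, s => s.setReg d (s.reg a * s.reg b)
  | .div d a b, s => s.setReg d (s.reg a / s.reg b)
  | .load d a, s => s.setReg d (s.mem (s.reg a))
  | .store a b, s =>
      { pc := s.pc + 1, reg := s.reg, mem := Function.update s.mem (s.reg a) (s.reg b) }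
  | .jump p, s => { pc := p, reg := s.reg, mem := s.mem }
  | .jz a p, s =>
      { pc := if s.reg a = 0 then p else s.pc + 1, reg := s.reg, mem := s.mem }

/-- The logarithmic cost of one instruction: the total length of the operands and of the memory
addresses that it handles. -/
def Instr.cost : Instr → Config → ℕ
  | .const _ c, _ => len c
  | .add _ a b, s => len (s.reg a) + len (s.reg b)
  | .sub _ a b, s => len (s.reg a) + len (s.reg b)
  | .mul _ a b, s => len (s.reg a) + len (s.reg b)
  | .div _ a b, s => len (s.reg a) + len (s.reg b)
  | .load _ a, s => len (s.reg a) + len (s.mem (s.reg a))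
  | .store a b, s => len (s.reg a) + len (s.reg b)
  | .jump _, _ => 1
  | .jz a _, s => len (s.reg a)

/-- `Runs P s T s'`: program `P` leads from configuration `s` to configuration `s'` by finitely
many instructions, of total cost `T`. -/
inductive Runs (P : Program) : Config → ℕ → Config → Prop where
  | refl (s : Config) : Runs P s 0 s
  | step {s s' : Config} {T : ℕ} {i : Instr} (hi : P[s.pc]? = some i)
      (h : Runs P (i.exec s) T s') : Runs P s (i.cost s + T) s'

/-- The start configuration: the input stands in the first memory cells, and everything else
is `0`. -/
def start (input : List ℕ) : Config :=
  { pc := 0, reg := fun _ => 0, mem := fun i => input.getD i 0 }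

/-- The machine halts when the program counter leaves the program. -/
def Halted (P : Program) (s : Config) : Prop := P[s.pc]? = none

/-! ### Parameterized problems -/

/-- A parameterized decision problem: its instances, their encoding as input of a machine, the
yes-instances, and the parameter of an instance. The parameter is not a part of the input. -/
structure ParamProblem where
  Inst : Type
  encode : Inst → List ℕ
  yes : Inst → Prop
  param : Inst → ℕ

/-- The size of an instance: the total length of the numbers in its encoding. -/
def ParamProblem.size (Q : ParamProblem) (I : Q.Inst) : ℕ := ((Q.encode I).map len).sum

/-- `P` solves `Q` in time `T`: on every instance `I` it halts, after instructions of total cost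
at most `T I`, with the correct answer (`1` exactly for yes-instances) in register `0`. -/
def SolvesInTime (P : Program) (Q : ParamProblem) (T : Q.Inst → ℝ) : Prop :=
  ∀ I : Q.Inst, ∃ (t : ℕ) (s : Config), Runs P (start (Q.encode I)) t s ∧ Halted P s ∧
    (s.reg 0 = 1 ↔ Q.yes I) ∧ (t : ℝ) ≤ T I

/-- Fixed-parameter tractability: solvable in time `f (param) * size ^ c` with `f` computable. -/
def ParamProblem.FPT (Q : ParamProblem) : Prop :=
  ∃ (P : Program) (f : ℕ → ℕ) (c : ℕ), Computable f ∧
    SolvesInTime P Q (fun I => (f (Q.param I) : ℝ) * (Q.size I : ℝ) ^ c)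

/-! ### The game of Cops and Robber -/

section Game

variable {V : Type*} (G : SimpleGraph V)

/-- A move of one agent: it stays or moves along an edge. -/
def Move (u v : V) : Prop := u = v ∨ G.Adj u v

/-- A strategy of `k` cops assigns to the list of the positions that the robber has taken so far,
in chronological order, the positions of the cops after they respond to it; at the empty list it
is their initial placement. -/
abbrev CopStrategy (V : Type*) (k : ℕ) : Type _ := List V → Fin k → V

/-- The cops only make legal moves. -/
def CopStrategy.Legal {k : ℕ} (σ : CopStrategy V k) : Prop :=
  ∀ (h : List V) (v : V) (j : Fin k), Move G (σ h j) (σ (h ++ [v]) j)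

/-- The robber chooses an initial vertex `ρ 0` and only makes legal moves. -/
def RobberLegal (ρ : ℕ → V) : Prop := ∀ i, Move G (ρ i) (ρ (i + 1))

/-- Cops playing `σ` capture a robber playing `ρ`: at some time `i`, either the robber's `i`-th
position is occupied by a cop already, or a cop moves to it in the following cop move. -/
def Captures {k : ℕ} (σ : CopStrategy V k) (ρ : ℕ → V) : Prop :=
  ∃ (i : ℕ) (j : Fin k), σ ((List.range i).map ρ) j = ρ i ∨ σ ((List.range (i + 1)).map ρ) j = ρ i

/-- `G` is `k`-copwin: `k` cops have a strategy that captures every robber. -/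
def CopWin (k : ℕ) : Prop :=
  ∃ σ : CopStrategy V k, σ.Legal G ∧ ∀ ρ : ℕ → V, RobberLegal G ρ → Captures σ ρ

end Game

/-- An instance of the problem: a finite connected simple graph and a number of cops. -/
structure CnRInstance where
  n : ℕ
  G : SimpleGraph (Fin n)
  connected : G.Connected
  k : ℕ

/-- The vertex cover number of the graph of an instance. -/
noncomputable def CnRInstance.vcn (I : CnRInstance) : ℕ := I.G.vertexCoverNum.toNat

open Classical in
/-- The encoding of an instance: the number `n` of vertices, the `n * n` entries of the adjacency
matrix row by row, the binary digits of `k` (least significant first), and the end mark `2`. -/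
noncomputable def CnRInstance.encode (I : CnRInstance) : List ℕ :=
  [I.n] ++ (List.finRange I.n).flatMap
      (fun u => (List.finRange I.n).map (fun v => if I.G.Adj u v then 1 else 0))
    ++ I.k.bits.map Bool.toNat ++ [2]

/-- Cops and Robber, parameterized by the vertex cover number. -/
noncomputable def cnr : ParamProblem where
  Inst := CnRInstance
  encode := CnRInstance.encode
  yes I := CopWin I.G I.k
  param I := I.vcn

end CopsRobber

/-! The machine tries one cop, two cops, and so on, as long as the number is at most `k` and no
smaller number has won. Each attempt solves a finite reachability game by backward propagation from
the final positions. Two facts keep the number of positions small; `vcn` enters only their estimate,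
and the program never computes it.

First, the cop number is at most `vcn / 3 + 4` (`exists_copWin_of_cover`). Cops are stationed
greedily on vertices that see three unguarded vertices of a minimum cover. Afterwards every closed
neighbourhood meets the rest `Y` of the cover in at most two vertices. Next, groups of three or four
vertices of `Y` are entrusted to one cop each, whose home is at distance at most two from all of
them. A robber who leaves the cover threatens at most one guarded vertex, since one of his two
possible neighbours in `Y` is where he came from; so the guard has time to step next to the
threatened vertex (`Setting.confines`). When no such group is left, the remaining vertices are
linked by common neighbours at most in pairs (`Setting.unique_linked`). Four spare cops, who also
make it possible to activate the guards one by one (`finishes_of_active`), then finish the robber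
(`Setting.finishes`).

Second, two or more cops may restrict the game to undominated vertices (`copWin_iff_nodeWin`). The
graph retracts onto them, and a cop who has caught the robber's shadow under the retraction blocks
all his exits while another cop walks up to him (`Win.lift`). Off the cover, the neighbourhoods of
undominated vertices form an antichain of subsets of the cover, so Sperner's theorem bounds the
number `m` of vertices left by the base of the running time (`card_undominated_le`,
`choose_half_le`).

If the agents move one at a time (`turnWin_zero_iff`), the game with `k` cops has `(k + 1) * m ^ (k
+ 1)` nodes with at most `m` moves each. The exponent `k + 1` exceeds `vcn / 3 + 2` by at most
three, and the surplus factors `m ≤ n` go into the polynomial (`length_keptList_pow_le`). A single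
cop plays on all vertices, at polynomial cost.

The remainder verifies a program: a structured language is compiled to the machine, with a bound on
all stored values that turns step counts into logarithmic cost (`Ev.runs`), and a worklist algorithm
is proved correct in a program logic (`wp_workC`, `wp_mainC`). -/

namespace CopsRobber

/-! ### The game as a reachability game on positions -/

section Positions

variable {α : Type*} {mv : α → α → Prop}

/-- The cops, standing on the vertices of the list `c` and about to move, win against a robber
on `r`, if all agents move along `mv`. -/
inductive Win (mv : α → α → Prop) : List α → α → Prop
  | capture {c c' : List α} {r : α} (h : List.Forall₂ mv c c') (hr : r ∈ c') : Win mv c r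
  | step {c c' : List α} {r : α} (h : List.Forall₂ mv c c')
      (hr : ∀ r', mv r r' → Win mv c' r') : Win mv c r

theorem forall₂_self (hrefl : ∀ a, mv a a) (c : List α) : List.Forall₂ mv c c :=
  List.forall₂_same.2 fun a _ => hrefl a

/-- Cops are interchangeable: a permutation can be pushed through a simultaneous move. -/
theorem Win.perm {c c' : List α} {r : α} (h : Win mv c r) (hp : c.Perm c') : Win mv c' r := by
  induction h generalizing c' with
  | capture h hr =>
    have h2 : Relation.Comp List.Perm (List.Forall₂ mv) c' _ := ⟨_, hp.symm, h⟩
    rw [← List.forall₂_comp_perm_eq_perm_comp_forall₂] at h2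
    obtain ⟨d, hd, hd'⟩ := h2
    exact .capture hd (hd'.mem_iff.2 hr)
  | step h hr ih =>
    have h2 : Relation.Comp List.Perm (List.Forall₂ mv) c' _ := ⟨_, hp.symm, h⟩
    rw [← List.forall₂_comp_perm_eq_perm_comp_forall₂] at h2
    obtain ⟨d, hd, hd'⟩ := h2
    exact .step hd fun r' hr' => ih r' hr' hd'.symm

theorem Win.append (hrefl : ∀ a, mv a a) {c : List α} {r : α} (h : Win mv c r) (d : List α) :
    Win mv (c ++ d) r := by
  induction h with
  | capture h hr =>
    exact .capture (List.rel_append h (forall₂_self hrefl d)) (List.mem_append_left _ hr)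
  | step h hr ih => exact .step (List.rel_append h (forall₂_self hrefl d)) ih

theorem Win.of_mem_move (hrefl : ∀ a, mv a a) {c : List α} {a r : α} (ha : a ∈ c)
    (h : mv a r) : Win mv c r := by
  obtain ⟨l₁, l₂, rfl⟩ := List.append_of_mem ha
  exact .capture (c' := l₁ ++ r :: l₂)
    (List.rel_append (forall₂_self hrefl _) (.cons h (forall₂_self hrefl _))) (by simp)

/-- A cop next to every possible escape and a second cop that walks to the robber win. -/
theorem Win.of_trapped (hrefl : ∀ a, mv a a) {v w r : α} (hv : ∀ r', mv r r' → r' = r ∨ mv v r')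
    (hw : Relation.ReflTransGen mv w r) (rest : List α) : Win mv (v :: w :: rest) r := by
  induction hw using Relation.ReflTransGen.head_induction_on with
  | refl => exact .of_mem_move hrefl (a := r) (by simp) (hrefl r)
  | head h _ ih =>
    refine .step (.cons (hrefl v) (.cons h (forall₂_self hrefl rest))) fun r' hr' => ?_
    rcases hv r' hr' with rfl | h'
    · exact ih
    · exact .of_mem_move hrefl (a := v) (by simp) h'

/-- The robber's moves in the retract are moves in the big game via `g`, and the cops answer with
the images under `f` of their moves there. That `f` undoes `g` is required only at `b` and at
targets of moves, because in the application `β` is `ℕ` and large numbers name no vertex. -/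
theorem Win.map_of_hom {β : Type*} {mv' : β → β → Prop} (f : α → β)
    (hf : ∀ u v, mv u v → mv' (f u) (f v)) (g : β → α) {c : List α} {r : α} (h : Win mv c r)
    (b : β) (hgb : g b = r) (hfg : ∀ b b', mv' b b' → f (g b') = b' ∧ mv (g b) (g b'))
    (hb : f (g b) = b) :
    Win mv' (c.map f) b := by
  have key : ∀ {c c' : List α}, List.Forall₂ mv c c' → List.Forall₂ mv' (c.map f) (c'.map f) := by
    intro c c' h
    rw [List.forall₂_map_left_iff, List.forall₂_map_right_iff]
    exact h.imp fun a b => hf a b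
  induction h generalizing b with
  | capture h hr =>
    refine .capture (key h) ?_
    subst hgb
    rw [← hb]
    exact List.mem_map_of_mem hr
  | step h hr ih =>
    subst hgb
    exact .step (key h) fun b' hb' => ih _ (hfg b b' hb').2 b' rfl (hfg b b' hb').1

open Classical in
/-- A win of at least two cops on a retract lifts to the whole graph, if neighbourhoods grow
under the retraction. -/
theorem Win.lift {β : Type*} {mv' : β → β → Prop} (hrefl : ∀ a, mv a a) (f : α → β) (g : β → α)
    (hf : ∀ u v, mv u v → mv' (f u) (f v)) (hg : ∀ a b, mv' a b → mv (g a) (g b))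
    (hdom : ∀ r r', mv r r' → r' = r ∨ mv (g (f r)) r')
    (hconn : ∀ a b, Relation.ReflTransGen mv a b)
    {c : List β} {b : β} (h : Win mv' c b) (hc : 2 ≤ c.length ∨ ∀ u, g (f u) = u) (r : α)
    (hr : f r = b) : Win mv (c.map g) r := by
  have key : ∀ {c c' : List β}, List.Forall₂ mv' c c' → List.Forall₂ mv (c.map g) (c'.map g) := by
    intro c c' h
    rw [List.forall₂_map_left_iff, List.forall₂_map_right_iff]
    exact h.imp fun a b => hg a b
  induction h generalizing r with
  | @capture c c' b h hm =>
    subst hr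
    rcases hc with hc | hc
    · refine .step (key h) fun r' hr' => ?_
      -- Only the shadow `f r` is caught. The cop on `g (f r)` now sees every vertex to which the
      -- robber can move away, and a second cop walks up to him.
      have hmem : g (f r) ∈ c'.map g := List.mem_map_of_mem hm
      rcases hdom r r' hr' with rfl | h'
      · rw [h.length_eq, ← List.length_map (f := g)] at hc
        obtain ⟨l, hl⟩ : ∃ l, (c'.map g).Perm (g (f r') :: l) :=
          ⟨_, (List.perm_cons_erase hmem)⟩
        have hlen := hl.length_eq
        match l, hl with
        | [], hl => simp at hlen; simp [hlen] at hc
        | w :: rest, hl =>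
          exact (Win.of_trapped hrefl (hdom r') (hconn w r') rest).perm hl.symm
      · exact .of_mem_move hrefl hmem h'
    · refine .capture (key h) ?_
      rw [← hc r]
      exact List.mem_map_of_mem hm
  | @step c c' b h hm ih =>
    subst hr
    exact .step (key h) fun r' hr' => ih (f r') (hf _ _ hr') (h.length_eq ▸ hc) r' rfl

/-- The cops win within `n` rounds. -/
def WinWithin (mv : α → α → Prop) : ℕ → List α → α → Prop
  | 0, _, _ => False
  | n + 1, c, r => ∃ c', List.Forall₂ mv c c' ∧ (r ∈ c' ∨ ∀ r', mv r r' → WinWithin mv n c' r')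

theorem WinWithin.succ {n : ℕ} {c : List α} {r : α} (h : WinWithin mv n c r) :
    WinWithin mv (n + 1) c r := by
  induction n generalizing c r with
  | zero => exact h.elim
  | succ n ih =>
    obtain ⟨c', hc, h⟩ := h
    exact ⟨c', hc, h.imp id fun h r' hr' => ih (h r' hr')⟩

theorem WinWithin.mono {n m : ℕ} (hnm : n ≤ m) {c : List α} {r : α} (h : WinWithin mv n c r) :
    WinWithin mv m c r := by
  induction hnm with
  | refl => exact h
  | step _ ih => exact ih.succ

/-- The robber has finitely many replies, so the ranks after them have a common bound in `ℕ`. -/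
theorem Win.exists_within [Finite α] {c : List α} {r : α} (h : Win mv c r) :
    ∃ n, WinWithin mv n c r := by
  induction h with
  | capture h hr => exact ⟨1, _, h, .inl hr⟩
  | @step c c' r h hr ih =>
    choose! N hN using ih
    obtain ⟨B, hB⟩ := (Set.finite_range N).bddAbove
    exact ⟨B + 1, _, h, .inr fun r' hr' => (hN r' hr').mono (hB ⟨r', rfl⟩)⟩

theorem ofFn_forall₂ {k : ℕ} {f g : Fin k → α} :
    List.Forall₂ mv (List.ofFn f) (List.ofFn g) ↔ ∀ j, mv (f j) (g j) := by
  rw [List.forall₂_iff_get]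
  simp only [List.length_ofFn, true_and, List.get_ofFn]
  exact ⟨fun h j => h j j.2 j.2, fun h i h₁ _ => h ⟨i, h₁⟩⟩

theorem exists_ofFn {k : ℕ} (c : List α) (hc : c.length = k) : ∃ f : Fin k → α, c = List.ofFn f := by
  subst hc
  exact ⟨c.get, (List.ofFn_get c).symm⟩

end Positions

section Game

variable {V : Type*} {G : SimpleGraph V}

theorem Move.refl (v : V) : Move G v v := .inl rfl

theorem Move.symm {u v : V} (h : Move G u v) : Move G v u :=
  h.elim (fun h => .inl h.symm) fun h => .inr h.symm

theorem reflTransGen_move (hG : G.Connected) (u v : V) : Relation.ReflTransGen (Move G) u v := by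
  obtain ⟨p⟩ := hG.preconnected u v
  induction p with
  | nil => exact .refl
  | cons h _ ih => exact .head (.inr h) ih

/-- Induction on the rank: each response of `σ` hits the robber or lowers the number of rounds still
needed. -/
theorem capture_of_winWithin {k : ℕ} (σ : CopStrategy V k) (ρ : ℕ → V) (hρ : RobberLegal G ρ)
    (hσ : ∀ n h v, WinWithin (Move G) (n + 1) (List.ofFn (σ h)) v →
      v ∈ List.ofFn (σ (h ++ [v])) ∨
        ∀ v', Move G v v' → WinWithin (Move G) n (List.ofFn (σ (h ++ [v]))) v') (n i : ℕ)
    (h : WinWithin (Move G) n (List.ofFn (σ ((List.range i).map ρ))) (ρ i)) : Captures σ ρ := by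
  induction n generalizing i with
  | zero => exact h.elim
  | succ n ih =>
    have := hσ n _ _ h
    have hl : (List.range i).map ρ ++ [ρ i] = (List.range (i + 1)).map ρ := by
      rw [List.range_succ, List.map_append]; rfl
    rw [hl] at this
    rcases this with h | h
    · obtain ⟨j, hj⟩ := List.mem_ofFn.1 h
      exact ⟨i, j, .inr hj⟩
    · exact ih (i + 1) (h _ (hρ i))

/-- Positional determinacy. If no placement is won against every robber, then against any `σ` the
robber can stay forever in positions that are not won, because a position with a cop move after
which all replies are won is itself won. Conversely, replies of minimal rank form a memoryless
winning strategy. -/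
theorem copWin_iff [Finite V] {k : ℕ} :
    CopWin G k ↔ ∃ c : List V, c.length = k ∧ ∀ r, Win (Move G) c r := by
  classical
  constructor
  · rintro ⟨σ, hσ, hcap⟩
    by_contra! hcon
    have hcon' : ∀ h : List V, ∃ r, ¬ Win (Move G) (List.ofFn (σ h)) r :=
      fun h => hcon _ (by simp)
    have hnext : ∀ (h : List V) (r : V), ¬ Win (Move G) (List.ofFn (σ h)) r →
        ∃ r', Move G r r' ∧ ¬ Win (Move G) (List.ofFn (σ (h ++ [r]))) r' := by
      intro h r hr
      by_contra! hc
      exact hr (.step (ofFn_forall₂.2 fun j => hσ h r j) hc)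
    choose r₀ hr₀ using hcon'
    choose! nx hnx using hnext
    -- The robber's past and his present vertex; the past is carried along since `σ` may depend on
    -- all of it.
    let st : ℕ → List V × V := fun i =>
      Nat.rec ([], r₀ []) (fun _ p => (p.1 ++ [p.2], nx p.1 p.2)) i
    let ρ : ℕ → V := fun i => (st i).2
    have hst : ∀ i, (st i).1 = (List.range i).map ρ := by
      intro i
      induction i with
      | zero => rfl
      | succ i ih =>
        rw [List.range_succ, List.map_append, ← ih]
        rfl
    have hno : ∀ i, ¬ Win (Move G) (List.ofFn (σ (st i).1)) (ρ i) := by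
      intro i
      induction i with
      | zero => exact hr₀ []
      | succ i ih => exact (hnx _ _ ih).2
    have hleg : RobberLegal G ρ := fun i => (hnx _ _ (hno i)).1
    obtain ⟨i, j, h⟩ := hcap ρ hleg
    have hi := hno i
    rw [hst] at hi
    apply hi
    rcases h with h | h
    · exact .of_mem_move Move.refl (List.mem_ofFn.2 ⟨j, h⟩) (Move.refl _)
    · refine .capture (c' := List.ofFn (σ ((List.range (i + 1)).map ρ))) (ofFn_forall₂.2 ?_)
        (List.mem_ofFn.2 ⟨j, h⟩)
      intro j
      rw [List.range_succ, List.map_append]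
      exact hσ _ _ j
  · rintro ⟨c, hc, hwin⟩
    obtain ⟨c₀, rfl⟩ := exists_ofFn c hc
    -- One reply, taken for the least possible number of rounds, serves every `n` by monotonicity.
    have hex : ∀ (c : Fin k → V) (r : V), ∃ c' : Fin k → V, (∀ j, Move G (c j) (c' j)) ∧
        ∀ n, WinWithin (Move G) (n + 1) (List.ofFn c) r →
          r ∈ List.ofFn c' ∨ ∀ r', Move G r r' → WinWithin (Move G) n (List.ofFn c') r' := by
      intro c r
      by_cases h : ∃ n, WinWithin (Move G) (n + 1) (List.ofFn c) r
      · obtain ⟨d, hd, hd'⟩ := Nat.find_spec h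
        obtain ⟨c', rfl⟩ := exists_ofFn (k := k) d (by rw [← hd.length_eq]; simp)
        refine ⟨c', ofFn_forall₂.1 hd, fun n hn => hd'.imp id fun h' r' hr' => ?_⟩
        exact (h' r' hr').mono (Nat.find_le hn)
      · exact ⟨c, fun _ => Move.refl _, fun n hn => (h ⟨n, hn⟩).elim⟩
    choose π hπ hπ' using hex
    let σ : CopStrategy V k := fun h => h.foldl π c₀
    have hσ : ∀ h v, σ (h ++ [v]) = π (σ h) v := fun h v => by simp [σ]
    refine ⟨σ, fun h v j => by rw [hσ]; exact hπ _ _ _, fun ρ hρ => ?_⟩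
    obtain ⟨n, hn⟩ := (hwin (ρ 0)).exists_within
    exact capture_of_winWithin σ ρ hρ (fun n h v hw => by rw [hσ]; exact hπ' _ _ n hw) n 0 hn

end Game


/-! ### A third of the vertex cover number, up to a constant, suffices -/

section Bound

variable {V : Type*} {G : SimpleGraph V}

/-- By connectedness the cops can walk to their targets one after the other. -/
theorem reflTransGen_forall₂ (hG : G.Connected) :
    ∀ {e e' : List V}, e.length = e'.length →
      Relation.ReflTransGen (List.Forall₂ (Move G)) e e'
  | [], [], _ => .refl
  | a :: e, b :: e', h => by
    have h₁ : Relation.ReflTransGen (List.Forall₂ (Move G)) (a :: e) (b :: e) :=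
      Relation.ReflTransGen.lift (fun x => x :: e)
        (fun _ _ h => List.Forall₂.cons h (forall₂_self Move.refl e)) _ _ (reflTransGen_move hG a b)
    have h₂ : Relation.ReflTransGen (List.Forall₂ (Move G)) (b :: e) (b :: e') :=
      Relation.ReflTransGen.lift (fun l => b :: l)
        (fun _ _ h => List.Forall₂.cons (Move.refl b) h) _ _
        (reflTransGen_forall₂ hG (by simpa using h))
    exact h₁.trans h₂

/-- While a team of cops that reacts to the robber by `pos` confines him to the region `R`, the
other cops, on `e`, finish him. -/
def Finishes (G : SimpleGraph V) (R : V → Prop) (pos : V → List V) (e : List V) : Prop :=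
  ∀ r, R r → ∀ q, List.Forall₂ (Move G) q (pos r) → Win (Move G) (q ++ e) r

/-- A team of cops that reacts to the robber by `pos` confines him to the region `R`. -/
def Confines (G : SimpleGraph V) (R : V → Prop) (pos : V → List V) : Prop :=
  ∀ r, R r → ∀ r', Move G r r' →
    (∃ c ∈ pos r, Move G c r') ∨ (R r' ∧ List.Forall₂ (Move G) (pos r) (pos r'))

/-- The confinement can be kept up for as long as the spare cops need to walk, so only their
destination matters. -/
theorem Finishes.walk (hG : G.Connected) {R : V → Prop} {pos : V → List V}
    (hR : Confines G R pos) {e e' : List V} (hl : e.length = e'.length)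
    (h : Finishes G R pos e') : Finishes G R pos e := by
  induction reflTransGen_forall₂ hG hl using Relation.ReflTransGen.head_induction_on with
  | refl => exact h
  | head hstep _ ih =>
    intro r hr q hq
    refine .step (List.rel_append hq hstep) fun r' hr' => ?_
    rcases hR r hr r' hr' with ⟨c, hc, hcr⟩ | ⟨hr₁, hf⟩
    · exact .of_mem_move Move.refl (List.mem_append_left _ hc) hcr
    · exact ih (by rw [← hl]; exact hstep.length_eq.symm) r' hr₁ _ hf

/-- Greedy choice: a cop is stationed wherever he sees three vertices not yet guarded, so that each
cop uses up at least three vertices of `X`. `Y` is what remains when this is no longer possible. -/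
theorem exists_static_guards [Finite V] (G : SimpleGraph V) (X : Finset V) :
    ∃ (S : List V) (Y : Finset V), Y ⊆ X ∧ 3 * S.length + Y.card ≤ X.card ∧
      (∀ v ∈ X, v ∈ Y ∨ ∃ s ∈ S, Move G s v) ∧
      ∀ v, ∀ a ∈ Y, ∀ b ∈ Y, ∀ c ∈ Y, Move G v a → Move G v b → Move G v c →
        a = b ∨ a = c ∨ b = c := by
  classical
  induction hn : X.card using Nat.strong_induction_on generalizing X with
  | _ n ih =>
    subst hn
    by_cases h : ∃ v, 3 ≤ (X.filter (Move G v)).card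
    · obtain ⟨v, hv⟩ := h
      have hcard := X.card_filter_add_card_filter_not (Move G v)
      obtain ⟨S, Y, hYX, hc, hcov, hY⟩ := ih (X.filter fun z => ¬ Move G v z).card (by omega) _ rfl
      refine ⟨v :: S, Y, hYX.trans (Finset.filter_subset _ _), ?_, fun z hz => ?_, hY⟩
      · simp only [List.length_cons]; omega
      · by_cases hvz : Move G v z
        · exact .inr ⟨v, by simp, hvz⟩
        · rcases hcov z (by simp [hz, hvz]) with h | ⟨s, hs, h⟩
          · exact .inl h
          · exact .inr ⟨s, by simp [hs], h⟩
    · push Not at h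
      refine ⟨[], X, subset_rfl, by simp, fun v hv => .inl hv, fun v a ha b hb c hc va vb vc => ?_⟩
      by_contra! hne
      have := Finset.two_lt_card.2 ⟨a, Finset.mem_filter.2 ⟨ha, va⟩, b,
        Finset.mem_filter.2 ⟨hb, vb⟩, c, Finset.mem_filter.2 ⟨hc, vc⟩, hne.1, hne.2.1, hne.2.2⟩
      exact absurd (h v) (by omega)

/-- A cop with home `g.1` can guard the vertices `g.2`, a part of `Y`: they are at distance at
most two, and edges inside `Y` do not lead into `g.2`. -/
structure Guardable (G : SimpleGraph V) (Y : Finset V) (g : V × Finset V) : Prop where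
  subset : g.2 ⊆ Y
  near : ∀ z ∈ g.2, ∃ w, Move G g.1 w ∧ Move G w z
  closed : ∀ z ∈ g.2, ∀ z' ∈ Y, G.Adj z z' → z' ∈ g.2
  card_le : g.2.card ≤ 4

/-- The same greedy choice with guardable groups of at least three vertices. A group is closed under
adjacency within `Y`, so deleting it leaves the remainder closed as well. -/
theorem exists_responsive_guards (G : SimpleGraph V) (Y X : Finset V) (hXY : X ⊆ Y)
    (hX : ∀ z ∈ X, ∀ z' ∈ Y, G.Adj z z' → z' ∈ X) :
    ∃ (gs : List (V × Finset V)) (Z : Finset V), Z ⊆ X ∧ 3 * gs.length + Z.card ≤ X.card ∧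
      (∀ g ∈ gs, Guardable G Y g) ∧ (∀ v ∈ X, v ∈ Z ∨ ∃ g ∈ gs, v ∈ g.2) ∧
      (∀ z ∈ Z, ∀ z' ∈ Y, G.Adj z z' → z' ∈ Z) ∧
      ∀ g, Guardable G Y g → g.2 ⊆ Z → g.2.card < 3 := by
  classical
  induction hn : X.card using Nat.strong_induction_on generalizing X with
  | _ n ih =>
    subst hn
    by_cases h : ∃ g, Guardable G Y g ∧ g.2 ⊆ X ∧ 3 ≤ g.2.card
    · obtain ⟨g, hg, hgX, hg3⟩ := h
      have hcard := Finset.card_sdiff_add_card_eq_card hgX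
      obtain ⟨gs, Z, hZ, hc, hgs, hcov, hcl, hmax⟩ := ih (X \ g.2).card (by omega) (X \ g.2)
        (Finset.sdiff_subset.trans hXY) (fun z hz z' hz' hadj => by
          rw [Finset.mem_sdiff] at hz ⊢
          exact ⟨hX z hz.1 z' hz' hadj,
            fun h' => hz.2 (hg.closed z' h' z (hXY hz.1) hadj.symm)⟩) rfl
      refine ⟨g :: gs, Z, hZ.trans Finset.sdiff_subset, ?_, ?_, fun v hv => ?_, hcl, hmax⟩
      · simp only [List.length_cons]; omega
      · simp only [List.mem_cons, forall_eq_or_imp]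
        exact ⟨hg, hgs⟩
      · by_cases hvg : v ∈ g.2
        · exact .inr ⟨g, by simp, hvg⟩
        · rcases hcov v (by simp [hv, hvg]) with h | ⟨s, hs, h⟩
          · exact .inl h
          · exact .inr ⟨s, by simp [hs], h⟩
    · push Not at h
      exact ⟨[], X, subset_rfl, by simp, by simp, fun v hv => .inl hv, hX,
        fun g hg hgX => h g hg hgX⟩

open Classical in
/-- The reaction of the guard `g` to a robber on `r`. -/
noncomputable def guardPos (G : SimpleGraph V) (g : V × Finset V) (r : V) : V :=
  if h : ∃ w, Move G g.1 w ∧ ∃ z ∈ g.2, G.Adj r z ∧ Move G w z then h.choose else g.1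

theorem move_guardPos (g : V × Finset V) (r : V) : Move G g.1 (guardPos G g r) := by
  unfold guardPos
  split_ifs with h
  · exact h.choose_spec.1
  · exact Move.refl _

theorem guardPos_of_not_adj {g : V × Finset V} {r : V} (h : ∀ z ∈ g.2, ¬ G.Adj r z) :
    guardPos G g r = g.1 := by
  unfold guardPos
  rw [dif_neg]
  rintro ⟨w, _, z, hz, hr, _⟩
  exact h z hz hr

/-- The choice in `guardPos` may aim at any threatened vertex of the group; if there is only one, it
aims at the right one. -/
theorem guardPos_move {Y : Finset V} {g : V × Finset V} (hg : Guardable G Y g) {r z : V}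
    (hz : z ∈ g.2) (hrz : G.Adj r z) (huniq : ∀ z' ∈ g.2, G.Adj r z' → z' = z) :
    Move G (guardPos G g r) z := by
  obtain ⟨w, hw, hwz⟩ := hg.near z hz
  have h : ∃ w, Move G g.1 w ∧ ∃ z ∈ g.2, G.Adj r z ∧ Move G w z := ⟨w, hw, z, hz, hrz, hwz⟩
  unfold guardPos
  rw [dif_pos h]
  obtain ⟨_, z', hz', hrz', hm⟩ := h.choose_spec
  rwa [huniq z' hz' hrz'] at hm

/-- The positions of static guards `S` and responsive guards `gs`. -/
noncomputable def teamPos (G : SimpleGraph V) (S : List V) (gs : List (V × Finset V)) (r : V) :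
    List V :=
  S ++ gs.map fun g => guardPos G g r

/-- The robber has not entered the guarded vertices, and can enter at most one at a time. -/
structure Outside (G : SimpleGraph V) (S : List V) (gs : List (V × Finset V)) (r : V) : Prop where
  static : ∀ s ∈ S, ¬ Move G s r
  not_mem : ∀ g ∈ gs, r ∉ g.2
  unique : ∀ g ∈ gs, ∀ g' ∈ gs, ∀ z ∈ g.2, ∀ z' ∈ g'.2, G.Adj r z → G.Adj r z' → z = z'

/-- The hypotheses on a cover `U`, on static guards `S` and on the rest `Y` of `U`. -/
structure Setting (G : SimpleGraph V) (U Y : Finset V) (S : List V) : Prop where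
  cover : ∀ u v, G.Adj u v → u ∈ U ∨ v ∈ U
  static : ∀ v ∈ U, v ∈ Y ∨ ∃ s ∈ S, Move G s v
  few : ∀ v, ∀ a ∈ Y, ∀ b ∈ Y, ∀ c ∈ Y, Move G v a → Move G v b → Move G v c →
    a = b ∨ a = c ∨ b = c

theorem Setting.mem {U Y : Finset V} {S : List V} (hs : Setting G U Y S)
    {gs : List (V × Finset V)} {r : V} (hr : Outside G S gs r) (hU : r ∈ U) : r ∈ Y := by
  rcases hs.static r hU with h | ⟨s, h, h'⟩
  · exact h
  · exact (hr.static s h h').elim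

/-- While the robber stands on the cover, all guards are at home. When he steps off it, each guard
has one move to get next to the only vertex under threat; when he steps back elsewhere, the guard
returns home. -/
theorem Setting.confines {U Y : Finset V} {S : List V} (hs : Setting G U Y S)
    {gs : List (V × Finset V)} (hgs : ∀ g ∈ gs, Guardable G Y g) :
    Confines G (Outside G S gs) (teamPos G S gs) := by
  -- Groups are closed under adjacency within `Y`, so a robber on `Y` outside the groups threatens
  -- none of them.
  have hfar : ∀ r ∈ Y, (∀ g ∈ gs, r ∉ g.2) → ∀ g ∈ gs, ∀ z ∈ g.2, ¬ G.Adj r z :=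
    fun r hr hn g hg z hz hadj => hn g hg ((hgs g hg).closed z hz r hr hadj.symm)
  intro r hr r' hrr'
  by_cases hS : ∃ s ∈ S, Move G s r'
  · obtain ⟨s, h, h'⟩ := hS
    exact .inl ⟨s, List.mem_append_left _ h, h'⟩
  push Not at hS
  rcases hrr' with rfl | hadj
  · exact .inr ⟨hr, forall₂_self Move.refl _⟩
  by_cases hA : ∃ g ∈ gs, r' ∈ g.2
  · obtain ⟨g, hg, hr'⟩ := hA
    refine .inl ⟨guardPos G g r, List.mem_append_right _ (List.mem_map_of_mem hg), ?_⟩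
    exact guardPos_move (hgs g hg) hr' hadj fun z' hz' h' => hr.unique g hg g hg z' hz' r' hr' h' hadj
  push Not at hA
  have hteam : (∀ g ∈ gs, Move G (guardPos G g r) (guardPos G g r')) →
      List.Forall₂ (Move G) (teamPos G S gs r) (teamPos G S gs r') := by
    intro h
    refine List.rel_append (forall₂_self Move.refl S) ?_
    rw [List.forall₂_map_left_iff, List.forall₂_map_right_iff, List.forall₂_same]
    exact h
  by_cases hU : r' ∈ U
  · have hY : r' ∈ Y := by
      rcases hs.static r' hU with h | ⟨s, h, h'⟩
      · exact h
      · exact (hS s h h').elim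
    have hno := hfar r' hY hA
    refine .inr ⟨⟨hS, hA, fun g hg _ _ z hz _ _ h => (hno g hg z hz h).elim⟩, hteam fun g hg => ?_⟩
    rw [guardPos_of_not_adj (hno g hg)]
    exact (move_guardPos g r).symm
  · have hrU : r ∈ U := (hs.cover r r' hadj).resolve_right hU
    have hrY := hs.mem hr hrU
    have hno := hfar r hrY hr.not_mem
    refine .inr ⟨⟨hS, hA, fun g hg g' hg' z hz z' hz' h h' => ?_⟩, hteam fun g hg => ?_⟩
    -- One of the at most two vertices of `Y` near `r'` is the unguarded `r` from which the robber
    -- came.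
    · rcases hs.few r' r hrY z ((hgs g hg).subset hz) z' ((hgs g' hg').subset hz')
        (.inr hadj.symm) (.inr h) (.inr h') with h | h | h
      · exact (hr.not_mem g hg (h ▸ hz)).elim
      · exact (hr.not_mem g' hg' (h ▸ hz')).elim
      · exact h
    · rw [guardPos_of_not_adj (hno g hg)]
      exact move_guardPos g r'

/-- With an empty group a guard waits at home; this models a guard who is not active yet. -/
theorem guardable_empty (Y : Finset V) (h : V) : Guardable G Y (h, ∅) :=
  ⟨by simp, by simp, by simp, by simp⟩

theorem exists_list_of_card_le (A : Finset V) (h : V) {m : ℕ} (hA : A.card ≤ m) :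
    ∃ e : List V, e.length = m ∧ ∀ a ∈ A, a ∈ e :=
  ⟨A.toList ++ List.replicate (m - A.card) h, by simp; omega, fun a ha => by simp [ha]⟩

/-- Responsive guards become active one after the other, while four further cops occupy the
vertices to be guarded. -/
theorem finishes_of_active (hG : G.Connected) {U Y : Finset V} {S : List V}
    (hs : Setting G U Y S) (todo : List (V × Finset V)) :
    ∀ gs : List (V × Finset V), (∀ g ∈ gs ++ todo, Guardable G Y g) →
      (∀ e : List V, e.length = 4 →
        Finishes G (Outside G S (gs ++ todo)) (teamPos G S (gs ++ todo)) e) →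
      ∀ e : List V, e.length = 4 →
        Finishes G (Outside G S (gs ++ todo.map fun g => (g.1, ∅)))
          (teamPos G S (gs ++ todo.map fun g => (g.1, ∅))) e := by
  induction todo with
  | nil => intro gs _ h; simpa using h
  | cons g todo ih =>
    intro gs hgs h e he
    have ih' := ih (gs ++ [g]) (by simpa using hgs) (by simpa using h)
    have hg : Guardable G Y g := hgs g (by simp)
    -- The bound four in `Guardable` lets the four spare cops occupy the whole group.
    obtain ⟨e', he', hmem⟩ := exists_list_of_card_le g.2 g.1 hg.card_le
    refine Finishes.walk hG (e' := e') (hs.confines ?_) (by rw [he, he']) ?_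
    · intro g' hg'
      simp only [List.map_cons, List.mem_append, List.mem_cons, List.mem_map] at hg'
      rcases hg' with h | rfl | ⟨a, _, rfl⟩
      · exact hgs g' (by simp [h])
      · exact guardable_empty _ _
      · exact guardable_empty _ _
    intro r hr q hq
    by_cases hA : ∃ a ∈ g.2, Move G a r
    · obtain ⟨a, ha, har⟩ := hA
      exact .of_mem_move Move.refl (List.mem_append_right _ (hmem a ha)) har
    push Not at hA
    have hfar : ∀ z ∈ g.2, ¬ G.Adj r z := fun z hz h => hA z hz (.inr h.symm)
    have hmap : ∀ g' ∈ gs ++ [g] ++ todo.map (fun g => (g.1, (∅ : Finset V))), g' = g ∨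
        g' ∈ gs ++ (g :: todo).map (fun g => (g.1, (∅ : Finset V))) := by
      intro g' hg'
      simp only [List.append_assoc, List.mem_append, List.mem_cons, List.cons_append,
        List.nil_append, List.map_cons] at hg' ⊢
      tauto
    refine ih' e' he' r ⟨hr.static, fun g' hg' => ?_, fun g₁ hg₁ g₂ hg₂ z hz z' hz' hrz hrz' => ?_⟩ q ?_
    · rcases hmap g' hg' with rfl | h
      · exact fun h' => hA r h' (Move.refl r)
      · exact hr.not_mem g' h
    · rcases hmap g₁ hg₁ with rfl | h₁
      · exact (hfar z hz hrz).elim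
      rcases hmap g₂ hg₂ with rfl | h₂
      · exact (hfar z' hz' hrz').elim
      exact hr.unique g₁ h₁ g₂ h₂ z hz z' hz' hrz hrz'
    -- The group is out of the robber's reach, so the active guard stands at home just like the
    -- inactive one.
    · convert hq using 1
      simp only [teamPos, List.map_append, List.map_cons, List.append_assoc, List.cons_append,
        List.nil_append]
      rw [guardPos_of_not_adj hfar, guardPos_of_not_adj (by simp)]

/-- A linked pair together with its neighbours in `Y` would be guardable, so by maximality it has no
neighbours in `Y` but its own members. Two such pairs sharing `z` would then make `{z, z₁, z₂}` a
guardable group of size three with home `z`. -/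
theorem Setting.unique_linked {U Y : Finset V} {S : List V} (hs : Setting G U Y S)
    {Z : Finset V} (hZY : Z ⊆ Y) (hcl : ∀ z ∈ Z, ∀ z' ∈ Y, G.Adj z z' → z' ∈ Z)
    (hmax : ∀ g, Guardable G Y g → g.2 ⊆ Z → g.2.card < 3) {z z₁ z₂ x₁ x₂ : V} (hz : z ∈ Z)
    (hz₁ : z₁ ∈ Z) (hz₂ : z₂ ∈ Z) (h₁ : z₁ ≠ z) (h₂ : z₂ ≠ z) (hx₁ : Move G x₁ z)
    (hx₁' : Move G x₁ z₁) (hx₂ : Move G x₂ z) (hx₂' : Move G x₂ z₂) : z₁ = z₂ := by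
  classical
  have key : ∀ x a b, a ∈ Z → b ∈ Z → a ≠ b → Move G x a → Move G x b →
      ∀ y ∈ Y, G.Adj a y ∨ G.Adj b y → y = a ∨ y = b := by
    intro x a b ha hb hab hxa hxb y hy hadj
    have hcard : ∀ v, (Y.filter (Move G v)).card ≤ 2 := by
      intro v
      by_contra! h
      obtain ⟨a, ha, b, hb, c, hc, h⟩ := Finset.two_lt_card.1 h
      rw [Finset.mem_filter] at ha hb hc
      have := hs.few v a ha.1 b hb.1 c hc.1 ha.2 hb.2 hc.2
      tauto
    let A := Y.filter (Move G a) ∪ Y.filter (Move G b)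
    have hA : ∀ v, v ∈ A ↔ v ∈ Y ∧ (Move G a v ∨ Move G b v) := by
      intro v
      simp only [A, Finset.mem_union, Finset.mem_filter]
      tauto
    -- Closed neighbourhoods meet `Y` in at most two vertices, so the edges inside `Y` form a
    -- matching, and the closed neighbourhood of `c` within `Y` is a component.
    have hcl1 : ∀ c ∈ Y, ∀ z, Move G c z → z ∈ Y → ∀ z' ∈ Y, G.Adj z z' → Move G c z' := by
      intro c hc z hcz hz z' hz' hadj
      rcases hcz with rfl | hcz
      · exact .inr hadj
      · rcases hs.few z c hc z hz z' hz' (.inr hcz.symm) (Move.refl _) (.inr hadj) with h | h | h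
        · exact (hcz.ne h).elim
        · exact .inl h
        · exact (hadj.ne h).elim
    have hg : Guardable G Y (x, A) := by
      refine ⟨fun v hv => ((hA v).1 hv).1, fun v hv => ?_, fun v hv v' hv' hadj => ?_, ?_⟩
      · rcases ((hA v).1 hv).2 with h | h
        · exact ⟨a, hxa, h⟩
        · exact ⟨b, hxb, h⟩
      · obtain ⟨hvY, h⟩ := (hA v).1 hv
        exact (hA v').2 ⟨hv', h.imp (fun h => hcl1 a (hZY ha) v h hvY v' hv' hadj)
          fun h => hcl1 b (hZY hb) v h hvY v' hv' hadj⟩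
      · exact (Finset.card_union_le _ _).trans (Nat.add_le_add (hcard a) (hcard b))
    have hlt := hmax _ hg fun v hv => by
      obtain ⟨hvY, h | h⟩ := (hA v).1 hv
      · rcases h with rfl | h
        · exact ha
        · exact hcl a ha v hvY h
      · rcases h with rfl | h
        · exact hb
        · exact hcl b hb v hvY h
    by_contra! hne
    have := Finset.two_lt_card.2 ⟨a, (hA a).2 ⟨hZY ha, .inl (Move.refl _)⟩, b,
      (hA b).2 ⟨hZY hb, .inr (Move.refl _)⟩, y, (hA y).2 ⟨hy, hadj.imp .inr .inr⟩, hab,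
      hne.1.symm, hne.2.symm⟩
    have hlt' : A.card < 3 := hlt
    omega
  by_contra hne
  have k₁ := key x₁ z z₁ hz hz₁ h₁.symm hx₁ hx₁'
  have k₂ := key x₂ z z₂ hz hz₂ h₂.symm hx₂ hx₂'
  have := hmax (z, {z, z₁, z₂}) ⟨?_, ?_, ?_, ?_⟩ ?_
  · rw [Finset.card_eq_three.2 ⟨z, z₁, z₂, h₁.symm, h₂.symm, hne, rfl⟩] at this
    omega
  · intro v hv
    simp only [Finset.mem_insert, Finset.mem_singleton] at hv
    rcases hv with rfl | rfl | rfl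
    exacts [hZY hz, hZY hz₁, hZY hz₂]
  · intro v hv
    simp only [Finset.mem_insert, Finset.mem_singleton] at hv
    rcases hv with rfl | rfl | rfl
    exacts [⟨_, Move.refl _, Move.refl _⟩, ⟨x₁, hx₁.symm, hx₁'⟩, ⟨x₂, hx₂.symm, hx₂'⟩]
  · intro v hv y hy hadj
    simp only [Finset.mem_insert, Finset.mem_singleton] at hv ⊢
    rcases hv with rfl | rfl | rfl
    · rcases k₁ y hy (.inl hadj) with h | h <;> tauto
    · rcases k₁ y hy (.inr hadj) with h | h <;> tauto
    · rcases k₂ y hy (.inr hadj) with h | h <;> tauto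
  · exact Finset.card_le_three.trans (by norm_num)
  · intro v hv
    simp only [Finset.mem_insert, Finset.mem_singleton] at hv
    rcases hv with rfl | rfl | rfl
    exacts [hz, hz₁, hz₂]

/-- The cover vertices that the robber can still use lie in one class `C` of linked vertices. Once
the spare cops occupy `C`, he is next to one of them or cannot move without being captured by the
team; in the latter case the spare cops walk up to him. -/
theorem Setting.finishes (hG : G.Connected) {U Y : Finset V} {S : List V}
    (hs : Setting G U Y S) {gs : List (V × Finset V)} (hgs : ∀ g ∈ gs, Guardable G Y g)
    {Z : Finset V} (hZY : Z ⊆ Y) (hcov : ∀ v ∈ Y, v ∈ Z ∨ ∃ g ∈ gs, v ∈ g.2)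
    (hcl : ∀ z ∈ Z, ∀ z' ∈ Y, G.Adj z z' → z' ∈ Z)
    (hmax : ∀ g, Guardable G Y g → g.2 ⊆ Z → g.2.card < 3) (e : List V) (he : e.length = 4) :
    Finishes G (Outside G S gs) (teamPos G S gs) e := by
  classical
  have hZ : ∀ r, Outside G S gs r → r ∈ U → r ∈ Z := by
    intro r hr hU
    rcases hcov r (hs.mem hr hU) with h | ⟨g, hg, h⟩
    · exact h
    · exact (hr.not_mem g hg h).elim
  have hconf := hs.confines hgs
  intro r hr
  obtain ⟨C, hC2, hCcl, hrC⟩ : ∃ C : Finset V, C.card ≤ 4 ∧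
      (∀ c ∈ C, ∀ z ∈ Z, ∀ x, Move G x c → Move G x z → z ∈ C) ∧ ∀ z ∈ Z, Move G r z → z ∈ C := by
    by_cases h : ∃ z ∈ Z, Move G r z
    · obtain ⟨z₀, hz₀, hrz⟩ := h
      have huniq := fun {z z₁ z₂ x₁ x₂ : V} => hs.unique_linked hZY hcl hmax (z := z) (z₁ := z₁)
        (z₂ := z₂) (x₁ := x₁) (x₂ := x₂)
      refine ⟨Z.filter fun z => ∃ x, Move G x z₀ ∧ Move G x z, ?_, ?_, ?_⟩
      -- The class consists of `z₀` and at most one partner; a bound by the number of spare cops is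
      -- enough.
      · by_contra! hlt
        obtain ⟨a, ha, b, hb, hab⟩ := Finset.one_lt_card.1
          (show 1 < ((Z.filter fun z => ∃ x, Move G x z₀ ∧ Move G x z).erase z₀).card by
            have := Finset.pred_card_le_card_erase
              (s := Z.filter fun z => ∃ x, Move G x z₀ ∧ Move G x z) (a := z₀)
            omega)
        simp only [Finset.mem_erase, Finset.mem_filter] at ha hb
        obtain ⟨ha₀, haZ, x, hx, hx'⟩ := ha
        obtain ⟨hb₀, hbZ, y, hy, hy'⟩ := hb
        exact hab (huniq hz₀ haZ hbZ ha₀ hb₀ hx hx' hy hy')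
      · intro c hc z hz x hxc hxz
        simp only [Finset.mem_filter] at hc ⊢
        obtain ⟨hcZ, y, hy, hyc⟩ := hc
        refine ⟨hz, ?_⟩
        by_cases hzc : z = c
        · exact hzc ▸ ⟨y, hy, hyc⟩
        by_cases hcz : z₀ = c
        · exact hcz ▸ ⟨x, hxc, hxz⟩
        rw [huniq hcZ hz hz₀ hzc hcz hxc hxz hyc hy]
        exact ⟨z₀, Move.refl _, Move.refl _⟩
      · intro z hz hrz'
        simp only [Finset.mem_filter]
        exact ⟨hz, r, hrz, hrz'⟩
    · push Not at h
      exact ⟨∅, by simp, by simp, fun z hz h' => (h z hz h').elim⟩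
  have hconfC : Confines G (fun r => Outside G S gs r ∧ ∀ z ∈ Z, Move G r z → z ∈ C)
      (teamPos G S gs) := by
    rintro r ⟨hr, hrC⟩ r' hrr'
    rcases hconf r hr r' hrr' with h | ⟨hr', hf⟩
    · exact .inl h
    refine .inr ⟨⟨hr', fun z hz hr'z => ?_⟩, hf⟩
    rcases hrr' with rfl | hadj
    · exact hrC z hz hr'z
    -- One end of the step lies on the cover, hence in `Z` and in `C`. Both this end and `z` are
    -- within one move of `r'`, so they are linked.
    by_cases hU : r' ∈ U
    · exact hCcl r' (hrC r' (hZ r' hr' hU) (.inr hadj)) z hz r' (Move.refl _) hr'z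
    · have hrU : r ∈ U := (hs.cover r r' hadj).resolve_right hU
      exact hCcl r (hrC r (hZ r hr hrU) (Move.refl _)) z hz r' (.inr hadj.symm) hr'z
  obtain ⟨e', he', hmem⟩ := exists_list_of_card_le C r hC2
  refine Finishes.walk hG hconfC (e := e) (e' := e') (by rw [he, he']) ?_ r ⟨hr, hrC⟩
  rintro r₁ ⟨hr₁, hrC₁⟩
  by_cases hA : ∃ a ∈ C, Move G a r₁
  · obtain ⟨a, ha, har⟩ := hA
    exact fun q _ => .of_mem_move Move.refl (List.mem_append_right _ (hmem a ha)) har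
  push Not at hA
  have hno : ∀ z ∈ Z, ¬ Move G r₁ z := fun z hz h => hA z (hrC₁ z hz h) h.symm
  have hstuck : Confines G (fun r => r = r₁) (teamPos G S gs) := by
    rintro r rfl r' hrr'
    rcases hconf r hr₁ r' hrr' with h | ⟨hr', hf⟩
    · exact .inl h
    refine .inr ⟨?_, hf⟩
    rcases hrr' with rfl | hadj
    · rfl
    by_cases hU : r' ∈ U
    · exact (hno r' (hZ r' hr' hU) (.inr hadj)).elim
    · have hrU : r ∈ U := (hs.cover r r' hadj).resolve_right hU
      exact (hno r (hZ r hr₁ hrU) (Move.refl _)).elim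
  refine Finishes.walk hG hstuck (e := e') (e' := List.replicate 4 r₁) (by simp [he']) ?_ r₁ rfl
  rintro r rfl q _
  exact .of_mem_move Move.refl (a := r) (by simp) (Move.refl _)

/-- The cop number is at most a third of the size of a vertex cover, up to a constant. -/
theorem exists_copWin_of_cover [Finite V] (hG : G.Connected) (U : Finset V)
    (hU : ∀ u v, G.Adj u v → u ∈ U ∨ v ∈ U) : ∃ k, 3 * k ≤ U.card + 12 ∧ CopWin G k := by
  obtain ⟨v₀⟩ := hG.nonempty
  obtain ⟨S, Y, _, hSc, hScov, hfew⟩ := exists_static_guards G U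
  have hs : Setting G U Y S := ⟨hU, hScov, hfew⟩
  obtain ⟨gs, Z, hZY, hgc, hgs, hcov, hcl, hmax⟩ :=
    exists_responsive_guards G Y Y subset_rfl fun _ _ z' hz' _ => hz'
  refine ⟨S.length + gs.length + 4, by omega, copWin_iff.2
    ⟨S ++ gs.map Prod.fst ++ List.replicate 4 v₀, by simp; omega, fun r => ?_⟩⟩
  -- No guard is active at the start, so at first only the static guards restrict the robber.
  have hfin := finishes_of_active hG hs gs [] (by simpa using hgs)
    (by simpa using hs.finishes hG hgs hZY hcov hcl hmax) (List.replicate 4 v₀) (by simp)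
  by_cases hS : ∃ s ∈ S, Move G s r
  · obtain ⟨s, h, h'⟩ := hS
    exact .of_mem_move Move.refl (by simp [h]) h'
  push Not at hS
  refine hfin r ⟨hS, ?_, ?_⟩ _ ?_
  · intro g hg
    simp only [List.nil_append, List.mem_map] at hg
    obtain ⟨a, _, rfl⟩ := hg
    simp
  · intro g hg g' hg' z hz
    simp only [List.nil_append, List.mem_map] at hg
    obtain ⟨a, _, rfl⟩ := hg
    simp at hz
  · refine List.rel_append (forall₂_self Move.refl S) ?_
    simp only [List.nil_append, List.map_map]
    rw [List.forall₂_map_left_iff, List.forall₂_map_right_iff, List.forall₂_same]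
    intro g _
    exact move_guardPos (g.1, ∅) r

/-- One cop on every vertex wins. -/
theorem copWin_card [Fintype V] : CopWin G (Fintype.card V) :=
  copWin_iff.2 ⟨Finset.univ.toList, by simp, fun r =>
    .of_mem_move Move.refl (a := r) (by simp) (Move.refl _)⟩

theorem CopWin.mono [Finite V] [Nonempty V] {k l : ℕ} (h : CopWin G k) (hkl : k ≤ l) :
    CopWin G l := by
  obtain ⟨c, hc, hw⟩ := copWin_iff.1 h
  exact copWin_iff.2 ⟨c ++ List.replicate (l - k) (Classical.arbitrary V), by simp; omega,
    fun r => (hw r).append Move.refl _⟩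

end Bound


/-! ### Moving the cops one after the other -/

section Sequential

variable {α : Type*} {mv : α → α → Prop} {k : ℕ}

/-- The cops win the game in which one agent moves at a time: in phase `p`, the head of the list
moves and goes to the end of the list. In phase `k` this is the robber. -/
inductive TurnWin (mv : α → α → Prop) (k : ℕ) : ℕ → List α → Prop
  | base {r : α} {c : List α} (h : r ∈ c) : TurnWin mv k k (r :: c)
  | cop {p : ℕ} {a b : α} {l : List α} (hp : p < k) (hab : mv a b)
      (h : TurnWin mv k (p + 1) (l ++ [b])) : TurnWin mv k p (a :: l)
  | rob {r : α} {c : List α} (h : ∀ b, mv r b → TurnWin mv k 0 (c ++ [b])) :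
      TurnWin mv k k (r :: c)

/-- In the rotation the robber separates the cops `c₂`, who still have to move, from the cops `c₁`,
who have moved already. -/
theorem TurnWin.of_forall₂ {c₂ c₂' : List α} (h : List.Forall₂ mv c₂ c₂') (r : α) :
    ∀ (p : ℕ) (c₁ : List α), p + c₂.length = k → TurnWin mv k k (r :: (c₁ ++ c₂')) →
      TurnWin mv k p (c₂ ++ r :: c₁) := by
  induction h with
  | nil =>
    intro p c₁ hp ht
    simp only [List.length_nil, Nat.add_zero] at hp
    subst hp
    simpa using ht
  | @cons a b c c' hab _ ih =>
    intro p c₁ hp ht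
    simp only [List.length_cons] at hp
    refine .cop (by omega) hab ?_
    have := ih (p + 1) (c₁ ++ [b]) (by omega) (by simpa using ht)
    simpa using this

theorem TurnWin.of_win {c : List α} {r : α} (h : Win mv c r) (hc : c.length = k) :
    TurnWin mv k 0 (c ++ [r]) := by
  induction h with
  | capture h hr => exact .of_forall₂ h _ 0 [] (by omega) (.base hr)
  | step h _ ih =>
    exact .of_forall₂ h _ 0 [] (by omega) (.rob fun b hb => ih b hb (by rw [← h.length_eq, hc]))

theorem TurnWin.exists_forall₂ {p : ℕ} {l : List α} (h : TurnWin mv k p l)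
    (hl₀ : l.length = k + 1) :
    ∀ (c₂ : List α) (r : α) (c₁ : List α), l = c₂ ++ r :: c₁ → p + c₂.length = k →
      ∃ c₂', List.Forall₂ mv c₂ c₂' ∧ (r ∈ c₁ ++ c₂' ∨ ∀ r', mv r r' → Win mv (c₁ ++ c₂') r') := by
  induction h with
  | base h =>
    intro c₂ r c₁ hl hp
    obtain rfl : c₂ = [] := List.length_eq_zero_iff.1 (by omega)
    obtain ⟨rfl, rfl⟩ := List.cons.inj hl
    exact ⟨[], .nil, .inl (by simpa using h)⟩
  | @cop p a b l hp hab h ih =>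
    intro c₂ r c₁ hl hlen
    match c₂, hl, hlen with
    | [], _, hlen => simp at hlen; omega
    | a' :: c₂, hl, hlen =>
      obtain ⟨rfl, rfl⟩ := List.cons.inj hl
      simp only [List.length_cons] at hlen
      obtain ⟨c₂', hf, hw⟩ := ih (by simp at hl₀ ⊢; omega) c₂ r (c₁ ++ [b]) (by simp) (by omega)
      exact ⟨b :: c₂', .cons hab hf, by simpa using hw⟩
  | @rob r c h ih =>
    intro c₂ r' c₁ hl hp
    obtain rfl : c₂ = [] := List.length_eq_zero_iff.1 (by omega)
    obtain ⟨rfl, rfl⟩ := List.cons.inj hl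
    refine ⟨[], .nil, .inr fun b hb => ?_⟩
    rw [List.append_nil]
    have hck : c.length = k := by simpa using hl₀
    obtain ⟨c', hf, hw⟩ := ih b hb (by simp [hck]) c b [] rfl (by omega)
    rcases hw with h | h
    · exact .capture hf (by simpa using h)
    · exact .step hf (by simpa using h)

/-- A joint cop move is a sequence of single moves with no robber move in between. Splitting it
replaces up to `m ^ k` joint moves per position by at most `m` moves per node, which keeps the work
near `m ^ (k + 1)`. -/
theorem turnWin_zero_iff {c : List α} {r : α} (hc : c.length = k) :
    TurnWin mv k 0 (c ++ [r]) ↔ Win mv c r := by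
  refine ⟨fun h => ?_, fun h => .of_win h hc⟩
  obtain ⟨c', hf, hw⟩ := h.exists_forall₂ (by simp [hc]) c r [] rfl (by omega)
  rcases hw with h | h
  · exact .capture hf (by simpa using h)
  · exact .step hf (by simpa using h)

end Sequential

/-! ### Positions as numbers -/

section Words

/-- The `j` lowest digits of `x` in base `m`, the lowest first. -/
def word (m : ℕ) : ℕ → ℕ → List ℕ
  | 0, _ => []
  | j + 1, x => x % m :: word m j (x / m)

theorem length_word (m j x : ℕ) : (word m j x).length = j := by
  induction j generalizing x with
  | zero => rfl
  | succ j ih => simp [word, ih]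

/-- Needed for turns on numbers: the agent to move is the lowest digit, and after his move to `b` he
becomes the highest one, so `x` turns into `x / m + m ^ k * b`. -/
theorem word_append {m j x b : ℕ} (hx : x < m ^ j) (hb : b < m) :
    word m (j + 1) (x + m ^ j * b) = word m j x ++ [b] := by
  induction j generalizing x with
  | zero =>
    obtain rfl : x = 0 := by simpa using hx
    simp [word, Nat.mod_eq_of_lt hb]
  | succ j ih =>
    have h₁ : (x + m ^ (j + 1) * b) % m = x % m := by
      rw [pow_succ, mul_comm (m ^ j), mul_assoc, Nat.add_mul_mod_self_left]
    have h₂ : (x + m ^ (j + 1) * b) / m = x / m + m ^ j * b := by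
      rw [pow_succ, mul_comm (m ^ j), mul_assoc, Nat.add_mul_div_left _ _ (by omega)]
    rw [word, h₁, h₂, ih (Nat.div_lt_of_lt_mul (by rwa [mul_comm, ← pow_succ])), word,
      List.cons_append]

theorem exists_word {m : ℕ} : ∀ l : List ℕ, (∀ a ∈ l, a < m) →
    ∃ x < m ^ l.length, word m l.length x = l
  | [], _ => ⟨0, by simp [word]⟩
  | a :: l, h => by
    obtain ⟨x, hx, hw⟩ := exists_word l fun b hb => h b (by simp [hb])
    have ha : a < m := h a (by simp)
    refine ⟨a + m * x, ?_, ?_⟩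
    · rw [List.length_cons, pow_succ]
      nlinarith
    · rw [List.length_cons, word, Nat.add_mul_mod_self_left, Nat.mod_eq_of_lt ha,
        Nat.add_mul_div_left _ _ (by omega), Nat.div_eq_of_lt ha, zero_add, hw]

theorem mem_word {m j x a : ℕ} : a ∈ word m j x ↔ ∃ i < j, x / m ^ i % m = a := by
  induction j generalizing x with
  | zero => simp [word]
  | succ j ih =>
    rw [word, List.mem_cons, ih]
    constructor
    · rintro (rfl | ⟨i, hi, rfl⟩)
      · exact ⟨0, by omega, by simp⟩
      · exact ⟨i + 1, by omega, by rw [pow_succ', Nat.div_div_eq_div_mul]⟩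
    · rintro ⟨i, hi, rfl⟩
      rcases i with _ | i
      · simp
      · exact .inr ⟨i, by omega, by rw [pow_succ', Nat.div_div_eq_div_mul]⟩

/-- `TurnWin` for positions that are encoded as numbers. -/
inductive NodeWin (mv : ℕ → ℕ → Prop) (m k : ℕ) : ℕ → ℕ → Prop
  | base {x : ℕ} (hx : x < m ^ (k + 1)) (h : ∃ i < k, x / m / m ^ i % m = x % m) :
      NodeWin mv m k k x
  | cop {p x b : ℕ} (hp : p < k) (hx : x < m ^ (k + 1)) (hb : mv (x % m) b)
      (h : NodeWin mv m k (p + 1) (x / m + m ^ k * b)) : NodeWin mv m k p x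
  | rob {x : ℕ} (hx : x < m ^ (k + 1))
      (h : ∀ b, mv (x % m) b → NodeWin mv m k 0 (x / m + m ^ k * b)) : NodeWin mv m k k x

variable {mv : ℕ → ℕ → Prop} {m k : ℕ}

theorem succ_lt {x b : ℕ} (hx : x < m ^ (k + 1)) (hb : b < m) :
    x / m < m ^ k ∧ x / m + m ^ k * b < m ^ (k + 1) := by
  have h : x / m < m ^ k := Nat.div_lt_of_lt_mul (by rwa [mul_comm, ← pow_succ])
  refine ⟨h, ?_⟩
  calc x / m + m ^ k * b < m ^ k * (b + 1) := by rw [mul_add]; omega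
    _ ≤ m ^ k * m := Nat.mul_le_mul_left _ hb
    _ = m ^ (k + 1) := (pow_succ _ _).symm

theorem nodeWin_iff (hmv : ∀ a b, mv a b → b < m) {p x : ℕ} (hx : x < m ^ (k + 1)) :
    NodeWin mv m k p x ↔ TurnWin mv k p (word m (k + 1) x) := by
  constructor
  · intro h
    clear hx
    induction h with
    | base hx h => exact .base (mem_word.2 h)
    | cop hp hx hb _ ih =>
      rw [word_append (succ_lt hx (hmv _ _ hb)).1 (hmv _ _ hb)] at ih
      exact .cop hp hb ih
    | rob hx _ ih =>
      refine .rob fun b hb => ?_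
      have := ih b hb
      rwa [word_append (succ_lt hx (hmv _ _ hb)).1 (hmv _ _ hb)] at this
  · intro h
    generalize hl : word m (k + 1) x = l at h
    induction h generalizing x with
    | base h =>
      obtain ⟨rfl, rfl⟩ := List.cons.inj hl
      exact .base hx (mem_word.1 h)
    | cop hp hb _ ih =>
      obtain ⟨rfl, rfl⟩ := List.cons.inj hl
      have := succ_lt hx (hmv _ _ hb)
      exact .cop hp hx hb (ih this.2 (word_append this.1 (hmv _ _ hb)))
    | rob _ ih =>
      obtain ⟨rfl, rfl⟩ := List.cons.inj hl
      refine .rob hx fun b hb => ?_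
      have := succ_lt hx (hmv _ _ hb)
      exact ih b hb this.2 (word_append this.1 (hmv _ _ hb))

end Words

/-! ### Deleting dominated vertices -/

section Reduction

variable {V : Type*} [LinearOrder V] {G : SimpleGraph V}

/-- Another vertex has all neighbours of `u`, and further ones or a larger name. -/
def Dominated (G : SimpleGraph V) (u : V) : Prop :=
  ∃ v, (∀ w, G.Adj u w → G.Adj v w) ∧ ((∃ w, G.Adj v w ∧ ¬ G.Adj u w) ∨ u < v)

/-- Larger names break the ties between twins, so dominance is a strict order; on a finite set one
can climb from `u` to a maximal vertex. -/
theorem exists_undominated [Finite V] (G : SimpleGraph V) (u : V) :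
    ∃ v, ¬ Dominated G v ∧ ∀ w, G.Adj u w → G.Adj v w := by
  let r : V → V → Prop := fun v u =>
    (∀ w, G.Adj u w → G.Adj v w) ∧ ((∃ w, G.Adj v w ∧ ¬ G.Adj u w) ∨ u < v)
  have : IsTrans V r := ⟨fun a b c ⟨hab, hab'⟩ ⟨hbc, hbc'⟩ => by
    refine ⟨fun w hw => hab w (hbc w hw), ?_⟩
    rcases hab' with ⟨w, hw, hw'⟩ | h
    · exact .inl ⟨w, hw, fun h => hw' (hbc w h)⟩
    rcases hbc' with ⟨w, hw, hw'⟩ | h'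
    · exact .inl ⟨w, hab w hw, hw'⟩
    · exact .inr (h'.trans h)⟩
  have : Std.Irrefl r := ⟨fun a ⟨_, h⟩ => by
    rcases h with ⟨w, hw, hw'⟩ | h
    · exact hw' hw
    · exact lt_irrefl _ h⟩
  have hwf : WellFounded r := Finite.wellFounded_of_trans_of_irrefl r
  induction u using hwf.induction with
  | _ u ih =>
    by_cases h : Dominated G u
    · obtain ⟨v, hv⟩ := h
      obtain ⟨v', hv', hsub⟩ := ih v hv
      exact ⟨v', hv', fun w hw => hsub w (hv.1 w hw)⟩
    · exact ⟨u, h, fun _ h => h⟩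

/-- The number of undominated vertices, by Sperner's theorem. -/
theorem card_undominated_le [Fintype V] (U : Finset V)
    (hU : ∀ u v, G.Adj u v → u ∈ U ∨ v ∈ U) (K : Finset V) (hK : ∀ u ∈ K, ¬ Dominated G u) :
    K.card ≤ U.card + U.card.choose (U.card / 2) := by
  classical
  let N : V → Finset U := fun u => Finset.univ.filter fun x => G.Adj u x
  -- Off the cover all neighbours lie in `U`, so `N` loses nothing, and an inclusion between
  -- different vertices would make one dominate the other.
  have hN : ∀ u ∈ K \ U, ∀ v ∈ K \ U, N u ⊆ N v → u = v := by
    intro u hu v hv h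
    rw [Finset.mem_sdiff] at hu hv
    have hsub : ∀ w, G.Adj u w → G.Adj v w := by
      intro w hw
      have hwU := (hU u w hw).resolve_left hu.2
      have := @h ⟨w, hwU⟩ (by simpa [N] using hw)
      simpa [N] using this
    have hsup : ∀ w, G.Adj v w → G.Adj u w := by
      intro w hw
      by_contra hc
      exact hK u hu.1 ⟨v, hsub, .inl ⟨w, hw, hc⟩⟩
    rcases lt_trichotomy u v with h | h | h
    · exact (hK u hu.1 ⟨v, hsub, .inr h⟩).elim
    · exact h
    · exact (hK v hv.1 ⟨u, hsup, .inr h⟩).elim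
  have hanti : IsAntichain (· ⊆ ·) (((K \ U).image N : Finset (Finset U)) : Set (Finset U)) := by
    intro A hA B hB hne hAB
    simp only [Finset.coe_image, Set.mem_image, Finset.mem_coe] at hA hB
    obtain ⟨u, hu, rfl⟩ := hA
    obtain ⟨v, hv, rfl⟩ := hB
    exact hne (by rw [hN u hu v hv hAB])
  have hcard := hanti.sperner
  rw [Finset.card_image_of_injOn fun u hu v hv h => hN u hu v hv (le_of_eq h),
    Fintype.card_coe] at hcard
  have := Finset.card_le_card (show K ⊆ U ∪ (K \ U) by simp)
  exact this.trans ((Finset.card_union_le _ _).trans (Nat.add_le_add_left hcard _))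

end Reduction

/-! ### The number of cops, by solving the game on numbers -/

section Solve

variable {n : ℕ} {G : SimpleGraph (Fin n)}

/-- The moves on the vertices of the list `L`, which are named by their positions. -/
def digitMove (G : SimpleGraph (Fin n)) (L : List (Fin n)) (a b : ℕ) : Prop :=
  ∃ (ha : a < L.length) (hb : b < L.length), a = b ∨ G.Adj L[a] L[b]

/-- The list `L` of vertices suffices for the game with `k` cops. -/
structure Suffices (G : SimpleGraph (Fin n)) (k : ℕ) (L : List (Fin n)) : Prop where
  nodup : L.Nodup
  mem : ∀ u, u ∈ L ↔ (k = 1 ∨ ¬ Dominated G u)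

/-- `d` sends each vertex to a kept one with at least its neighbours. Using this at both ends of an
edge shows that `d` preserves edges, so it is a retraction, and wins transfer by `Win.map_of_hom`
and `Win.lift`. Since lifting needs a second cop, nothing is removed when `k = 1`. -/
theorem copWin_iff_nodeWin (hG : G.Connected) {k : ℕ} (hk : k ≠ 0) {L : List (Fin n)}
    (hL : Suffices G k L) :
    CopWin G k ↔ ∃ c < L.length ^ k, ∀ r < L.length,
      NodeWin (digitMove G L) L.length k 0 (c + L.length ^ k * r) := by
  classical
  obtain ⟨v₀⟩ := hG.nonempty
  have hdom : ∀ u, ∃ v ∈ L, (∀ w, G.Adj u w → G.Adj v w) ∧ ((k = 1 ∨ u ∈ L) → v = u) := by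
    intro u
    by_cases hu : u ∈ L
    · exact ⟨u, hu, fun _ h => h, fun _ => rfl⟩
    · have h1 : k ≠ 1 := fun h => hu ((hL.mem u).2 (.inl h))
      obtain ⟨v, hv, hsub⟩ := exists_undominated G u
      exact ⟨v, (hL.mem v).2 (.inr hv), hsub, fun h => (h.elim h1 hu).elim⟩
  choose d hdL hdsub hdid using hdom
  set m := L.length with hm
  let f : Fin n → ℕ := fun u => L.idxOf (d u)
  let g : ℕ → Fin n := fun a => L.getD a v₀
  have hfm : ∀ u, f u < m := fun u => List.idxOf_lt_length_iff.2 (hdL u)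
  have hg : ∀ a (ha : a < m), g a = L[a] := fun a ha => List.getD_eq_getElem _ _ ha
  have hgf : ∀ u, g (f u) = d u := fun u => by
    rw [hg _ (hfm u)]
    exact List.getElem_idxOf (hfm u)
  have hgL : ∀ a < m, g a ∈ L := fun a ha => by rw [hg a ha]; exact List.getElem_mem ha
  have hfg : ∀ a < m, f (g a) = a := fun a ha => by
    have : d (g a) = g a := hdid _ (.inr (hgL a ha))
    simp only [f, this]
    rw [hg a ha]
    exact hL.nodup.idxOf_getElem a ha
  have hmove : ∀ a b, digitMove G L a b ↔ a < m ∧ b < m ∧ (a = b ∨ G.Adj (g a) (g b)) := by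
    intro a b
    constructor
    · rintro ⟨ha, hb, h⟩
      exact ⟨ha, hb, by rwa [hg a ha, hg b hb]⟩
    · rintro ⟨ha, hb, h⟩
      exact ⟨ha, hb, by rwa [hg a ha, hg b hb] at h⟩
  have hhom : ∀ u v, Move G u v → digitMove G L (f u) (f v) := by
    intro u v h
    refine (hmove _ _).2 ⟨hfm u, hfm v, ?_⟩
    rcases h with rfl | h
    · exact .inl rfl
    · rw [hgf, hgf]
      exact .inr (hdsub v _ (hdsub u v h).symm).symm
  have hgmove : ∀ a b, digitMove G L a b → Move G (g a) (g b) := by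
    intro a b h
    obtain ⟨_, _, rfl | h⟩ := (hmove a b).1 h
    · exact Move.refl _
    · exact .inr h
  have hlt : ∀ a b, digitMove G L a b → b < m := fun a b h => ((hmove a b).1 h).2.1
  have hpow : ∀ c < m ^ k, ∀ r < m, c + m ^ k * r < m ^ (k + 1) := by
    intro c hc r hr
    calc c + m ^ k * r < m ^ k * (r + 1) := by rw [mul_add]; omega
      _ ≤ m ^ k * m := Nat.mul_le_mul_left _ hr
      _ = m ^ (k + 1) := (pow_succ _ _).symm
  rw [copWin_iff]
  constructor
  · rintro ⟨c, hc, hw⟩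
    obtain ⟨x, hx, hxw⟩ := exists_word (m := m) (c.map f) (by
      intro a ha
      obtain ⟨u, _, rfl⟩ := List.mem_map.1 ha
      exact hfm u)
    rw [List.length_map, hc] at hx hxw
    refine ⟨x, hx, fun r hr => ?_⟩
    rw [nodeWin_iff hlt (hpow x hx r hr), word_append hx hr, hxw, turnWin_zero_iff (by simp [hc])]
    exact (hw (g r)).map_of_hom f hhom g r rfl
      (fun b b' h => ⟨hfg b' (hlt _ _ h), hgmove _ _ h⟩) (hfg r hr)
  · rintro ⟨x, hx, hw⟩
    refine ⟨(word m k x).map g, by simp [length_word], fun r => ?_⟩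
    have h := hw (f r) (hfm r)
    rw [nodeWin_iff hlt (hpow x hx _ (hfm r)), word_append hx (hfm r),
      turnWin_zero_iff (length_word _ _ _)] at h
    refine h.lift Move.refl f g hhom hgmove (fun r r' h => ?_) (reflTransGen_move hG) ?_ r rfl
    · rcases h with rfl | h
      · exact .inl rfl
      · rw [hgf]
        exact .inr (.inr (hdsub r r' h))
    · rw [length_word]
      by_cases h1 : k = 1
      · exact .inr fun u => by rw [hgf]; exact hdid u (.inl h1)
      · exact .inl (by omega)

end Solve


/-! ### A structured programming language and its compilation -/

/-- Expressions; `get` reads the memory. -/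
inductive Ex where
  | lit (c : ℕ)
  | var (x : ℕ)
  | add (a b : Ex)
  | sub (a b : Ex)
  | mul (a b : Ex)
  | div (a b : Ex)
  | get (a : Ex)

/-- The state of a structured program: variables and memory. -/
structure St where
  v : ℕ → ℕ
  mem : ℕ → ℕ

def Ex.eval (s : St) : Ex → ℕ
  | lit c => c
  | var x => s.v x
  | add a b => a.eval s + b.eval s
  | sub a b => a.eval s - b.eval s
  | mul a b => a.eval s * b.eval s
  | div a b => a.eval s / b.eval s
  | get a => s.mem (a.eval s)

/-- A literal counts by its value, so that `Y ^ size` bounds it already for `Y = 2`. -/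
def Ex.size : Ex → ℕ
  | lit c => c + 1
  | var _ => 1
  | add a b => a.size + b.size + 1
  | sub a b => a.size + b.size + 1
  | mul a b => a.size + b.size + 1
  | div a b => a.size + b.size + 1
  | get a => a.size + 1

/-- Commands: assignment, store, sequence, case distinction (on `e ≠ 0`), and
`iter i b c`, which is `while i < b do (c; i := i + 1)`. -/
inductive Cm where
  | skip
  | set (x : ℕ) (e : Ex)
  | put (a e : Ex)
  | seq (c d : Cm)
  | ite (e : Ex) (c d : Cm)
  | iter (i b : ℕ) (c : Cm)

def St.set (s : St) (x a : ℕ) : St := { v := Function.update s.v x a, mem := s.mem }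

def St.put (s : St) (p a : ℕ) : St := { v := s.v, mem := Function.update s.mem p a }

/-- `Ev Y c s t s'`: the command `c` leads from `s` to `s'` in `t` elementary commands, and all
values that are assigned or stored are at most `Y`. -/
inductive Ev (Y : ℕ) : Cm → St → ℕ → St → Prop
  | skip (s : St) : Ev Y .skip s 0 s
  | set {x : ℕ} {e : Ex} {s : St} (h : e.eval s ≤ Y) : Ev Y (.set x e) s 1 (s.set x (e.eval s))
  | put {a e : Ex} {s : St} (h : e.eval s ≤ Y) :
      Ev Y (.put a e) s 1 (s.put (a.eval s) (e.eval s))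
  | seq {c d : Cm} {s s₁ s₂ : St} {t t' : ℕ} (h : Ev Y c s t s₁) (h' : Ev Y d s₁ t' s₂) :
      Ev Y (.seq c d) s (t + t') s₂
  | iteTrue {e : Ex} {c d : Cm} {s s' : St} {t : ℕ} (he : e.eval s ≠ 0) (h : Ev Y c s t s') :
      Ev Y (.ite e c d) s (1 + t) s'
  | iteFalse {e : Ex} {c d : Cm} {s s' : St} {t : ℕ} (he : e.eval s = 0) (h : Ev Y d s t s') :
      Ev Y (.ite e c d) s (1 + t) s'
  | iterDone {i b : ℕ} {c : Cm} {s : St} (h : s.v b ≤ s.v i) : Ev Y (.iter i b c) s 1 s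
  | iterStep {i b : ℕ} {c : Cm} {s s₁ s₂ : St} {t t' : ℕ} (hlt : s.v i < s.v b)
      (h : Ev Y c s t s₁) (hY : s₁.v i + 1 ≤ Y)
      (h' : Ev Y (.iter i b c) (s₁.set i (s₁.v i + 1)) t' s₂) :
      Ev Y (.iter i b c) s (1 + t + t') s₂

/-- All values are at most `Y`. -/
structure St.Bd (Y : ℕ) (s : St) : Prop where
  v : ∀ x, s.v x ≤ Y
  mem : ∀ p, s.mem p ≤ Y

theorem St.Bd.set {Y : ℕ} {s : St} (h : s.Bd Y) {x a : ℕ} (ha : a ≤ Y) : (s.set x a).Bd Y :=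
  ⟨fun y => by simp only [St.set, Function.update_apply]; split_ifs; exacts [ha, h.v y], h.mem⟩

theorem St.Bd.put {Y : ℕ} {s : St} (h : s.Bd Y) {p a : ℕ} (ha : a ≤ Y) : (s.put p a).Bd Y :=
  ⟨h.v, fun y => by simp only [St.put, Function.update_apply]; split_ifs; exacts [ha, h.mem y]⟩

theorem Ev.bd {Y : ℕ} {c : Cm} {s s' : St} {t : ℕ} (h : Ev Y c s t s') (hs : s.Bd Y) :
    s'.Bd Y := by
  induction h with
  | skip => exact hs
  | set h => exact hs.set h
  | put h => exact hs.put h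
  | seq _ _ ih ih' => exact ih' (ih hs)
  | iteTrue _ _ ih => exact ih hs
  | iteFalse _ _ ih => exact ih hs
  | iterDone => exact hs
  | iterStep _ _ hY _ ih ih' => exact ih' ((ih hs).set hY)

theorem Ex.size_pos (e : Ex) : 1 ≤ e.size := by cases e <;> simp [size]

/-- Intermediate results may exceed `Y`, but only polynomially, which costs a constant factor in
length. -/
theorem Ex.eval_le {Y : ℕ} (hY : 2 ≤ Y) {s : St} (hs : s.Bd Y) (e : Ex) :
    e.eval s ≤ Y ^ e.size := by
  have hY1 : 1 ≤ Y := by omega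
  induction e with
  | lit c =>
    calc c ≤ 2 ^ c := Nat.lt_two_pow_self.le
      _ ≤ Y ^ c := Nat.pow_le_pow_left hY c
      _ ≤ Y ^ (c + 1) := Nat.pow_le_pow_right hY1 (by omega)
  | var x => simpa [size, eval] using hs.v x
  | add a b iha ihb =>
    have ha : Y ^ a.size ≤ Y ^ (a.size + b.size) := Nat.pow_le_pow_right hY1 (by omega)
    have hb : Y ^ b.size ≤ Y ^ (a.size + b.size) := Nat.pow_le_pow_right hY1 (by omega)
    simp only [size, eval, pow_succ]
    nlinarith
  | sub a b iha ihb =>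
    exact ((Nat.sub_le _ _).trans iha).trans (Nat.pow_le_pow_right hY1 (by simp [size]; omega))
  | mul a b iha ihb =>
    calc a.eval s * b.eval s ≤ Y ^ a.size * Y ^ b.size := Nat.mul_le_mul iha ihb
      _ = Y ^ (a.size + b.size) := (pow_add _ _ _).symm
      _ ≤ Y ^ (a.size + b.size + 1) := Nat.pow_le_pow_right hY1 (by omega)
  | div a b iha ihb =>
    exact ((Nat.div_le_self _ _).trans iha).trans (Nat.pow_le_pow_right hY1 (by simp [size]; omega))
  | get a ih => exact (hs.mem _).trans (Nat.le_self_pow (by simp [size]) Y)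

theorem len_mono {a b : ℕ} (h : a ≤ b) : len a ≤ len b :=
  Nat.add_le_add_right (Nat.log_mono_right h) 1

theorem one_le_len (a : ℕ) : 1 ≤ len a := Nat.le_add_left _ _

theorem len_pow_le (Y z : ℕ) (hz : 1 ≤ z) : len (Y ^ z) ≤ z * len Y := by
  have h : Y < 2 ^ len Y := Nat.lt_pow_succ_log_self (by norm_num) Y
  have h' : Y ^ z < 2 ^ (z * len Y) := by
    rw [mul_comm, pow_mul]
    exact Nat.pow_lt_pow_left h (by omega)
  rcases Nat.eq_zero_or_pos (Y ^ z) with h0 | h0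
  · rw [h0]
    exact Nat.mul_pos hz (one_le_len Y)
  · exact Nat.log_lt_of_lt_pow (by omega) h'

theorem Ex.len_eval_le {Y : ℕ} (hY : 2 ≤ Y) {s : St} (hs : s.Bd Y) (e : Ex) :
    len (e.eval s) ≤ e.size * len Y :=
  (len_mono (e.eval_le hY hs)).trans (len_pow_le Y _ e.size_pos)

/-- Code that computes an expression into register `2 * t + 1`, with auxiliary registers
`2 * u + 1` for `u ≥ t`. The variable `x` is kept in register `2 * x`. -/
def Ex.code : Ex → ℕ → List Instr
  | lit c, t => [.const (2 * t + 1) c]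
  | var x, t => [.const (2 * t + 1) 0, .add (2 * t + 1) (2 * t + 1) (2 * x)]
  | add a b, t => a.code t ++ b.code (t + 1) ++ [.add (2 * t + 1) (2 * t + 1) (2 * (t + 1) + 1)]
  | sub a b, t => a.code t ++ b.code (t + 1) ++ [.sub (2 * t + 1) (2 * t + 1) (2 * (t + 1) + 1)]
  | mul a b, t => a.code t ++ b.code (t + 1) ++ [.mul (2 * t + 1) (2 * t + 1) (2 * (t + 1) + 1)]
  | div a b, t => a.code t ++ b.code (t + 1) ++ [.div (2 * t + 1) (2 * t + 1) (2 * (t + 1) + 1)]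
  | get a, t => a.code t ++ [.load (2 * t + 1) (2 * t + 1)]

/-- The length of the code of a command. -/
def Cm.codeLen : Cm → ℕ
  | skip => 0
  | set _ e => (e.code 0).length + 2
  | put a e => (a.code 0).length + (e.code 1).length + 1
  | seq c d => c.codeLen + d.codeLen
  | ite e c d => (e.code 0).length + 1 + c.codeLen + 1 + d.codeLen
  | iter _ _ c => c.codeLen + 5

/-- The code of a command, to be placed at position `p` of a program. -/
def Cm.code : Cm → ℕ → List Instr
  | skip, _ => []
  -- Copying is done by adding a zero from register `3`.
  | set x e, _ => e.code 0 ++ [.const 3 0, .add (2 * x) 1 3]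
  | put a e, _ => a.code 0 ++ e.code 1 ++ [.store 1 3]
  | seq c d, p => c.code p ++ d.code (p + c.codeLen)
  | ite e c d, p =>
    e.code 0 ++ [.jz 1 (p + (e.code 0).length + 1 + c.codeLen + 1)]
      ++ c.code (p + (e.code 0).length + 1)
      ++ [.jump (p + (e.code 0).length + 1 + c.codeLen + 1 + d.codeLen)]
      ++ d.code (p + (e.code 0).length + 1 + c.codeLen + 1)
  | iter i b c, p =>
    [.sub 1 (2 * b) (2 * i), .jz 1 (p + c.codeLen + 5)] ++ c.code (p + 2)
      ++ [.const 1 1, .add (2 * i) (2 * i) 1, .jump p]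

theorem Cm.length_code (c : Cm) (p : ℕ) : (c.code p).length = c.codeLen := by
  induction c generalizing p with
  | skip => rfl
  | set => simp [code, codeLen]
  | put => simp [code, codeLen]; omega
  | seq c d ihc ihd => simp [code, codeLen, ihc, ihd]
  | ite e c d ihc ihd => simp [code, codeLen, ihc, ihd]; omega
  | iter i b c ih => simp [code, codeLen, ih]

/-- The piece `l` of code stands at position `p` of the program `P`. -/
def CodeAt (P : Program) (p : ℕ) (l : List Instr) : Prop :=
  ∀ i, i < l.length → P[p + i]? = l[i]?

theorem codeAt_append {P : Program} {p : ℕ} {l l' : List Instr} :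
    CodeAt P p (l ++ l') ↔ CodeAt P p l ∧ CodeAt P (p + l.length) l' := by
  constructor
  · intro h
    refine ⟨fun i hi => ?_, fun i hi => ?_⟩
    · rw [h i (by simp; omega), List.getElem?_append_left hi]
    · rw [add_assoc, h _ (by simp; omega), List.getElem?_append_right (by omega)]
      simp
  · rintro ⟨h, h'⟩ i hi
    rcases Nat.lt_or_ge i l.length with hl | hl
    · rw [h i hl, List.getElem?_append_left hl]
    · have := h' (i - l.length) (by simp at hi; omega)
      rw [List.getElem?_append_right hl, ← this]
      congr 1
      omega

theorem codeAt_cons {P : Program} {p : ℕ} {i : Instr} {l : List Instr} :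
    CodeAt P p (i :: l) ↔ P[p]? = some i ∧ CodeAt P (p + 1) l := by
  rw [← List.singleton_append, codeAt_append]
  refine and_congr ⟨fun h => by simpa using h 0 (by simp), fun h j hj => ?_⟩ Iff.rfl
  obtain rfl : j = 0 := by simpa using hj
  simpa using h

theorem Runs.trans {P : Program} {s s' s'' : Config} {T T' : ℕ} (h : Runs P s T s')
    (h' : Runs P s' T' s'') : Runs P s (T + T') s'' := by
  induction h with
  | refl => simpa using h'
  | step hi _ ih =>
    rw [add_assoc]
    exact .step hi (ih h')

theorem Runs.single {P : Program} {s : Config} {i : Instr} (hi : P[s.pc]? = some i) :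
    Runs P s (i.cost s) (i.exec s) := .step hi (.refl _)

/-- The configuration `g` represents the state `s`. -/
structure Represents (g : Config) (s : St) : Prop where
  reg : ∀ x, g.reg (2 * x) = s.v x
  mem : g.mem = s.mem

theorem Config.setReg_reg (g : Config) (d a : ℕ) : (g.setReg d a).reg d = a :=
  Function.update_self _ _ _

theorem Represents.setReg {g : Config} {s : St} (h : Represents g s) (t a : ℕ) :
    Represents (g.setReg (2 * t + 1) a) s :=
  ⟨fun x => by
    rw [← h.reg x]
    exact Function.update_of_ne (by omega) _ _, h.mem⟩

/-- What code for an expression with value `a` achieves. -/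
def Computes (P : Program) (g : Config) (s : St) (t a l T : ℕ) : Prop :=
  ∃ T' g', Runs P g T' g' ∧ g'.pc = g.pc + l ∧ Represents g' s ∧ g'.reg (2 * t + 1) = a ∧
    (∀ u < t, g'.reg (2 * u + 1) = g.reg (2 * u + 1)) ∧ T' ≤ T

theorem Computes.binary {P : Program} {g : Config} {s : St} {t a b la lb Ta Tb c : ℕ}
    (i : Instr) (ha : Computes P g s t a la Ta)
    (hb : ∀ g', g'.pc = g.pc + la → Represents g' s → Computes P g' s (t + 1) b lb Tb)
    (hi : P[g.pc + (la + lb)]? = some i)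
    (hx : ∀ g' : Config, g'.reg (2 * t + 1) = a → g'.reg (2 * (t + 1) + 1) = b →
      i.exec g' = g'.setReg (2 * t + 1) c ∧ i.cost g' = len a + len b) {T : ℕ}
    (hT : Ta + Tb + (len a + len b) ≤ T) : Computes P g s t c (la + lb + 1) T := by
  obtain ⟨T₁, g₁, hr₁, hp₁, hs₁, hv₁, hu₁, hT₁⟩ := ha
  obtain ⟨T₂, g₂, hr₂, hp₂, hs₂, hv₂, hu₂, hT₂⟩ := hb g₁ hp₁ hs₁
  obtain ⟨he, hc⟩ := hx g₂ (by rw [hu₂ t (by omega), hv₁]) hv₂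
  have hpc : P[g₂.pc]? = some i := by rw [hp₂, hp₁, add_assoc]; exact hi
  refine ⟨T₁ + T₂ + i.cost g₂, i.exec g₂, (hr₁.trans hr₂).trans (.single hpc), ?_⟩
  rw [he, hc]
  refine ⟨?_, hs₂.setReg t c, Function.update_self _ _ _, fun u hu => ?_, by omega⟩
  · simp only [Config.setReg, hp₂, hp₁]; omega
  · rw [← hu₁ u hu, ← hu₂ u (by omega)]
    exact Function.update_of_ne (by omega) _ _

theorem Ex.computes {P : Program} {Y : ℕ} (hY : 2 ≤ Y) {s : St} (hs : s.Bd Y) (e : Ex) :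
    ∀ (t : ℕ) (g : Config), CodeAt P g.pc (e.code t) → Represents g s →
      Computes P g s t (e.eval s) (e.code t).length (4 * e.size ^ 2 * len Y) := by
  have hL := one_le_len Y
  -- The square of the size leaves room, in its mixed terms, for the lengths of the two operands.
  have hbin : ∀ a b : Ex, 4 * a.size ^ 2 * len Y + 4 * b.size ^ 2 * len Y +
      (len (a.eval s) + len (b.eval s)) ≤ 4 * (a.size + b.size + 1) ^ 2 * len Y := by
    intro a b
    have ha := a.len_eval_le hY hs
    have hb := b.len_eval_le hY hs
    nlinarith [Nat.zero_le (a.size * b.size * len Y)]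
  induction e with
  | lit c =>
    intro t g hc hg
    refine ⟨_, _, .single (codeAt_cons.1 hc).1, rfl, hg.setReg t c, Function.update_self _ _ _,
      fun u hu => Function.update_of_ne (by omega) _ _, ?_⟩
    have := (Ex.lit c).len_eval_le hY hs
    simp only [eval, size, Instr.cost] at this ⊢
    nlinarith
  | var x =>
    intro t g hc hg
    obtain ⟨h₁, h₂⟩ := codeAt_cons.1 hc
    have hg₁ := hg.setReg t 0
    refine ⟨_, _, (Runs.single h₁).trans (.single (codeAt_cons.1 h₂).1), rfl,
      hg₁.setReg t _, ?_, fun u hu => ?_, ?_⟩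
    · refine (Function.update_self _ _ _).trans ?_
      have : (g.setReg (2 * t + 1) 0).reg (2 * t + 1) = 0 := Function.update_self _ _ _
      simp only [Instr.exec]
      rw [this, hg₁.reg, zero_add, eval]
    · exact (Function.update_of_ne (by omega) _ _).trans (Function.update_of_ne (by omega) _ _)
    · have : (g.setReg (2 * t + 1) 0).reg (2 * t + 1) = 0 := Function.update_self _ _ _
      have h0 : len 0 = 1 := by simp [len]
      have hx := len_mono (hs.v x)
      simp only [Instr.cost, Instr.exec, size]
      rw [this, hg₁.reg, h0]
      omega
  | add a b iha ihb =>
    intro t g hc hg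
    obtain ⟨hab, hi⟩ := codeAt_append.1 hc
    obtain ⟨ha, hb⟩ := codeAt_append.1 hab
    simp only [code, List.length_append] at hi ⊢
    exact Computes.binary (.add (2 * t + 1) (2 * t + 1) (2 * (t + 1) + 1)) (iha t g ha hg)
      (fun g' hp hr => ihb (t + 1) g' (hp ▸ hb) hr) (codeAt_cons.1 hi).1
      (fun g' h h' => by simp [Instr.exec, Instr.cost, h, h', eval]) (hbin a b)
  | sub a b iha ihb =>
    intro t g hc hg
    obtain ⟨hab, hi⟩ := codeAt_append.1 hc
    obtain ⟨ha, hb⟩ := codeAt_append.1 hab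
    simp only [code, List.length_append] at hi ⊢
    exact Computes.binary (.sub (2 * t + 1) (2 * t + 1) (2 * (t + 1) + 1)) (iha t g ha hg)
      (fun g' hp hr => ihb (t + 1) g' (hp ▸ hb) hr) (codeAt_cons.1 hi).1
      (fun g' h h' => by simp [Instr.exec, Instr.cost, h, h', eval]) (hbin a b)
  | mul a b iha ihb =>
    intro t g hc hg
    obtain ⟨hab, hi⟩ := codeAt_append.1 hc
    obtain ⟨ha, hb⟩ := codeAt_append.1 hab
    simp only [code, List.length_append] at hi ⊢
    exact Computes.binary (.mul (2 * t + 1) (2 * t + 1) (2 * (t + 1) + 1)) (iha t g ha hg)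
      (fun g' hp hr => ihb (t + 1) g' (hp ▸ hb) hr) (codeAt_cons.1 hi).1
      (fun g' h h' => by simp [Instr.exec, Instr.cost, h, h', eval]) (hbin a b)
  | div a b iha ihb =>
    intro t g hc hg
    obtain ⟨hab, hi⟩ := codeAt_append.1 hc
    obtain ⟨ha, hb⟩ := codeAt_append.1 hab
    simp only [code, List.length_append] at hi ⊢
    exact Computes.binary (.div (2 * t + 1) (2 * t + 1) (2 * (t + 1) + 1)) (iha t g ha hg)
      (fun g' hp hr => ihb (t + 1) g' (hp ▸ hb) hr) (codeAt_cons.1 hi).1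
      (fun g' h h' => by simp [Instr.exec, Instr.cost, h, h', eval]) (hbin a b)
  | get a ih =>
    intro t g hc hg
    obtain ⟨ha, hi⟩ := codeAt_append.1 hc
    obtain ⟨T₁, g₁, hr₁, hp₁, hs₁, hv₁, hu₁, hT₁⟩ := ih t g ha hg
    rw [← hp₁] at hi
    refine ⟨_, _, hr₁.trans (.single (codeAt_cons.1 hi).1), ?_, hs₁.setReg t _,
      (Function.update_self _ _ _).trans ?_, fun u hu => ?_, ?_⟩
    · simp [Instr.exec, Config.setReg, hp₁, code]; omega
    · rw [hv₁, hs₁.mem, eval]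
    · rw [← hu₁ u hu]
      exact Function.update_of_ne (by omega) _ _
    · have h₁ := a.len_eval_le hY hs
      have h₂ := len_mono (hs.mem (a.eval s))
      simp only [Instr.cost, size]
      rw [hv₁, hs₁.mem]
      nlinarith

/-- The cost of an elementary command, in multiples of the length of the largest value. -/
def Cm.unit : Cm → ℕ
  | skip => 0
  | set _ e => 4 * e.size ^ 2 + e.size + 2
  | put a e => 4 * a.size ^ 2 + 4 * e.size ^ 2 + a.size + e.size
  | seq c d => c.unit + d.unit
  | ite e c d => 4 * e.size ^ 2 + e.size + 1 + c.unit + d.unit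
  | iter _ _ c => c.unit + 7

theorem Represents.setVar {g : Config} {s : St} (h : Represents g s) (x a : ℕ) :
    Represents (g.setReg (2 * x) a) (s.set x a) := by
  refine ⟨fun y => ?_, h.mem⟩
  simp only [Config.setReg, St.set, Function.update_apply, h.reg]
  simp

/-- Induction on the evaluation, not on the command, so that the remaining iterations of a loop fall
under the induction hypothesis. -/
theorem Ev.runs {P : Program} {Y : ℕ} (hY : 2 ≤ Y) {c : Cm} {s s' : St} {t : ℕ}
    (h : Ev Y c s t s') (hs : s.Bd Y) :
    ∀ g : Config, CodeAt P g.pc (c.code g.pc) → Represents g s →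
      ∃ T g', Runs P g T g' ∧ g'.pc = g.pc + c.codeLen ∧ Represents g' s' ∧
        T ≤ t * (c.unit * len Y) := by
  have hL := one_le_len Y
  have h0 : len 0 = 1 := by simp [len]
  have h1 : len 1 = 1 := by simp [len]
  induction h with
  | skip s => exact fun g _ hg => ⟨0, g, .refl g, rfl, hg, by omega⟩
  | @set x e s h =>
    intro g hc hg
    obtain ⟨h₁, h₂⟩ := codeAt_append.1 hc
    obtain ⟨T₁, g₁, hr₁, hp₁, hs₁, hv₁, -, hT₁⟩ := e.computes hY hs 0 g h₁ hg
    rw [← hp₁, codeAt_cons, codeAt_cons] at h₂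
    have hs₂ := hs₁.setReg 1 0
    have e₁ : (g₁.setReg 3 0).reg 1 = e.eval s := by
      rw [← hv₁]; exact Function.update_of_ne (show (1 : ℕ) ≠ 3 by norm_num) 0 g₁.reg
    have e₂ : (g₁.setReg 3 0).reg 3 = 0 := g₁.setReg_reg _ _
    refine ⟨_, _, hr₁.trans ((Runs.single h₂.1).trans (.single h₂.2.1)), ?_, ?_, ?_⟩
    · simp [Instr.exec, Config.setReg, hp₁, Cm.codeLen, add_assoc]
    · convert hs₂.setVar x (e.eval s) using 1
      simp only [Instr.exec, e₁, e₂, add_zero]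
    · have := e.len_eval_le hY hs
      simp only [Instr.cost, Instr.exec, Cm.unit, e₁, e₂, h0]
      nlinarith
  | @put a e s h =>
    intro g hc hg
    obtain ⟨h₁₂, h₃⟩ := codeAt_append.1 hc
    obtain ⟨h₁, h₂⟩ := codeAt_append.1 h₁₂
    obtain ⟨T₁, g₁, hr₁, hp₁, hs₁, hv₁, -, hT₁⟩ := a.computes hY hs 0 g h₁ hg
    obtain ⟨T₂, g₂, hr₂, hp₂, hs₂, hv₂, hu₂, hT₂⟩ := e.computes hY hs 1 g₁ (hp₁ ▸ h₂) hs₁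
    rw [List.length_append, ← add_assoc, ← hp₁, ← hp₂, codeAt_cons] at h₃
    have e₁ : g₂.reg 1 = a.eval s := (hu₂ 0 (by omega)).trans hv₁
    have e₂ : g₂.reg 3 = e.eval s := hv₂
    refine ⟨_, _, hr₁.trans (hr₂.trans (.single h₃.1)), ?_, ⟨fun x => ?_, ?_⟩, ?_⟩
    · simp [Instr.exec, hp₂, hp₁, Cm.codeLen]; omega
    · exact hs₂.reg x
    · simp only [Instr.exec, St.put, e₁, e₂, hs₂.mem]
    · have := e.len_eval_le hY hs
      have := a.len_eval_le hY hs
      simp only [Instr.cost, Cm.unit, e₁, e₂]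
      nlinarith
  | @seq c d s s₁ s₂ t t' h h' ih ih' =>
    intro g hc hg
    obtain ⟨h₁, h₂⟩ := codeAt_append.1 hc
    obtain ⟨T₁, g₁, hr₁, hp₁, hs₁, hT₁⟩ := ih hs g h₁ hg
    rw [Cm.length_code, ← hp₁] at h₂
    obtain ⟨T₂, g₂, hr₂, hp₂, hs₂, hT₂⟩ := ih' (h.bd hs) g₁ h₂ hs₁
    refine ⟨_, _, hr₁.trans hr₂, by rw [hp₂, hp₁, Cm.codeLen, add_assoc], hs₂, ?_⟩
    simp only [Cm.unit]
    have := Nat.zero_le (t * (d.unit * len Y))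
    have := Nat.zero_le (t' * (c.unit * len Y))
    nlinarith
  | @iteTrue e c d s s' t he h ih =>
    intro g hc hg
    simp only [Cm.code, codeAt_append, List.length_append, List.length_cons, List.length_nil,
      Cm.length_code, zero_add] at hc
    obtain ⟨⟨⟨⟨h₁, h₂⟩, h₃⟩, h₄⟩, h₅⟩ := hc
    obtain ⟨T₁, g₁, hr₁, hp₁, hs₁, hv₁, -, hT₁⟩ := e.computes hY hs 0 g h₁ hg
    rw [← hp₁] at h₂ h₃ h₄
    have e₁ : g₁.reg 1 = e.eval s := hv₁
    obtain ⟨T₂, g₂, hr₂, hp₂, hs₂, hT₂⟩ := ih hs ⟨g₁.pc + 1, g₁.reg, g₁.mem⟩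
      (by simpa only [← add_assoc, ← hp₁] using h₃) ⟨hs₁.reg, hs₁.mem⟩
    have hr : Runs P g₁ (len (e.eval s)) ⟨g₁.pc + 1, g₁.reg, g₁.mem⟩ := by
      have := Runs.single (codeAt_cons.1 h₂).1
      simpa only [Instr.exec, Instr.cost, e₁, if_neg he] using this
    have h₄' : P[g₂.pc]? = some (.jump (g₁.pc + 1 + c.codeLen + 1 + d.codeLen)) := by
      have := (codeAt_cons.1 h₄).1
      rw [hp₂]
      convert this using 2
      dsimp only
      omega
    refine ⟨_, _, hr₁.trans (hr.trans (hr₂.trans (.single h₄'))), ?_, ⟨hs₂.reg, hs₂.mem⟩, ?_⟩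
    · simp only [Instr.exec, Cm.codeLen]; omega
    · have := e.len_eval_le hY hs
      simp only [Instr.cost, Cm.unit]
      have := Nat.zero_le (t * (d.unit * len Y))
      have := Nat.zero_le (t * (4 * e.size ^ 2 * len Y))
      have := Nat.zero_le (t * (e.size * len Y))
      have := Nat.zero_le (t * len Y)
      have := Nat.zero_le (c.unit * len Y)
      have := Nat.zero_le (d.unit * len Y)
      nlinarith
  | @iteFalse e c d s s' t he h ih =>
    intro g hc hg
    simp only [Cm.code, codeAt_append, List.length_append, List.length_cons, List.length_nil,
      Cm.length_code, zero_add] at hc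
    obtain ⟨⟨⟨⟨h₁, h₂⟩, h₃⟩, h₄⟩, h₅⟩ := hc
    obtain ⟨T₁, g₁, hr₁, hp₁, hs₁, hv₁, -, hT₁⟩ := e.computes hY hs 0 g h₁ hg
    rw [← hp₁] at h₂
    have e₁ : g₁.reg 1 = e.eval s := hv₁
    set p := g₁.pc + 1 + c.codeLen + 1 with hp
    obtain ⟨T₂, g₂, hr₂, hp₂, hs₂, hT₂⟩ := ih hs ⟨p, g₁.reg, g₁.mem⟩ 
      (by simpa only [← add_assoc, ← hp₁] using h₅) ⟨hs₁.reg, hs₁.mem⟩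
    have hr : Runs P g₁ (len (e.eval s)) ⟨p, g₁.reg, g₁.mem⟩ := by
      have := Runs.single (codeAt_cons.1 h₂).1
      simpa only [Instr.exec, Instr.cost, e₁, if_pos he] using this
    refine ⟨_, _, hr₁.trans (hr.trans hr₂), ?_, ⟨hs₂.reg, hs₂.mem⟩, ?_⟩
    · rw [hp₂]; simp only [Cm.codeLen, hp]; omega
    · have := e.len_eval_le hY hs
      simp only [Cm.unit]
      have := Nat.zero_le (t * (c.unit * len Y))
      have := Nat.zero_le (t * (4 * e.size ^ 2 * len Y))
      have := Nat.zero_le (t * (e.size * len Y))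
      have := Nat.zero_le (t * len Y)
      have := Nat.zero_le (c.unit * len Y)
      have := Nat.zero_le (d.unit * len Y)
      nlinarith
  | @iterDone i b c s h =>
    intro g hc hg
    simp only [Cm.code, List.cons_append, List.nil_append, codeAt_cons] at hc
    obtain ⟨h₁, h₂, -⟩ := hc
    have e₁ : g.reg (2 * b) - g.reg (2 * i) = 0 := by rw [hg.reg, hg.reg]; omega
    have hr₁ : Runs P g (len (g.reg (2 * b)) + len (g.reg (2 * i))) (g.setReg 1 0) := by
      have := Runs.single h₁
      simpa only [Instr.exec, Instr.cost, e₁] using this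
    have e₂ : (g.setReg 1 0).reg 1 = 0 := g.setReg_reg _ _
    refine ⟨_, _, hr₁.trans (.single h₂), ?_, ?_, ?_⟩
    · simp only [Instr.exec, e₂, if_pos, Cm.codeLen]; omega
    · have := hg.setReg 0 0
      exact ⟨this.reg, this.mem⟩
    · simp only [Instr.cost, e₂, h0, hg.reg, Cm.unit]
      have := len_mono (hs.v b)
      have := len_mono (hs.v i)
      nlinarith [Nat.zero_le (c.unit * len Y)]
  | @iterStep i b c s s₁ s₂ t t' hlt h hY' h' ih ih' =>
    intro g hc hg
    -- Kept intact, because after the jump back the rest of the loop runs on the same code.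
    have hc' := hc
    simp only [Cm.code, List.cons_append, List.nil_append, codeAt_cons, codeAt_append,
      Cm.length_code] at hc
    obtain ⟨h₁, h₂, h₃, h₄, h₅, h₆, -⟩ := hc
    have e₁ : g.reg (2 * b) - g.reg (2 * i) = s.v b - s.v i := by rw [hg.reg, hg.reg]
    have hr₁ : Runs P g (len (g.reg (2 * b)) + len (g.reg (2 * i)))
        (g.setReg 1 (s.v b - s.v i)) := by
      have := Runs.single h₁
      simpa only [Instr.exec, Instr.cost, e₁] using this
    have e₂ : (g.setReg 1 (s.v b - s.v i)).reg 1 = s.v b - s.v i := g.setReg_reg _ _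
    have hg₁ : Represents (g.setReg 1 (s.v b - s.v i)) s := hg.setReg 0 _
    have hr₂ : Runs P (g.setReg 1 (s.v b - s.v i)) (len (s.v b - s.v i))
        ⟨g.pc + 2, (g.setReg 1 (s.v b - s.v i)).reg, g.mem⟩ := by
      have := Runs.single (s := g.setReg 1 (s.v b - s.v i)) h₂
      simp only [Instr.exec, Instr.cost, e₂] at this
      rw [if_neg (by omega)] at this
      exact this
    obtain ⟨T₃, g₃, hr₃, hp₃, hs₃, hT₃⟩ := ih hs
      ⟨g.pc + 2, (g.setReg 1 (s.v b - s.v i)).reg, g.mem⟩ h₃ ⟨hg₁.reg, hg₁.mem⟩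
    have hr₄ := Runs.single (P := P) (s := g₃) (i := .const 1 1) (by rw [hp₃]; exact h₄)
    have hr₅ := Runs.single (P := P) (s := g₃.setReg 1 1) (i := .add (2 * i) (2 * i) 1)
      (by simp only [Config.setReg, hp₃]; exact h₅)
    have e₃ : (g₃.setReg 1 1).reg 1 = 1 := g₃.setReg_reg _ _
    have hg₃ : Represents (g₃.setReg 1 1) s₁ := hs₃.setReg 0 1
    have hr₆ := Runs.single (P := P) (s := (Instr.add (2 * i) (2 * i) 1).exec (g₃.setReg 1 1))
      (i := .jump g.pc) (by simp only [Instr.exec, Config.setReg, hp₃]; exact h₆)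
    have hg₄ := hg₃.setVar i (s₁.v i + 1)
    have hb := ((h.bd hs).set (x := i) hY')
    obtain ⟨T₇, g₇, hr₇, hp₇, hs₇, hT₇⟩ := ih' hb
      ((Instr.jump g.pc).exec ((Instr.add (2 * i) (2 * i) 1).exec (g₃.setReg 1 1))) hc' (by
        refine ⟨fun x => ?_, ?_⟩
        · have := hg₄.reg x
          simp only [Instr.exec, e₃, hg₃.reg]
          exact this
        · exact hg₄.mem)
    refine ⟨_, g₇, hr₁.trans (hr₂.trans (hr₃.trans (hr₄.trans (hr₅.trans (hr₆.trans hr₇))))),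
      hp₇, hs₇, ?_⟩
    simp only [Instr.cost, e₃, hg₃.reg, h1, hg.reg]
    have := len_mono (hs.v b)
    have := len_mono (hs.v i)
    have := len_mono ((Nat.sub_le (s.v b) (s.v i)).trans (hs.v b))
    have := len_mono ((h.bd hs).v i)
    simp only [Cm.unit] at hT₇ ⊢
    have hexp : (1 + t + t') * ((c.unit + 7) * len Y) = c.unit * len Y + 7 * len Y +
        t * (c.unit * len Y) + 7 * (t * len Y) + t' * ((c.unit + 7) * len Y) := by ring
    rw [hexp]
    have := Nat.zero_le (t * len Y)
    have := Nat.zero_le (c.unit * len Y)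
    linarith

/-- A structured program, started on an input, gives a program for the machine. -/
theorem Ev.runs_start {Y : ℕ} (hY : 2 ≤ Y) {c : Cm} {input : List ℕ} {s' : St} {t : ℕ}
    (h : Ev Y c ⟨fun _ => 0, fun i => input.getD i 0⟩ t s') (hin : ∀ a ∈ input, a ≤ Y) :
    ∃ T g, Runs (c.code 0) (start input) T g ∧ Halted (c.code 0) g ∧ g.reg 0 = s'.v 0 ∧
      T ≤ t * (c.unit * len Y) := by
  obtain ⟨T, g, hr, hp, hg, hT⟩ := h.runs (P := c.code 0) hY
    ⟨fun _ => Nat.zero_le _, fun p => by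
      simp only [List.getD_eq_getElem?_getD]
      rcases Nat.lt_or_ge p input.length with h | h
      · rw [List.getElem?_eq_getElem h]
        exact hin _ (List.getElem_mem h)
      · rw [List.getElem?_eq_none h]
        exact Nat.zero_le _⟩ (start input)
    (fun i _ => by simp [start]) ⟨fun _ => rfl, rfl⟩
  refine ⟨T, g, hr, ?_, hg.reg 0, hT⟩
  rw [Halted, hp, List.getElem?_eq_none]
  rw [Cm.length_code]
  exact Nat.le_add_left _ _


/-! ### A program logic -/

section Logic

variable {Y : ℕ}

/-- The command `c`, started in `s`, takes at most `T` steps with values at most `Y`, and then `Q`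
holds. -/
def Wp (Y : ℕ) (c : Cm) (T : ℕ) (s : St) (Q : St → Prop) : Prop :=
  ∃ t s', Ev Y c s t s' ∧ t ≤ T ∧ Q s'

/-- The command does not assign to the variable `x`. -/
def Cm.fixes : Cm → ℕ → Bool
  | skip, _ => true
  | set y _, x => y != x
  | put _ _, _ => true
  | seq c d, x => c.fixes x && d.fixes x
  | ite _ c d, x => c.fixes x && d.fixes x
  | iter i _ c, x => i != x && c.fixes x

/-- The command does not store. -/
def Cm.pure : Cm → Bool
  | skip => true
  | set _ _ => true
  | put _ _ => false
  | seq c d => c.pure && d.pure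
  | ite _ c d => c.pure && d.pure
  | iter _ _ c => c.pure

@[simp] theorem St.set_v (s : St) (x a y : ℕ) : (s.set x a).v y = if y = x then a else s.v y := by
  simp [St.set, Function.update_apply]

@[simp] theorem St.set_mem (s : St) (x a : ℕ) : (s.set x a).mem = s.mem := rfl

@[simp] theorem St.put_v (s : St) (p a : ℕ) : (s.put p a).v = s.v := rfl

@[simp] theorem St.put_mem (s : St) (p a y : ℕ) :
    (s.put p a).mem y = if y = p then a else s.mem y := by
  simp [St.put, Function.update_apply]

theorem Ev.frame {c : Cm} {s s' : St} {t x : ℕ} (h : Ev Y c s t s') (hx : c.fixes x = true) :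
    s'.v x = s.v x := by
  induction h with
  | skip => rfl
  | set _ => simp only [Cm.fixes, bne_iff_ne] at hx; simp [hx.symm]
  | put _ => rfl
  | seq _ _ ih ih' =>
    simp only [Cm.fixes, Bool.and_eq_true] at hx
    rw [ih' hx.2, ih hx.1]
  | iteTrue _ _ ih => simp only [Cm.fixes, Bool.and_eq_true] at hx; exact ih hx.1
  | iteFalse _ _ ih => simp only [Cm.fixes, Bool.and_eq_true] at hx; exact ih hx.2
  | iterDone => rfl
  | iterStep _ _ _ _ ih ih' =>
    rw [ih' hx]
    simp only [Cm.fixes, Bool.and_eq_true, bne_iff_ne] at hx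
    rw [← ih hx.2]
    simp [hx.1.symm]

theorem Ev.mem_eq {c : Cm} {s s' : St} {t : ℕ} (h : Ev Y c s t s') (hx : c.pure = true) :
    s'.mem = s.mem := by
  induction h with
  | skip => rfl
  | set _ => rfl
  | put _ => simp [Cm.pure] at hx
  | seq _ _ ih ih' =>
    simp only [Cm.pure, Bool.and_eq_true] at hx
    rw [ih' hx.2, ih hx.1]
  | iteTrue _ _ ih => simp only [Cm.pure, Bool.and_eq_true] at hx; exact ih hx.1
  | iteFalse _ _ ih => simp only [Cm.pure, Bool.and_eq_true] at hx; exact ih hx.2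
  | iterDone => rfl
  | iterStep _ _ _ _ ih ih' => rw [ih' hx, St.set_mem, ih hx]

theorem Wp.mono {c : Cm} {T T' : ℕ} {s : St} {Q Q' : St → Prop} (h : Wp Y c T s Q) (hT : T ≤ T')
    (hQ : ∀ s', Q s' → Q' s') : Wp Y c T' s Q' := by
  obtain ⟨t, s', he, ht, hq⟩ := h
  exact ⟨t, s', he, ht.trans hT, hQ s' hq⟩

/-- Frame facts come along for free: `fixes` and `pure` are computable, so their side conditions
close by `rfl`, and postconditions need mention only what changes. -/
theorem Wp.conseq {c : Cm} {T : ℕ} {s : St} {Q Q' : St → Prop} (h : Wp Y c T s Q)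
    (hQ : ∀ s', Q s' → (∀ x, c.fixes x = true → s'.v x = s.v x) →
      (c.pure = true → s'.mem = s.mem) → Q' s') : Wp Y c T s Q' := by
  obtain ⟨t, s', he, ht, hq⟩ := h
  exact ⟨t, s', he, ht, hQ s' hq (fun _ => he.frame) he.mem_eq⟩

theorem Wp.skip {s : St} {Q : St → Prop} (h : Q s) {T : ℕ} : Wp Y .skip T s Q :=
  ⟨0, s, .skip s, Nat.zero_le _, h⟩

theorem Wp.set {x : ℕ} {e : Ex} {s : St} {Q : St → Prop} (hY : e.eval s ≤ Y)
    (h : Q (s.set x (e.eval s))) : Wp Y (.set x e) 1 s Q :=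
  ⟨1, _, .set hY, le_rfl, h⟩

theorem Wp.put {a e : Ex} {s : St} {Q : St → Prop} (hY : e.eval s ≤ Y)
    (h : Q (s.put (a.eval s) (e.eval s))) : Wp Y (.put a e) 1 s Q :=
  ⟨1, _, .put hY, le_rfl, h⟩

theorem Wp.seq {c d : Cm} {T T' : ℕ} {s : St} {P Q : St → Prop} (h : Wp Y c T s P)
    (h' : ∀ s₁, P s₁ → (∀ x, c.fixes x = true → s₁.v x = s.v x) →
      (c.pure = true → s₁.mem = s.mem) → Wp Y d T' s₁ Q) : Wp Y (.seq c d) (T + T') s Q := by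
  obtain ⟨t, s₁, he, ht, hp⟩ := h
  obtain ⟨t', s₂, he', ht', hq⟩ := h' s₁ hp (fun _ => he.frame) he.mem_eq
  exact ⟨_, s₂, .seq he he', Nat.add_le_add ht ht', hq⟩

theorem Wp.setSeq {x : ℕ} {e : Ex} {d : Cm} {T : ℕ} {s : St} {Q : St → Prop} (hY : e.eval s ≤ Y)
    (h : Wp Y d T (s.set x (e.eval s)) Q) : Wp Y (.seq (.set x e) d) (T + 1) s Q := by
  obtain ⟨t, s', he, ht, hq⟩ := h
  exact ⟨_, s', .seq (.set hY) he, by omega, hq⟩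

theorem Wp.putSeq {a e : Ex} {d : Cm} {T : ℕ} {s : St} {Q : St → Prop} (hY : e.eval s ≤ Y)
    (h : Wp Y d T (s.put (a.eval s) (e.eval s)) Q) : Wp Y (.seq (.put a e) d) (T + 1) s Q := by
  obtain ⟨t, s', he, ht, hq⟩ := h
  exact ⟨_, s', .seq (.put hY) he, by omega, hq⟩

theorem Wp.ite {e : Ex} {c d : Cm} {T : ℕ} {s : St} {Q : St → Prop}
    (h : e.eval s ≠ 0 → Wp Y c T s Q) (h' : e.eval s = 0 → Wp Y d T s Q) :
    Wp Y (.ite e c d) (T + 1) s Q := by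
  by_cases he : e.eval s = 0
  · obtain ⟨t, s', hev, ht, hq⟩ := h' he
    exact ⟨_, s', .iteFalse he hev, by omega, hq⟩
  · obtain ⟨t, s', hev, ht, hq⟩ := h he
    exact ⟨_, s', .iteTrue he hev, by omega, hq⟩

/-- `for i < b do c`. -/
def Cm.loop (i b : ℕ) (c : Cm) : Cm := .seq (.set i (.lit 0)) (.iter i b c)

/-- The body assigns neither counter nor bound, so there are exactly `N` rounds. `I j` speaks of the
state in which the counter has just become `j`; frame facts in the step refer back to the state
before the loop. -/
theorem Wp.loop {i b : ℕ} {c : Cm} {T N : ℕ} {s : St} (I : ℕ → St → Prop)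
    (hi : c.fixes i = true) (hb : c.fixes b = true) (hib : i ≠ b) (hN : s.v b = N) (hNY : N ≤ Y)
    (h0 : I 0 (s.set i 0))
    (hstep : ∀ j < N, ∀ s₁, I j s₁ → s₁.v i = j →
      (∀ x, i ≠ x → c.fixes x = true → s₁.v x = s.v x) → (c.pure = true → s₁.mem = s.mem) →
      Wp Y c T s₁ fun s₂ => I (j + 1) (s₂.set i (j + 1))) :
    Wp Y (.loop i b c) (N * (T + 1) + 2) s (I N) := by
  have key : ∀ l j s₁, j + l = N → I j s₁ → s₁.v i = j →
      (∀ x, i ≠ x → c.fixes x = true → s₁.v x = s.v x) → (c.pure = true → s₁.mem = s.mem) →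
      Wp Y (.iter i b c) (l * (T + 1) + 1) s₁ (I N) := by
    intro l
    induction l with
    | zero =>
      intro j s₁ hj hI hij hfr _
      refine ⟨1, s₁, .iterDone ?_, by omega, by rwa [← hj]⟩
      rw [hij, hfr b hib hb]
      omega
    | succ l ih =>
      intro j s₁ hj hI hij hfr hmem
      obtain ⟨t, s₂, he, ht, hI₂⟩ := hstep j (by omega) s₁ hI hij hfr hmem
      have hij₂ : s₂.v i = j := by rw [he.frame hi, hij]
      obtain ⟨t', s₃, he', ht', hI₃⟩ := ih (j + 1) (s₂.set i (j + 1)) (by omega) hI₂ (by simp)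
        (fun x hx hx' => by
          rw [St.set_v, if_neg hx.symm, he.frame hx', hfr x hx hx'])
        (fun hp => by rw [St.set_mem, he.mem_eq hp, hmem hp])
      refine ⟨_, s₃, .iterStep ?_ he ?_ (by rwa [hij₂]), ?_, hI₃⟩
      · rw [hij, hfr b hib hb]
        omega
      · rw [hij₂]
        omega
      · have : (l + 1) * (T + 1) = l * (T + 1) + T + 1 := by ring
        omega
  obtain ⟨t, s', he, ht, hI⟩ := key N 0 (s.set i 0) (by omega) h0 (by simp)
    (fun x hx _ => by simp [hx.symm]) fun _ => rfl
  exact ⟨_, s', .seq (.set (e := .lit 0) (Nat.zero_le _)) he, by omega, hI⟩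

end Logic


/-! ### Expressions and memory layout of the algorithm -/

section Layout

def neE (a b : Ex) : Ex := .add (.sub a b) (.sub b a)

/-- The entry of the adjacency matrix. -/
def adjE (a b : Ex) : Ex := .get (.add (.add (.lit 1) (.mul a (.var 1))) b)

/-- The vertex with a given position in the list of vertices. -/
def nameE (a : Ex) : Ex := .get (.add (.add (.mul (.var 1) (.var 1)) (.lit 1)) a)

def moveE (a b : Ex) : Ex := .add (.sub (.lit 1) (neE a b)) (adjE (nameE a) (nameE b))

/-- The address of the mark of a node. -/
def markE (e : Ex) : Ex :=
  .add (.add (.mul (.var 1) (.var 1)) (.add (.lit 1) (.var 1))) (.mul (.lit 2) e)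

/-- The address of an entry of the queue. -/
def queueE (e : Ex) : Ex := .add (markE e) (.lit 1)

variable {n m k : ℕ} {G : SimpleGraph (Fin n)} {L : List (Fin n)} {s s' : St}

open Classical in
/-- The memory holds the graph. -/
structure GraphMem (G : SimpleGraph (Fin n)) (s : St) : Prop where
  v1 : s.v 1 = n
  adj : ∀ u v : Fin n, s.mem (1 + u * n + v) = if G.Adj u v then 1 else 0

/-- The memory holds the graph, a list of vertices, and the parameters of the game on it. -/
structure GameMem (G : SimpleGraph (Fin n)) (L : List (Fin n)) (k : ℕ) (s : St) : Prop
    extends GraphMem G s where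
  name : ∀ (i : ℕ) (h : i < L.length), s.mem (n * n + 1 + i) = L[i]
  length_le : L.length ≤ n
  v4 : s.v 4 = L.length
  v5 : s.v 5 = k
  v6 : s.v 6 = L.length ^ k
  v7 : s.v 7 = L.length ^ (k + 1)
  v8 : s.v 8 = L.length ^ (k + 1) * (k + 1)

theorem adj_addr_lt (u v : Fin n) : 1 + u * n + v < n * n + 1 := by
  have := Nat.mul_le_mul_right n (Nat.succ_le_of_lt u.2)
  rw [Nat.succ_mul] at this
  omega

theorem GraphMem.congr (h : GraphMem G s) (h1 : s'.v 1 = s.v 1)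
    (hm : ∀ p < n * n + 1, s'.mem p = s.mem p) : GraphMem G s' :=
  ⟨h1.trans h.v1, fun u v => (hm _ (adj_addr_lt u v)).trans (h.adj u v)⟩

/-- Variable `0` is the answer; the variables from `9` on and the memory behind the names are
scratch. -/
theorem GameMem.congr (h : GameMem G L k s) (hv : ∀ x, x ≠ 0 → x < 9 → s'.v x = s.v x)
    (hm : ∀ p < n * n + (1 + n), s'.mem p = s.mem p) : GameMem G L k s' where
  toGraphMem := h.toGraphMem.congr (hv 1 (by norm_num) (by norm_num)) fun p hp => hm p (by omega)
  name i hi := (hm _ (by have := h.length_le; omega)).trans (h.name i hi)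
  length_le := h.length_le
  v4 := (hv 4 (by norm_num) (by norm_num)).trans h.v4
  v5 := (hv 5 (by norm_num) (by norm_num)).trans h.v5
  v6 := (hv 6 (by norm_num) (by norm_num)).trans h.v6
  v7 := (hv 7 (by norm_num) (by norm_num)).trans h.v7
  v8 := (hv 8 (by norm_num) (by norm_num)).trans h.v8

theorem GraphMem.eval_adjE (h : GraphMem G s) {a b : Ex} {u v : Fin n} (ha : a.eval s = u)
    (hb : b.eval s = v) : (adjE a b).eval s ≠ 0 ↔ G.Adj u v := by
  simp [adjE, Ex.eval, ha, hb, h.v1, h.adj]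

/-- The names stand directly behind the matrix, where the input holds the digits of `k`; these have
been read by then. -/
theorem GameMem.eval_nameE (h : GameMem G L k s) {a : Ex} (ha : a.eval s < L.length) :
    (nameE a).eval s = L[a.eval s] := by
  simp [nameE, Ex.eval, h.v1, h.name _ ha]

theorem GameMem.eval_moveE (h : GameMem G L k s) {a b : Ex} (ha : a.eval s < L.length)
    (hb : b.eval s < L.length) :
    (moveE a b).eval s ≠ 0 ↔ digitMove G L (a.eval s) (b.eval s) := by
  have hadj := h.toGraphMem.eval_adjE (h.eval_nameE ha) (h.eval_nameE hb)
  have hne : (neE a b).eval s = 0 ↔ a.eval s = b.eval s := by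
    simp only [neE, Ex.eval]; omega
  have : (moveE a b).eval s ≠ 0 ↔ (neE a b).eval s = 0 ∨ (adjE (nameE a) (nameE b)).eval s ≠ 0 := by
    simp only [moveE, Ex.eval]; omega
  rw [this, hne, hadj]
  exact ⟨fun h => ⟨ha, hb, h⟩, fun ⟨_, _, h⟩ => h⟩

/-- `n * n + (1 + n)` is the first address behind the matrix and the space for names. Marks take the
even offsets from there and queue entries the odd ones, so they never collide. -/
theorem GraphMem.eval_markE (h : GraphMem G s) (e : Ex) :
    (markE e).eval s = n * n + (1 + n) + 2 * e.eval s := by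
  simp [markE, Ex.eval, h.v1]

theorem GraphMem.eval_queueE (h : GraphMem G s) (e : Ex) :
    (queueE e).eval s = n * n + (1 + n) + 2 * e.eval s + 1 := by
  simp [queueE, Ex.eval, h.eval_markE]

theorem node_inj {N p x p' x' : ℕ} (hx : x < N) (hx' : x' < N) (h : p * N + x = p' * N + x') :
    p = p' ∧ x = x' := by
  have hp : p = p' := by
    have h₁ : (p * N + x) / N = p := by
      rw [mul_comm, Nat.mul_add_div (by omega), Nat.div_eq_of_lt hx, add_zero]
    have h₂ : (p' * N + x') / N = p' := by
      rw [mul_comm, Nat.mul_add_div (by omega), Nat.div_eq_of_lt hx', add_zero]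
    rw [← h₁, h, h₂]
  subst hp
  exact ⟨rfl, by omega⟩

theorem node_lt {N p x : ℕ} (hp : p ≤ k) (hx : x < N) : p * N + x < N * (k + 1) := by
  calc p * N + x < (p + 1) * N := by rw [Nat.succ_mul]; omega
    _ ≤ (k + 1) * N := Nat.mul_le_mul_right _ (by omega)
    _ = N * (k + 1) := mul_comm _ _

/-- The memory holds a queue that lists the marked nodes. -/
structure Queue (n m k : ℕ) (l : List (ℕ × ℕ)) (s : St) : Prop where
  tail : s.v 17 = l.length
  entry : ∀ (i : ℕ) (h : i < l.length),
    s.mem (n * n + (1 + n) + 2 * i + 1) = l[i].1 * m ^ (k + 1) + l[i].2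
  mark : ∀ p ≤ k, ∀ x < m ^ (k + 1),
    s.mem (n * n + (1 + n) + 2 * (p * m ^ (k + 1) + x)) ≠ 0 ↔ (p, x) ∈ l
  nodup : l.Nodup
  valid : ∀ a ∈ l, a.1 ≤ k ∧ a.2 < m ^ (k + 1)

/-- Each node enters the queue at most once, so as many rounds as there are nodes exhaust it. -/
theorem length_le_of_valid {N : ℕ} {l : List (ℕ × ℕ)} (hn : l.Nodup)
    (hv : ∀ a ∈ l, a.1 ≤ k ∧ a.2 < N) : l.length ≤ N * (k + 1) := by
  rw [← List.toFinset_card_of_nodup hn]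
  refine (Finset.card_le_card (t := Finset.range (k + 1) ×ˢ Finset.range N) ?_).trans ?_
  · intro a ha
    have := hv a (List.mem_toFinset.1 ha)
    simp only [Finset.mem_product, Finset.mem_range]
    omega
  · simp [mul_comm]

theorem Queue.congr {l : List (ℕ × ℕ)} (h : Queue n m k l s) (h17 : s'.v 17 = s.v 17)
    (hm : s'.mem = s.mem) : Queue n m k l s' :=
  ⟨h17.trans h.tail, by rw [hm]; exact h.entry, by rw [hm]; exact h.mark, h.nodup, h.valid⟩

/-- Mark the node in variable `18` and put it into the queue, unless it is marked. -/
def pushC : Cm :=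
  .ite (.get (markE (.var 18))) .skip
    (.seq (.put (markE (.var 18)) (.lit 1))
      (.seq (.put (queueE (.var 17)) (.var 18)) (.set 17 (.add (.var 17) (.lit 1)))))

theorem wp_pushC {Y : ℕ} {l : List (ℕ × ℕ)} (hg : GraphMem G s) (hl : Queue n m k l s) {p x : ℕ}
    (hp : p ≤ k) (hx : x < m ^ (k + 1)) (h18 : s.v 18 = p * m ^ (k + 1) + x)
    (hY : m ^ (k + 1) * (k + 1) ≤ Y) :
    Wp Y pushC 4 s fun s' => (∃ l', Queue n m k l' s' ∧ l <+: l' ∧ (p, x) ∈ l' ∧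
      ∀ a ∈ l', a ∈ l ∨ a = (p, x)) ∧ ∀ q < n * n + (1 + n), s'.mem q = s.mem q := by
  have hY' := node_lt hp hx
  refine Wp.ite (fun he => Wp.skip ?_) fun he => ?_
  · simp only [Ex.eval, hg.eval_markE, h18] at he
    exact ⟨⟨l, hl, List.prefix_rfl, (hl.mark p hp x hx).1 he, fun a ha => .inl ha⟩, fun _ _ => rfl⟩
  · simp only [Ex.eval, hg.eval_markE, h18] at he
    have hnew : (p, x) ∉ l := fun h => (hl.mark p hp x hx).2 h he
    have hnd : (l ++ [(p, x)]).Nodup :=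
      List.nodup_append.2 ⟨hl.nodup, by simp, fun a ha b hb hab => hnew (by simp_all)⟩
    have hval : ∀ a ∈ l ++ [(p, x)], a.1 ≤ k ∧ a.2 < m ^ (k + 1) := by
      intro a ha
      rcases List.mem_append.1 ha with ha | ha
      · exact hl.valid a ha
      · rw [List.mem_singleton.1 ha]; exact ⟨hp, hx⟩
    have hlen := length_le_of_valid hnd hval
    simp only [List.length_append, List.length_singleton] at hlen
    refine Wp.putSeq (by simp only [Ex.eval]; omega) (Wp.putSeq ?_ (Wp.set ?_ ?_))
    · simp only [Ex.eval, St.put_v, h18]; omega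
    · simp only [Ex.eval, St.put_v, hl.tail]; omega
    have hg' : GraphMem G (s.put (n * n + (1 + n) + 2 * (p * m ^ (k + 1) + x)) 1) := by
      refine hg.congr rfl fun q hq => ?_
      rw [St.put_mem, if_neg (by omega)]
    simp only [hg'.eval_queueE, hg.eval_markE, Ex.eval, St.put_v, h18, hl.tail]
    refine ⟨⟨l ++ [(p, x)], ⟨by simp, fun i hi => ?_, fun p' hp' x' hx' => ?_, hnd, hval⟩,
      List.prefix_append _ _, by simp, by simp⟩, fun q hq => ?_⟩
    · simp only [St.set_mem, St.put_mem]
      simp only [List.length_append, List.length_singleton] at hi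
      rcases Nat.lt_or_ge i l.length with hil | hil
      · rw [if_neg (by omega), if_neg (by omega), hl.entry i hil, List.getElem_append_left hil]
      · obtain rfl : i = l.length := by omega
        simp
    · simp only [St.set_mem, St.put_mem]
      rw [if_neg (by omega)]
      by_cases heq : p' * m ^ (k + 1) + x' = p * m ^ (k + 1) + x
      · obtain ⟨rfl, rfl⟩ := node_inj hx' hx heq
        simp
      · rw [if_neg (by omega), hl.mark p' hp' x' hx', List.mem_append, List.mem_singleton,
          Prod.mk.injEq, or_iff_left]
        rintro ⟨rfl, rfl⟩
        exact heq rfl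
    · simp only [St.set_mem, St.put_mem]
      rw [if_neg (by omega), if_neg (by omega)]

end Layout

/-! ### Solving the game by a worklist -/

section Worklist

variable {n k Y : ℕ} {G : SimpleGraph (Fin n)} {L : List (Fin n)} {s : St}

/-- Empty the queue. -/
def clearC : Cm := .seq (.loop 9 8 (.put (markE (.var 9)) (.lit 0))) (.set 17 (.lit 0))

theorem wp_clearC (hg : GameMem G L k s) (hY : L.length ^ (k + 1) * (k + 1) ≤ Y) :
    Wp Y clearC (L.length ^ (k + 1) * (k + 1) * 2 + 3) s fun s' =>
      Queue n L.length k [] s' ∧ GameMem G L k s' := by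
  refine (Wp.seq (T := L.length ^ (k + 1) * (k + 1) * (1 + 1) + 2) (T' := 1) (Wp.loop
    (fun j s' => (∀ x < j, s'.mem (n * n + (1 + n) + 2 * x) = 0) ∧
      ∀ q < n * n + (1 + n), s'.mem q = s.mem q) rfl rfl (by norm_num) hg.v8 hY (by simp)
    fun j hj s₁ ⟨hI, hI'⟩ h9 hfr _ => ?_) fun s₁ ⟨h, h'⟩ hfr _ => ?_)
  · have hg₁ : GraphMem G s₁ := hg.toGraphMem.congr (hfr 1 (by norm_num) rfl)
      fun p hp => hI' p (by omega)
    refine Wp.put (Nat.zero_le _) ?_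
    simp only [hg₁.eval_markE, Ex.eval, h9, St.set_mem, St.put_mem]
    refine ⟨fun x hx => ?_, fun q hq => ?_⟩
    · split_ifs with hc
      · rfl
      · exact hI x (by omega)
    · rw [if_neg (by omega)]
      exact hI' q hq
  · refine Wp.set (Nat.zero_le _) ⟨⟨by simp [Ex.eval], by simp, ?_, by simp, by simp⟩, ?_⟩
    · intro p hp x hx
      simp [h _ (node_lt hp hx)]
    · refine hg.congr (fun x h0 h9 => ?_) h'
      rw [St.set_v, if_neg (by omega)]
      exact hfr x (by interval_cases x <;> rfl)

/-- Put the final positions into the queue. -/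
def baseC : Cm :=
  .loop 9 6 (.loop 10 4 (.seq (.set 11 (.var 9)) (.seq (.set 13 (.lit 0))
    (.seq (.loop 12 5 (.seq
        (.ite (neE (.sub (.var 11) (.mul (.div (.var 11) (.var 4)) (.var 4))) (.var 10)) .skip
          (.set 13 (.lit 1)))
        (.set 11 (.div (.var 11) (.var 4)))))
      (.ite (.var 13)
        (.seq (.set 18 (.add (.mul (.var 5) (.var 7)) (.add (.var 10) (.mul (.var 4) (.var 9)))))
          pushC) .skip)))))

theorem mod_eq (a b : ℕ) : a - a / b * b = a % b := by
  rw [Nat.mod_eq_sub_mul_div, mul_comm]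

theorem pair_lt {m y r : ℕ} (hy : y < m ^ k) (hr : r < m) : r + m * y < m ^ (k + 1) := by
  calc r + m * y < m * (y + 1) := by rw [mul_add]; omega
    _ ≤ m * m ^ k := Nat.mul_le_mul_left _ hy
    _ = m ^ (k + 1) := (pow_succ' _ _).symm

theorem pair_mod {m y r : ℕ} (hr : r < m) : (r + m * y) % m = r ∧ (r + m * y) / m = y := by
  rw [Nat.add_mul_mod_self_left, Nat.mod_eq_of_lt hr, Nat.add_mul_div_left _ _ (by omega),
    Nat.div_eq_of_lt hr, zero_add]
  exact ⟨rfl, rfl⟩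

/-- All marked nodes are won. -/
def Sound (G : SimpleGraph (Fin n)) (L : List (Fin n)) (k : ℕ) (l : List (ℕ × ℕ)) : Prop :=
  ∀ a ∈ l, NodeWin (digitMove G L) L.length k a.1 a.2

theorem wp_baseC (hg : GameMem G L k s) (hq : Queue n L.length k [] s) (hpos : 0 < L.length) (hk : k ≤ n)
    (hnY : n ≤ Y) (hY : L.length ^ (k + 1) * (k + 1) ≤ Y) :
    Wp Y baseC (L.length ^ k * (L.length * (k * 4 + 10 + 1) + 2 + 1) + 2) s fun s' => GameMem G L k s' ∧
      ∃ l, Queue n L.length k l s' ∧ Sound G L k l ∧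
        ∀ y < L.length ^ k, ∀ r < L.length, (∃ i < k, y / L.length ^ i % L.length = r) →
          (k, r + L.length * y) ∈ l := by
  have hMY : ∀ y < L.length ^ k, ∀ r < L.length, r + L.length * y < Y := fun y hy r hr =>
    (pair_lt hy hr).trans_le ((Nat.le_mul_of_pos_right _ (by omega)).trans hY)
  have hyY : ∀ y < L.length ^ k, ∀ r < L.length, y ≤ Y := fun y hy r hr =>
    (Nat.le_mul_of_pos_left y (show 0 < L.length by omega)).trans
      ((Nat.le_add_left _ r).trans (hMY y hy r hr).le)
  have hmn : L.length ≤ n := hg.length_le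
  have hMY' : L.length ^ k ≤ Y := (Nat.pow_le_pow_right hpos (Nat.le_succ k)).trans
    ((Nat.le_mul_of_pos_right _ (by omega)).trans hY)
  refine (Wp.loop (T := L.length * (k * 4 + 10 + 1) + 2) (fun j s' => GameMem G L k s' ∧
      ∃ l, Queue n L.length k l s' ∧ Sound G L k l ∧
        ∀ y < j, ∀ r < L.length, (∃ i < k, y / L.length ^ i % L.length = r) → (k, r + L.length * y) ∈ l) rfl rfl (by norm_num)
      hg.v6 hMY' ?_ fun y hy s₁ ⟨hg₁, l, hl, hs, hc⟩ h9 _ _ => ?_)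
  · exact ⟨hg.congr (fun x _ h => by simp [show x ≠ 9 by omega]) fun _ _ => rfl, [],
      hq.congr (by simp) rfl, by simp [Sound], by simp⟩
  refine (Wp.loop (T := k * 4 + 10) (fun j s' => GameMem G L k s' ∧
      ∃ l', Queue n L.length k l' s' ∧ Sound G L k l' ∧ l <+: l' ∧
        ∀ r < j, (∃ i < k, y / L.length ^ i % L.length = r) → (k, r + L.length * y) ∈ l') rfl rfl (by norm_num)
      hg₁.v4 (hmn.trans hnY) ?_ fun r hr s₂ ⟨hg₂, l', hl', hs', hpre, hc'⟩ h10 hfr₂ _ => ?_).conseq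
      fun s₂ ⟨hg₂, l', hl', hs', hpre, hc'⟩ hfr _ => ?_
  · exact ⟨hg₁.congr (fun x _ h => by simp [show x ≠ 10 by omega]) fun _ _ => rfl, l,
      hl.congr (by simp) rfl, hs, List.prefix_rfl, by simp⟩
  · have h9₂ : s₂.v 9 = y := (hfr₂ 9 (by norm_num) rfl).trans h9
    have hyY₁ : y ≤ Y := hyY y hy r hr
    refine Wp.mono (T := k * (2 + 1 + 1) + 2 + 6 + 1 + 1) ?_ (by omega) fun _ h => h
    refine Wp.setSeq (by simpa [Ex.eval, h9₂] using hyY₁) (Wp.setSeq (Nat.zero_le _) ?_)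
    -- Variable `11` is divided down through the digits of `y`, the positions of the cops, and `13`
    -- records whether one of them is `r`.
    refine Wp.seq (T := k * (2 + 1 + 1) + 2) (T' := 6) (Wp.loop (N := k)
      (fun j s' => s'.v 11 = y / L.length ^ j ∧ (s'.v 13 ≠ 0 ↔ ∃ i < j, y / L.length ^ i % L.length = r))
      rfl rfl (by norm_num) (by simpa using hg₂.v5) (hk.trans hnY) ?_
      fun j hj s₃ ⟨h11, h13⟩ h12 hfr₃ _ => ?_) fun s₃ ⟨h11, h13⟩ hfr₃ hmem₃ => ?_
    · simp [Ex.eval, h9₂]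
    · have h4 : s₃.v 4 = L.length := (hfr₃ 4 (by norm_num) rfl).trans (by simpa using hg₂.v4)
      have h10₃ : s₃.v 10 = r := (hfr₃ 10 (by norm_num) rfl).trans (by simpa using h10)
      have hdiv : y / L.length ^ j / L.length = y / L.length ^ (j + 1) := by rw [Nat.div_div_eq_div_mul, pow_succ]
      have hdivY : y / L.length ^ j / L.length ≤ Y :=
        ((Nat.div_le_self _ _).trans (Nat.div_le_self _ _)).trans hyY₁
      have hcond : (neE (.sub (.var 11) (.mul (.div (.var 11) (.var 4)) (.var 4)))
          (.var 10)).eval s₃ = 0 ↔ y / L.length ^ j % L.length = r := by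
        simp only [neE, Ex.eval, h11, h4, h10₃, mod_eq]
        omega
      refine Wp.seq (T := 1 + 1) (T' := 1)
        (P := fun s' => s'.v 11 = y / L.length ^ j ∧ s'.v 4 = L.length ∧
          (s'.v 13 ≠ 0 ↔ ∃ i < j + 1, y / L.length ^ i % L.length = r)) (Wp.ite (fun he => Wp.skip ?_) fun he =>
            Wp.set ?_ ?_) fun s₄ ⟨h₁, h₂, h₃⟩ _ _ => Wp.set ?_ ?_
      · refine ⟨h11, h4, h13.trans ⟨fun ⟨i, hi, h⟩ => ⟨i, by omega, h⟩, fun ⟨i, hi, h⟩ => ⟨i, ?_, h⟩⟩⟩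
        rcases Nat.lt_succ_iff_lt_or_eq.1 hi with hi | rfl
        · exact hi
        · exact (he (hcond.2 h)).elim
      · simp only [Ex.eval]; omega
      · simp only [St.set_v, Ex.eval]
        exact ⟨by simpa using h11, by simpa using h4, by simpa using ⟨j, by omega, hcond.1 he⟩⟩
      · simpa [Ex.eval, h₁, h₂] using hdivY
      · simp only [Ex.eval, h₁, h₂, hdiv]
        exact ⟨by simp, by simpa using h₃⟩
    · have hmem₃' : s₃.mem = s₂.mem := hmem₃ rfl
      have hg₃ : GameMem G L k s₃ := hg₂.congr (fun x h0 h9 => by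
        rw [hfr₃ x (by interval_cases x <;> rfl)]
        simp [show x ≠ 11 by omega, show x ≠ 13 by omega]) fun p _ => by rw [hmem₃']
      have hl₃ : Queue n L.length k l' s₃ := hl'.congr ((hfr₃ 17 rfl).trans (by simp)) hmem₃'
      have h9₃ : s₃.v 9 = y := (hfr₃ 9 rfl).trans (by simpa using h9₂)
      have h10₃ : s₃.v 10 = r := (hfr₃ 10 rfl).trans (by simpa using h10)
      have hx := pair_lt hy hr
      have hmod := pair_mod (y := y) hr
      refine Wp.ite (fun he => ?_) fun he => Wp.skip ?_
      · simp only [Ex.eval] at he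
        have hnode : k * L.length ^ (k + 1) + (r + L.length * y) < L.length ^ (k + 1) * (k + 1) := node_lt le_rfl hx
        have hev : (Ex.add (.mul (.var 5) (.var 7)) (.add (.var 10) (.mul (.var 4) (.var 9)))).eval s₃
            = k * L.length ^ (k + 1) + (r + L.length * y) := by
          simp only [Ex.eval, hg₃.v5, hg₃.v7, hg₃.v4, h9₃, h10₃]
        refine Wp.setSeq (by rw [hev]; omega) ?_
        rw [hev]
        have hg₄ : GameMem G L k (s₃.set 18 (k * L.length ^ (k + 1) + (r + L.length * y))) :=
          hg₃.congr (fun x _ h => by simp [show x ≠ 18 by omega]) fun _ _ => rfl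
        refine (wp_pushC hg₄.toGraphMem (hl₃.congr (by simp) rfl) le_rfl hx (by simp) hY).conseq ?_
        rintro s₅ ⟨⟨l₂, hl₂, hpre₂, hin, hsub⟩, hm₅⟩ hfr₅ _
        refine ⟨hg₄.congr (fun x h0 h9 => ?_) fun p hp => ?_, l₂, hl₂.congr (by simp) rfl, ?_,
          hpre.trans hpre₂, ?_⟩
        · rw [St.set_v, if_neg (by omega)]
          exact hfr₅ x (by interval_cases x <;> rfl)
        · exact hm₅ p hp
        · intro a ha
          rcases hsub a ha with h | rfl
          · exact hs' a h
          · exact .base hx (by rw [hmod.1, hmod.2]; exact h13.1 he)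
        · intro r' hr' h
          rcases Nat.lt_succ_iff_lt_or_eq.1 hr' with h' | rfl
          · exact hpre₂.subset (hc' r' h' h)
          · exact hin
      · simp only [Ex.eval] at he
        refine ⟨hg₃.congr (fun x _ h => by simp [show x ≠ 10 by omega]) fun _ _ => rfl, l',
          hl₃.congr (by simp) rfl, hs', hpre, ?_⟩
        intro r' hr' h
        rcases Nat.lt_succ_iff_lt_or_eq.1 hr' with h' | rfl
        · exact hc' r' h' h
        · exact absurd he (h13.2 h)
  · refine ⟨hg₂.congr (fun x _ h => by simp [show x ≠ 9 by omega]) fun _ _ => rfl, l',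
      hl'.congr (by simp) rfl, hs', ?_⟩
    intro y' hy' r hr h
    rcases Nat.lt_succ_iff_lt_or_eq.1 hy' with h' | rfl
    · exact hpre.subset (hc y' h' r hr h)
    · exact hc' r hr h

end Worklist


/-! ### Predecessors of won nodes and closure of the worklist -/

section Worklist

variable {n k Y : ℕ} {G : SimpleGraph (Fin n)} {L : List (Fin n)} {s : St}

/-- A node that is won if all nodes of `Z` are, by one more move. -/
def Enabled (G : SimpleGraph (Fin n)) (L : List (Fin n)) (k : ℕ) (Z : List (ℕ × ℕ)) (p x : ℕ) :
    Prop :=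
  (p < k ∧ ∃ b, digitMove G L (x % L.length) b ∧
    (p + 1, x / L.length + L.length ^ k * b) ∈ Z) ∨
  (p = k ∧ ∀ b, digitMove G L (x % L.length) b → (0, x / L.length + L.length ^ k * b) ∈ Z)

theorem digitMove_lt {a b : ℕ} (h : digitMove G L a b) : a < L.length ∧ b < L.length :=
  ⟨h.1, h.2.1⟩

theorem digitMove_self {a : ℕ} (h : a < L.length) : digitMove G L a a := ⟨h, h, .inl rfl⟩

theorem not_enabled_nil {p x : ℕ} (hpos : 0 < L.length) : ¬ Enabled G L k [] p x := by
  rintro (⟨_, b, _, h⟩ | ⟨_, h⟩)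
  · exact absurd h (by simp)
  · exact absurd (h _ (digitMove_self (Nat.mod_lt x hpos))) (by simp)

/-- A node that becomes enabled by a new node is a predecessor of it. -/
theorem Enabled.of_concat {Z : List (ℕ × ℕ)} {p x q z : ℕ} (hx : x < L.length ^ (k + 1))
    (h : Enabled G L k (Z ++ [(q, z)]) p x) :
    Enabled G L k Z p x ∨ (digitMove G L (x % L.length) (z / L.length ^ k) ∧
      x = x % L.length + L.length * (z % L.length ^ k) ∧ p = (q - 1) + k * (1 - q)) := by
  -- Undoing a move: the highest digit of `z` is the agent who moved last, and the predecessor has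
  -- his former position as lowest digit. With truncated subtraction, `(q - 1) + k * (1 - q)` is the
  -- phase before `q` in cyclic order, namely `k` for `q = 0`.
  have key : ∀ b, digitMove G L (x % L.length) b → z = x / L.length + L.length ^ k * b →
      digitMove G L (x % L.length) (z / L.length ^ k) ∧
        x = x % L.length + L.length * (z % L.length ^ k) := by
    intro b hb hz
    have hlt := (succ_lt hx (digitMove_lt hb).2).1
    have h₁ := pair_mod (y := b) hlt
    rw [hz, h₁.1, h₁.2]
    exact ⟨hb, (Nat.mod_add_div x _).symm⟩
  rcases h with ⟨hp, b, hb, h⟩ | ⟨rfl, h⟩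
  · rcases List.mem_append.1 h with h | h
    · exact .inl (.inl ⟨hp, b, hb, h⟩)
    · obtain ⟨rfl, rfl⟩ := Prod.mk.injEq _ _ _ _ ▸ List.mem_singleton.1 h
      obtain ⟨h₁, h₂⟩ := key b hb rfl
      exact .inr ⟨h₁, h₂, by simp⟩
  · by_cases hall : ∀ b, digitMove G L (x % L.length) b →
        (0, x / L.length + L.length ^ p * b) ∈ Z
    · exact .inl (.inr ⟨rfl, hall⟩)
    · push Not at hall
      obtain ⟨b, hb, hn⟩ := hall
      have := List.mem_singleton.1 ((List.mem_append.1 (h b hb)).resolve_left hn)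
      obtain ⟨rfl, rfl⟩ := Prod.mk.injEq _ _ _ _ ▸ this
      obtain ⟨h₁, h₂⟩ := key b hb rfl
      exact .inr ⟨h₁, h₂, by simp⟩

/-- A list of nodes that contains the final positions and is closed under `Enabled` contains all
won nodes. -/
theorem NodeWin.mem_of_closed {l : List (ℕ × ℕ)}
    (hbase : ∀ y < L.length ^ k, ∀ r < L.length, (∃ i < k, y / L.length ^ i % L.length = r) →
      (k, r + L.length * y) ∈ l)
    (hcl : ∀ p ≤ k, ∀ x < L.length ^ (k + 1), Enabled G L k l p x → (p, x) ∈ l) (hpos : 0 < L.length)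
    {p x : ℕ} (h : NodeWin (digitMove G L) L.length k p x) : (p, x) ∈ l := by
  induction h with
  | @base x hx h =>
    have := hbase (x / L.length) (Nat.div_lt_of_lt_mul (by rwa [mul_comm, ← pow_succ]))
      (x % L.length) (Nat.mod_lt _ hpos) h
    rwa [Nat.mod_add_div] at this
  | cop hp hx hb _ ih => exact hcl _ hp.le _ hx (.inl ⟨hp, _, hb, ih⟩)
  | rob hx _ ih => exact hcl _ le_rfl _ hx (.inr ⟨rfl, ih⟩)

/-- Check whether the robber's node with the robber on `16` is lost for him, in variable `19`. -/
def checkC : Cm :=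
  .loop 20 4 (.ite (.mul (moveE (.var 16) (.var 20))
    (.sub (.lit 1) (.get (markE (.add (.var 14) (.mul (.var 6) (.var 20)))))))
    (.set 19 (.lit 0)) .skip)

/-- All moves of the robber are inspected anew each time instead of keeping counters; this costs
only a factor `m`. -/
theorem wp_checkC {l : List (ℕ × ℕ)} (hg : GameMem G L k s) (hq : Queue n L.length k l s)
    (hnY : n ≤ Y) {d y : ℕ} (hd : d < L.length) (hy : y < L.length ^ k) (h16 : s.v 16 = d)
    (h14 : s.v 14 = y) (h19 : s.v 19 = 1) :
    Wp Y checkC (L.length * (1 + 1 + 1) + 2) s fun s' => s'.v 19 ≠ 0 ↔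
      ∀ e, digitMove G L d e → (0, y + L.length ^ k * e) ∈ l := by
  refine (Wp.loop (N := L.length) (fun j s' => s'.v 19 ≠ 0 ↔
      ∀ e < j, digitMove G L d e → (0, y + L.length ^ k * e) ∈ l) rfl rfl (by norm_num)
      hg.v4 (hg.length_le.trans hnY) (by simp [h19])
      fun j hj s₁ hI h20 hfr hmem => ?_).conseq fun s' h _ _ =>
        h.trans ⟨fun h e he => h e (digitMove_lt he).2 he, fun h e _ he => h e he⟩
  have hg₁ : GameMem G L k s₁ := hg.congr (fun x h0 h9 => hfr x (by omega) (by
    interval_cases x <;> rfl)) fun p _ => by rw [hmem rfl]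
  have hq₁ : Queue n L.length k l s₁ := hq.congr (hfr 17 (by norm_num) rfl) (hmem rfl)
  have h16₁ : s₁.v 16 = d := (hfr 16 (by norm_num) rfl).trans h16
  have h14₁ : s₁.v 14 = y := (hfr 14 (by norm_num) rfl).trans h14
  have hmv := hg₁.eval_moveE (a := .var 16) (b := .var 20) (by simpa [Ex.eval, h16₁] using hd)
    (by simpa [Ex.eval, h20] using hj)
  simp only [Ex.eval, h16₁, h20] at hmv
  have hx : y + L.length ^ k * j < L.length ^ (k + 1) := by
    rw [pow_succ]
    calc y + L.length ^ k * j < L.length ^ k * (j + 1) := by rw [mul_add]; omega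
      _ ≤ _ := Nat.mul_le_mul_left _ hj
  have hmark := hq₁.mark 0 (Nat.zero_le _) _ hx
  have hcond : (Ex.mul (moveE (.var 16) (.var 20)) (.sub (.lit 1)
      (.get (markE (.add (.var 14) (.mul (.var 6) (.var 20))))))).eval s₁ ≠ 0 ↔
      digitMove G L d j ∧ (0, y + L.length ^ k * j) ∉ l := by
    simp only [Ex.eval, hg₁.toGraphMem.eval_markE, h14₁, hg₁.v6, h20]
    rw [zero_mul, zero_add] at hmark
    rw [Nat.mul_ne_zero_iff, hmv, ← hmark]
    refine and_congr Iff.rfl ?_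
    omega
  refine Wp.ite (fun he => Wp.set (Nat.zero_le _) ?_) fun he => Wp.skip ?_
  · have := hcond.1 he
    simp only [Ex.eval, St.set_v]
    simp only [show (19 : ℕ) ≠ 20 by norm_num, if_false, if_true]
    refine ⟨fun h => (h rfl).elim, fun h => (this.2 (h j (by omega) this.1)).elim⟩
  · simp only [St.set_v, show (19 : ℕ) ≠ 20 by norm_num, if_false]
    rw [hI]
    refine ⟨fun h e he' hm => ?_, fun h e he' hm => h e (by omega) hm⟩
    rcases Nat.lt_succ_iff_lt_or_eq.1 he' with h' | rfl
    · exact h e h' hm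
    · by_contra hc
      exact (hcond.2 ⟨hm, hc⟩) he

/-- Treat the predecessor from which the last agent has moved away from `16`. -/
def predC : Cm :=
  .ite (moveE (.var 16) (.var 13))
    (.seq (.set 18 (.add (.mul (.var 15) (.var 7)) (.add (.var 16) (.mul (.var 4) (.var 14)))))
      (.seq (.set 19 (.lit 1))
        (.seq (.ite (.var 11) .skip checkC) (.ite (.var 19) pushC .skip)))) .skip

/-- A cop's node is won as soon as one successor is; a robber's node needs the check of all
successors. The check consults all marks in `l`, which is sound, and complete for the treated
entries `Z` because `Z ⊆ l`. -/
theorem wp_predC {l : List (ℕ × ℕ)} (hg : GameMem G L k s) (hq : Queue n L.length k l s)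
    (hnY : n ≤ Y) (hY : L.length ^ (k + 1) * (k + 1) ≤ Y) (hs : Sound G L k l) {Z : List (ℕ × ℕ)}
    (hZ : Z ⊆ l) {p x d : ℕ} (hp : p ≤ k) (hx : x < L.length ^ (k + 1)) (hpx : (p, x) ∈ l)
    (hd : d < L.length) (h11 : s.v 11 = p) (h13 : s.v 13 = x / L.length ^ k)
    (h14 : s.v 14 = x % L.length ^ k) (h15 : s.v 15 = (p - 1) + k * (1 - p)) (h16 : s.v 16 = d) :
    Wp Y predC (L.length * (1 + 1 + 1) + 2 + 1 + 5 + 1 + 1 + 1) s fun s' => GameMem G L k s' ∧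
      ∃ l', Queue n L.length k l' s' ∧ Sound G L k l' ∧ l <+: l' ∧
        (digitMove G L d (x / L.length ^ k) →
          Enabled G L k Z ((p - 1) + k * (1 - p)) (d + L.length * (x % L.length ^ k)) →
          ((p - 1) + k * (1 - p), d + L.length * (x % L.length ^ k)) ∈ l') := by
  have hpos : 0 < L.length := by omega
  have hy : x % L.length ^ k < L.length ^ k := Nat.mod_lt _ (pow_pos hpos k)
  have hb : x / L.length ^ k < L.length :=
    Nat.div_lt_of_lt_mul (by rwa [← pow_succ])
  have hmv := hg.eval_moveE (a := .var 16) (b := .var 13) (by simpa [Ex.eval, h16] using hd)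
    (by simpa [Ex.eval, h13] using hb)
  simp only [Ex.eval, h16, h13] at hmv
  have hz := pair_lt hy hd
  have hmod := pair_mod (y := x % L.length ^ k) hd
  obtain ⟨pp, hpp⟩ : ∃ pp, pp = (p - 1) + k * (1 - p) := ⟨_, rfl⟩
  rw [← hpp] at h15 ⊢
  have hppk : pp ≤ k := by
    rcases Nat.eq_zero_or_pos p with h | h
    · subst h; simp at hpp; omega
    · rw [show 1 - p = 0 by omega, mul_zero] at hpp; omega
  generalize hz' : d + L.length * (x % L.length ^ k) = z at hz hmod ⊢
  have hnode := node_lt hppk hz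
  have hdec : x % L.length ^ k + L.length ^ k * (x / L.length ^ k) = x := Nat.mod_add_div x _
  refine Wp.ite (fun he => ?_) fun he => Wp.skip
    ⟨hg, l, hq, hs, List.prefix_rfl, fun h => (hmv.2 h he).elim⟩
  have hmv' := hmv.1 he
  have hev : (Ex.add (.mul (.var 15) (.var 7)) (.add (.var 16) (.mul (.var 4) (.var 14)))).eval s
      = pp * L.length ^ (k + 1) + z := by
    simp only [Ex.eval, h15, hg.v7, h16, hg.v4, h14, hz']
  refine Wp.setSeq (by rw [hev]; omega) (Wp.setSeq ?_ ?_)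
  · simp only [Ex.eval]; omega
  rw [hev]
  set s₁ := (s.set 18 (pp * L.length ^ (k + 1) + z)).set 19
    ((Ex.lit 1).eval (s.set 18 (pp * L.length ^ (k + 1) + z))) with hs₁
  have hg₁ : GameMem G L k s₁ := hg.congr (fun x _ h => by
    simp [hs₁, show x ≠ 18 by omega, show x ≠ 19 by omega]) fun _ _ => rfl
  have hq₁ : Queue n L.length k l s₁ := hq.congr (by simp [hs₁]) rfl
  refine Wp.seq (T := L.length * (1 + 1 + 1) + 2 + 1) (T' := 5)
    (P := fun s' => s'.v 19 ≠ 0 ↔ (p ≠ 0 ∨ ∀ e, digitMove G L d e →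
      (0, x % L.length ^ k + L.length ^ k * e) ∈ l)) (Wp.ite (fun he => Wp.skip ?_) fun he => ?_)
    fun s₂ h19 hfr hmem => ?_
  · have hp0 : p ≠ 0 := by simpa [hs₁, Ex.eval, h11] using he
    simp [hs₁, Ex.eval, hp0]
  · have hp0 : p = 0 := by simpa [hs₁, Ex.eval, h11] using he
    refine (wp_checkC hg₁ hq₁ hnY hd hy (by simpa [hs₁] using h16) (by simpa [hs₁] using h14)
      (by simp [hs₁, Ex.eval])).conseq fun s' h _ _ => ?_
    rw [h]
    simp [hp0]
  · have hg₂ : GameMem G L k s₂ := hg₁.congr (fun x h0 h9 => hfr x (by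
      interval_cases x <;> rfl)) fun p _ => by rw [hmem rfl]
    have hq₂ : Queue n L.length k l s₂ := hq₁.congr (hfr 17 rfl) (hmem rfl)
    have h18 : s₂.v 18 = pp * L.length ^ (k + 1) + z := (hfr 18 rfl).trans (by simp [hs₁])
    refine Wp.ite (fun he => ?_) fun he => Wp.skip ?_
    · simp only [Ex.eval] at he
      refine (wp_pushC hg₂.toGraphMem hq₂ hppk hz h18 hY).conseq ?_
      rintro s₃ ⟨⟨l', hl', hpre, hin, hsub⟩, hm₃⟩ hfr₃ _
      refine ⟨hg₂.congr (fun x h0 h9 => hfr₃ x (by interval_cases x <;> rfl)) hm₃, l', hl', ?_,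
        hpre, fun _ _ => hin⟩
      intro a ha
      rcases hsub a ha with h | rfl
      · exact hs a h
      by_cases hp0 : p = 0
      · subst hp0
        obtain rfl : pp = k := by simpa using hpp
        refine .rob hz fun e hmve => ?_
        rw [hmod.1] at hmve
        rw [hmod.2]
        exact hs _ ((h19.1 he).resolve_left (by simp) e hmve)
      · obtain rfl : pp = p - 1 := by
          rw [hpp, show 1 - p = 0 by omega, mul_zero, add_zero]
        refine .cop (by omega) hz (b := x / L.length ^ k) (by rwa [hmod.1]) ?_
        rw [hmod.2, hdec, show p - 1 + 1 = p by omega]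
        exact hs _ hpx
    · simp only [Ex.eval] at he
      refine ⟨hg₂, l, hq₂, hs, List.prefix_rfl, fun _ hen => ?_⟩
      have hno : ¬ (p ≠ 0 ∨ ∀ e, digitMove G L d e →
          (0, x % L.length ^ k + L.length ^ k * e) ∈ l) := fun h => h19.2 h he
      rw [not_or, not_not] at hno
      obtain ⟨rfl, hno⟩ := hno
      obtain rfl : pp = k := by simpa using hpp
      rcases hen with ⟨h, _⟩ | ⟨_, hen⟩
      · exact (lt_irrefl _ h).elim
      · refine (hno fun e hmve => ?_).elim
        have := hen e (by rwa [hmod.1])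
        rw [hmod.2] at this
        exact hZ this

/-- Treat all entries of the queue. -/
def workC : Cm :=
  .loop 9 8 (.ite (.sub (.var 17) (.var 9))
    (.seq (.set 10 (.get (queueE (.var 9)))) (.seq (.set 11 (.div (.var 10) (.var 7)))
      (.seq (.set 12 (.sub (.var 10) (.mul (.var 11) (.var 7))))
        (.seq (.set 13 (.div (.var 12) (.var 6)))
          (.seq (.set 14 (.sub (.var 12) (.mul (.var 13) (.var 6))))
            (.seq (.set 15 (.add (.sub (.var 11) (.lit 1)) (.mul (.var 5) (.sub (.lit 1) (.var 11)))))
              (.loop 16 4 predC)))))))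
    .skip)

/-- The number of steps of `workC`, on `m` vertices with `t` nodes. -/
def workTime (m t : ℕ) : ℕ :=
  t * (m * (m * (1 + 1 + 1) + 2 + 1 + 5 + 1 + 1 + 1 + 1) + 2 + 1 + 1 + 1 + 1 + 1 + 1 + 1 + 1) + 2

/-- Invariant: whatever is enabled by the treated entries `l.take j` is in the queue. Treating one
more entry can enable only its predecessors (`Enabled.of_concat`), and these are examined. At the
end the queue is closed under `Enabled`, hence contains all won nodes. -/
theorem wp_workC {l₀ : List (ℕ × ℕ)} (hg : GameMem G L k s) (hq : Queue n L.length k l₀ s)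
    (hnY : n ≤ Y) (hkn : k ≤ n) (hY : L.length ^ (k + 1) * (k + 1) ≤ Y) (hs₀ : Sound G L k l₀)
    (hpos : 0 < L.length)
    (hbase : ∀ y < L.length ^ k, ∀ r < L.length, (∃ i < k, y / L.length ^ i % L.length = r) →
      (k, r + L.length * y) ∈ l₀) :
    Wp Y workC (workTime L.length (L.length ^ (k + 1) * (k + 1))) s fun s' => GameMem G L k s' ∧
      ∀ p ≤ k, ∀ x < L.length ^ (k + 1),
        (s'.mem (n * n + (1 + n) + 2 * (p * L.length ^ (k + 1) + x)) ≠ 0 ↔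
          NodeWin (digitMove G L) L.length k p x) := by
  refine (Wp.loop (N := L.length ^ (k + 1) * (k + 1)) (fun j s' => GameMem G L k s' ∧
      ∃ l, Queue n L.length k l s' ∧ Sound G L k l ∧ l₀ <+: l ∧
        ∀ p ≤ k, ∀ x < L.length ^ (k + 1), Enabled G L k (l.take j) p x → (p, x) ∈ l)
      rfl rfl (by norm_num) hg.v8 hY ?_
      fun j hj s₁ ⟨hg₁, l, hl, hs, hpre₀, hc⟩ h9 _ _ => ?_).conseq
      fun s' ⟨hg', l, hl, hs, hpre₀, hc⟩ _ _ => ⟨hg', fun p hp x hx => ?_⟩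
  · refine ⟨hg.congr (fun x _ h => by simp [show x ≠ 9 by omega]) fun _ _ => rfl, l₀,
      hq.congr (by simp) rfl, hs₀, List.prefix_rfl, fun p _ x _ h => ?_⟩
    exact (not_enabled_nil hpos h).elim
  · refine Wp.ite (fun he => ?_) fun he => Wp.skip ?_
    · simp only [Ex.eval, hl.tail, h9] at he
      have hjl : j < l.length := by omega
      obtain ⟨p, x, hpx⟩ : ∃ p x, l[j] = (p, x) := ⟨_, _, rfl⟩
      have hmem : (p, x) ∈ l := hpx ▸ List.getElem_mem hjl
      obtain ⟨hp, hx⟩ : p ≤ k ∧ x < L.length ^ (k + 1) := hl.valid _ hmem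
      have hent := hl.entry j hjl
      rw [hpx] at hent
      simp only at hent
      have hnode := node_lt hp hx
      have e10 : (Ex.get (queueE (.var 9))).eval s₁ = p * L.length ^ (k + 1) + x := by
        simp only [Ex.eval, hg₁.toGraphMem.eval_queueE, h9, hent]
      have hdiv : (p * L.length ^ (k + 1) + x) / L.length ^ (k + 1) = p := by
        rw [mul_comm, Nat.mul_add_div (by omega), Nat.div_eq_of_lt hx, add_zero]
      have hxY : x ≤ Y := by omega
      have hpY : p ≤ Y := by omega
      refine Wp.setSeq (by rw [e10]; omega) ?_
      rw [e10]
      refine Wp.setSeq (by simpa [Ex.eval, hg₁.v7, hdiv] using hpY) ?_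
      simp only [Ex.eval, St.set_v, hg₁.v7, hdiv, if_true, show (7 : ℕ) ≠ 10 by norm_num, if_false]
      refine Wp.setSeq (by simpa [Ex.eval, hg₁.v7] using hxY) ?_
      simp only [Ex.eval, St.set_v, hg₁.v7, if_true, show (7 : ℕ) ≠ 10 by norm_num, if_false,
        show (7 : ℕ) ≠ 11 by norm_num, show (10 : ℕ) ≠ 11 by norm_num, Nat.add_sub_cancel_left]
      refine Wp.setSeq ?_ ?_
      · simpa [Ex.eval, hg₁.v6] using (Nat.div_le_self _ _).trans hxY
      simp only [Ex.eval, St.set_v, hg₁.v6, if_true, if_false, show (6 : ℕ) ≠ 10 by norm_num,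
        show (6 : ℕ) ≠ 11 by norm_num, show (6 : ℕ) ≠ 12 by norm_num]
      refine Wp.setSeq ?_ ?_
      · simpa [Ex.eval, hg₁.v6] using (Nat.le_add_right x _).trans (Nat.add_le_add_right hxY _)
      simp only [Ex.eval, St.set_v, hg₁.v6, if_true, if_false, show (6 : ℕ) ≠ 10 by norm_num,
        show (6 : ℕ) ≠ 11 by norm_num, show (6 : ℕ) ≠ 12 by norm_num,
        show (6 : ℕ) ≠ 13 by norm_num, show (12 : ℕ) ≠ 13 by norm_num, mod_eq]
      have hppY : p - 1 + k * (1 - p) ≤ Y := by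
        rcases Nat.eq_zero_or_pos p with h | h
        · subst h; simp; omega
        · rw [show 1 - p = 0 by omega, mul_zero]; omega
      refine Wp.setSeq ?_ ?_
      · simpa [Ex.eval, hg₁.v5] using hppY
      simp only [Ex.eval, St.set_v, hg₁.v5, if_true, if_false, show (5 : ℕ) ≠ 10 by norm_num,
        show (5 : ℕ) ≠ 11 by norm_num, show (5 : ℕ) ≠ 12 by norm_num,
        show (5 : ℕ) ≠ 13 by norm_num, show (5 : ℕ) ≠ 14 by norm_num,
        show (11 : ℕ) ≠ 12 by norm_num, show (11 : ℕ) ≠ 13 by norm_num,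
        show (11 : ℕ) ≠ 14 by norm_num]
      set s₂ := (((((s₁.set 10 (p * L.length ^ (k + 1) + x)).set 11 p).set 12 x).set 13
        (x / L.length ^ k)).set 14 (x % L.length ^ k)).set 15 (p - 1 + k * (1 - p)) with hs₂
      have hg₂ : GameMem G L k s₂ := hg₁.congr (fun x _ h => by
        simp [hs₂, show x ≠ 10 by omega, show x ≠ 11 by omega, show x ≠ 12 by omega,
          show x ≠ 13 by omega, show x ≠ 14 by omega, show x ≠ 15 by omega]) fun _ _ => rfl
      have hq₂ : Queue n L.length k l s₂ := hl.congr (by simp [hs₂]) rfl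
      have htake : l.take (j + 1) = l.take j ++ [(p, x)] := by
        rw [List.take_succ_eq_append_getElem hjl, hpx]
      refine (Wp.loop (N := L.length) (fun i s' => GameMem G L k s' ∧
        ∃ l', Queue n L.length k l' s' ∧ Sound G L k l' ∧ l <+: l' ∧ ∀ d < i,
          digitMove G L d (x / L.length ^ k) →
          Enabled G L k (l.take (j + 1)) ((p - 1) + k * (1 - p)) (d + L.length * (x % L.length ^ k)) →
          ((p - 1) + k * (1 - p), d + L.length * (x % L.length ^ k)) ∈ l') rfl rfl (by norm_num)
        hg₂.v4 (hg.length_le.trans hnY) ?_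
        fun d hd s₃ ⟨hg₃, l', hl', hs', hpre, hc'⟩ h16 hfr _ => ?_).conseq
        fun s₃ ⟨hg₃, l', hl', hs', hpre, hc'⟩ _ _ => ?_
      · exact ⟨hg₂.congr (fun x _ h => by simp [show x ≠ 16 by omega]) fun _ _ => rfl, l,
          hq₂.congr (by simp) rfl, hs, List.prefix_rfl, by simp⟩
      · refine (wp_predC hg₃ hl' hnY hY hs' (Z := l.take (j + 1))
          (fun a ha => hpre.subset (List.mem_of_mem_take ha)) hp hx (hpre.subset hmem) hd
          ((hfr 11 (by norm_num) rfl).trans (by simp [hs₂]))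
          ((hfr 13 (by norm_num) rfl).trans (by simp [hs₂]))
          ((hfr 14 (by norm_num) rfl).trans (by simp [hs₂]))
          ((hfr 15 (by norm_num) rfl).trans (by simp [hs₂])) h16).conseq ?_
        rintro s₄ ⟨hg₄, l'', hl'', hs'', hpre', hc''⟩ _ _
        refine ⟨hg₄.congr (fun x _ h => by simp [show x ≠ 16 by omega]) fun _ _ => rfl, l'',
          hl''.congr (by simp) rfl, hs'', hpre.trans hpre', fun d' hd' hmv hen => ?_⟩
        rcases Nat.lt_succ_iff_lt_or_eq.1 hd' with h' | rfl
        · exact hpre'.subset (hc' d' h' hmv hen)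
        · exact hc'' hmv hen
      · refine ⟨hg₃.congr (fun x _ h => by simp [show x ≠ 9 by omega]) fun _ _ => rfl, l',
          hl'.congr (by simp) rfl, hs', hpre₀.trans hpre, fun p' hp' x' hx' hen => ?_⟩
        -- New entries are appended at the end, so the treated part is unchanged.
        have htk : l'.take (j + 1) = l.take (j + 1) := by
          obtain ⟨t, rfl⟩ := hpre
          rw [List.take_append_of_le_length (by omega)]
        rw [htk] at hen
        have hen' := hen
        rw [htake] at hen'
        rcases hen'.of_concat hx' with h | ⟨hmv, hx'', rfl⟩
        · exact hpre.subset (hc p' hp' x' hx' h)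
        · have := hc' (x' % L.length) (Nat.mod_lt _ hpos) hmv
          rw [← hx''] at this
          exact this hen
    -- The queue is exhausted: the treated part is all of `l`, and the remaining rounds are idle.
    · simp only [Ex.eval, hl.tail, h9] at he
      refine ⟨hg₁.congr (fun x _ h => by simp [show x ≠ 9 by omega]) fun _ _ => rfl, l,
        hl.congr (by simp) rfl, hs, hpre₀, ?_⟩
      rw [List.take_of_length_le (by omega)]
      rwa [List.take_of_length_le (by omega)] at hc
  · rw [List.take_of_length_le (length_le_of_valid hl.nodup hl.valid)] at hc
    rw [hl.mark p hp x hx]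
    exact ⟨fun h => hs _ h, fun h => h.mem_of_closed
      (fun y hy r hr h => hpre₀.subset (hbase y hy r hr h)) hc hpos⟩

/-- Look for an initial placement from which the cops win against every robber. -/
def finalC : Cm :=
  .loop 9 6 (.seq (.set 11 (.lit 1))
    (.seq (.loop 10 4 (.ite (.get (markE (.add (.var 9) (.mul (.var 6) (.var 10))))) .skip
        (.set 11 (.lit 0))))
      (.ite (.var 11) (.set 0 (.lit 1)) .skip)))

theorem wp_finalC (hg : GameMem G L k s) (hpos : 0 < L.length) (hnY : n ≤ Y)
    (hY : L.length ^ (k + 1) * (k + 1) ≤ Y) (h0 : s.v 0 = 0)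
    (hmark : ∀ p ≤ k, ∀ x < L.length ^ (k + 1),
        (s.mem (n * n + (1 + n) + 2 * (p * L.length ^ (k + 1) + x)) ≠ 0 ↔
          NodeWin (digitMove G L) L.length k p x)) :
    Wp Y finalC (L.length ^ k * (L.length * (1 + 1 + 1) + 2 + 2 + 1 + 1) + 2) s fun s' =>
      s'.v 0 ≤ 1 ∧ (s'.v 0 ≠ 0 ↔ ∃ c < L.length ^ k, ∀ r < L.length,
        NodeWin (digitMove G L) L.length k 0 (c + L.length ^ k * r)) := by
  have hMY : L.length ^ k ≤ L.length ^ (k + 1) * (k + 1) :=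
    (Nat.pow_le_pow_right hpos (Nat.le_succ k)).trans (Nat.le_mul_of_pos_right _ (by omega))
  have hY1 : 1 ≤ Y := (Nat.succ_le_of_lt (Nat.pow_pos (n := k) hpos)).trans (hMY.trans hY)
  refine Wp.loop (N := L.length ^ k) (fun j s' => s'.v 0 ≤ 1 ∧ (s'.v 0 ≠ 0 ↔ ∃ c < j,
      ∀ r < L.length, NodeWin (digitMove G L) L.length k 0 (c + L.length ^ k * r)))
      rfl rfl (by norm_num) hg.v6 (hMY.trans hY) (by simp [h0])
      fun j hj s₁ ⟨hI₀, hI⟩ h9 hfr hmem => ?_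
  refine Wp.setSeq (by simp only [Ex.eval]; omega) ?_
  refine Wp.seq (T := L.length * (1 + 1 + 1) + 2) (T' := 2) (Wp.loop (N := L.length)
    (fun i s' => s'.v 11 ≠ 0 ↔ ∀ r < i,
      NodeWin (digitMove G L) L.length k 0 (j + L.length ^ k * r)) rfl rfl (by norm_num) ?_
      (hg.length_le.trans hnY) (by simp [Ex.eval]) fun r hr s₂ hI₂ h10 hfr₂ hmem₂ => ?_)
      fun s₂ h11 hfr₂ _ => Wp.ite (fun he => Wp.set hY1 ?_) fun he => Wp.skip ?_
  · rw [St.set_v, if_neg (by norm_num), hfr 4 (by norm_num) rfl, hg.v4]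
  · have hm₂ : s₂.mem = s.mem := (hmem₂ rfl).trans (hmem rfl)
    have hg₂ : GameMem G L k s₂ := hg.congr (fun x h0 h9 => by
      rw [hfr₂ x (by omega) (by interval_cases x <;> rfl), St.set_v, if_neg (by omega)]
      exact hfr x (by omega) (by interval_cases x <;> first | rfl | exact absurd rfl h0))
      fun p _ => by rw [hm₂]
    have h9₂ : s₂.v 9 = j := (hfr₂ 9 (by norm_num) rfl).trans (by simpa using h9)
    have hx : j + L.length ^ k * r < L.length ^ (k + 1) := by
      rw [pow_succ]
      calc j + L.length ^ k * r < L.length ^ k * (r + 1) := by rw [mul_add]; omega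
        _ ≤ _ := Nat.mul_le_mul_left _ hr
    have hev : (Ex.get (markE (.add (.var 9) (.mul (.var 6) (.var 10))))).eval s₂ ≠ 0 ↔
        NodeWin (digitMove G L) L.length k 0 (j + L.length ^ k * r) := by
      rw [← hmark 0 (Nat.zero_le _) _ hx]
      simp only [Ex.eval, hg₂.toGraphMem.eval_markE, h9₂, hg₂.v6, h10, hm₂, zero_mul, zero_add]
    refine Wp.ite (fun he => Wp.skip ?_) fun he => Wp.set (Nat.zero_le _) ?_
    · simp only [St.set_v, show (11 : ℕ) ≠ 10 by norm_num, if_false]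
      rw [hI₂]
      refine ⟨fun h r' hr' => ?_, fun h r' hr' => h r' (by omega)⟩
      rcases Nat.lt_succ_iff_lt_or_eq.1 hr' with h' | rfl
      · exact h r' h'
      · exact hev.1 he
    · simp only [St.set_v, show (11 : ℕ) ≠ 10 by norm_num, if_false, if_true, Ex.eval]
      exact ⟨fun h => (h rfl).elim, fun h => (hev.2 (h r (by omega)) he).elim⟩
  · simp only [Ex.eval] at he
    simp only [Ex.eval, St.set_v, show (0 : ℕ) ≠ 9 by norm_num, if_false, if_true]
    exact ⟨le_rfl, fun _ => ⟨j, by omega, h11.1 he⟩, fun _ => one_ne_zero⟩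
  · simp only [Ex.eval] at he
    have h0₂ : s₂.v 0 = s₁.v 0 := (hfr₂ 0 rfl).trans (by simp)
    simp only [St.set_v, show (0 : ℕ) ≠ 9 by norm_num, if_false, h0₂]
    refine ⟨hI₀, hI.trans ⟨fun ⟨c, hc, h⟩ => ⟨c, by omega, h⟩, fun ⟨c, hc, h⟩ => ⟨c, ?_, h⟩⟩⟩
    rcases Nat.lt_succ_iff_lt_or_eq.1 hc with h' | rfl
    · exact h'
    · exact (h11.2 h he).elim

end Worklist


/-! ### The whole game on the undominated vertices -/

section Build

variable {n k Y : ℕ} {G : SimpleGraph (Fin n)} {s : St}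

open Classical in
/-- The vertices on which the game with `k` cops is solved. -/
noncomputable def keptList (G : SimpleGraph (Fin n)) (k : ℕ) : List (Fin n) :=
  (List.finRange n).filter fun u => k = 1 ∨ ¬ Dominated G u

theorem suffices_keptList (G : SimpleGraph (Fin n)) (k : ℕ) : Suffices G k (keptList G k) :=
  ⟨(List.nodup_finRange n).filter _, fun u => by simp [keptList]⟩

theorem length_keptList_le (G : SimpleGraph (Fin n)) (k : ℕ) : (keptList G k).length ≤ n :=
  (List.length_filter_le _ _).trans (by simp)

theorem keptList_pos (hn : 0 < n) (G : SimpleGraph (Fin n)) (k : ℕ) :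
    0 < (keptList G k).length := by
  obtain ⟨v, hv, _⟩ := exists_undominated G ⟨0, hn⟩
  exact List.length_pos_of_mem (((suffices_keptList G k).mem v).2 (.inr hv))

/-- Compare the neighbourhoods of the vertices in variables `9` and `10`. -/
def compareC : Cm :=
  .loop 11 1 (.seq
    (.ite (adjE (.var 9) (.var 11))
      (.ite (adjE (.var 10) (.var 11)) .skip (.set 13 (.lit 0))) .skip)
    (.ite (adjE (.var 10) (.var 11))
      (.ite (adjE (.var 9) (.var 11)) .skip (.set 14 (.lit 0))) .skip))

theorem wp_compareC (hg : GraphMem G s) (hnY : n ≤ Y) {u v : Fin n} (h9 : s.v 9 = u)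
    (h10 : s.v 10 = v) (h13 : s.v 13 = 1) (h14 : s.v 14 = 1) :
    Wp Y compareC (n * (3 + 3 + 1) + 2) s fun s' =>
      (s'.v 13 ≠ 0 ↔ ∀ w, G.Adj u w → G.Adj v w) ∧
      (s'.v 14 ≠ 0 ↔ ∀ w, G.Adj v w → G.Adj u w) := by
  refine (Wp.loop (N := n) (fun j s' =>
      (s'.v 13 ≠ 0 ↔ ∀ w : Fin n, w.1 < j → G.Adj u w → G.Adj v w) ∧
      (s'.v 14 ≠ 0 ↔ ∀ w : Fin n, w.1 < j → G.Adj v w → G.Adj u w)) rfl rfl (by norm_num)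
      hg.v1 hnY (by simp [h13, h14])
      fun j hj s₁ ⟨hI, hI'⟩ h11 hfr hmem => ?_).conseq fun s' ⟨h, h'⟩ _ _ =>
        ⟨h.trans ⟨fun h w => h w w.2, fun h w _ => h w⟩,
          h'.trans ⟨fun h w => h w w.2, fun h w _ => h w⟩⟩
  have hg₁ : ∀ s₂ : St, s₂.v 1 = s₁.v 1 → s₂.mem = s₁.mem → GraphMem G s₂ := fun s₂ h h' =>
    hg.congr (h.trans (hfr 1 (by norm_num) rfl)) fun p _ => by rw [h', hmem rfl]
  have hstep : ∀ P : Fin n → Prop, (∀ w : Fin n, w.1 < j + 1 → P w) ↔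
      (∀ w : Fin n, w.1 < j → P w) ∧ P ⟨j, hj⟩ := by
    intro P
    refine ⟨fun h => ⟨fun w hw => h w (by omega), h _ (by simp)⟩, fun ⟨h, h'⟩ w hw => ?_⟩
    rcases Nat.lt_succ_iff_lt_or_eq.1 hw with hw | hw
    · exact h w hw
    · rwa [show w = ⟨j, hj⟩ from Fin.ext hw]
  have key : ∀ s₂ : St, s₂.v 1 = s₁.v 1 → s₂.mem = s₁.mem → s₂.v 9 = s₁.v 9 →
      s₂.v 10 = s₁.v 10 → s₂.v 11 = s₁.v 11 →
      ((adjE (.var 9) (.var 11)).eval s₂ ≠ 0 ↔ G.Adj u ⟨j, hj⟩) ∧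
      ((adjE (.var 10) (.var 11)).eval s₂ ≠ 0 ↔ G.Adj v ⟨j, hj⟩) := by
    intro s₂ e1 em e9 e10 e11
    have h9₂ : s₂.v 9 = u := e9.trans ((hfr 9 (by norm_num) rfl).trans h9)
    have h10₂ : s₂.v 10 = v := e10.trans ((hfr 10 (by norm_num) rfl).trans h10)
    have h11₂ : s₂.v 11 = j := e11.trans h11
    exact ⟨(hg₁ s₂ e1 em).eval_adjE (by simpa [Ex.eval] using h9₂) (by simpa [Ex.eval] using h11₂),
      (hg₁ s₂ e1 em).eval_adjE (by simpa [Ex.eval] using h10₂) (by simpa [Ex.eval] using h11₂)⟩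
  obtain ⟨ku, kv⟩ := key s₁ rfl rfl rfl rfl rfl
  refine Wp.seq (T := 3) (T' := 3)
    (P := fun s' => (s'.v 13 ≠ 0 ↔ ∀ w : Fin n, w.1 < j + 1 → G.Adj u w → G.Adj v w) ∧
      s'.v 14 = s₁.v 14) ?_ fun s₂ ⟨h₁, h₂⟩ hfr₂ hmem₂ => ?_
  · rw [hstep]
    refine Wp.ite (T := 2) (fun he => Wp.ite (T := 1) (fun he' => Wp.skip ?_)
      fun he' => Wp.set (Nat.zero_le _) ?_) fun he => Wp.skip ?_
    · exact ⟨hI.trans ⟨fun h => ⟨h, fun _ => kv.1 he'⟩, fun h => h.1⟩, rfl⟩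
    · refine ⟨?_, by simp⟩
      simp only [Ex.eval, St.set_v, if_true]
      exact ⟨fun h => (h rfl).elim, fun h => (kv.2 (h.2 (ku.1 he)) he').elim⟩
    · exact ⟨hI.trans ⟨fun h => ⟨h, fun h' => (ku.2 h' he).elim⟩, fun h => h.1⟩, rfl⟩
  · obtain ⟨ku, kv⟩ := key s₂ (hfr₂ 1 rfl) (hmem₂ rfl) (hfr₂ 9 rfl) (hfr₂ 10 rfl) (hfr₂ 11 rfl)
    rw [← h₂] at hI'
    simp only [St.set_v, show (13 : ℕ) ≠ 11 by norm_num, show (14 : ℕ) ≠ 11 by norm_num, if_false]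
    rw [hstep fun w => G.Adj v w → G.Adj u w]
    refine Wp.ite (T := 2) (fun he => Wp.ite (T := 1) (fun he' => Wp.skip ?_)
      fun he' => Wp.set (Nat.zero_le _) ?_) fun he => Wp.skip ?_
    · exact ⟨h₁, hI'.trans ⟨fun h => ⟨h, fun _ => ku.1 he'⟩, fun h => h.1⟩⟩
    · refine ⟨by simpa using h₁, ?_⟩
      simp only [Ex.eval, St.set_v, if_true]
      exact ⟨fun h => (h rfl).elim, fun h => (ku.2 (h.2 (kv.1 he)) he').elim⟩
    · exact ⟨h₁, hI'.trans ⟨fun h => ⟨h, fun h' => (kv.2 h' he).elim⟩, fun h => h.1⟩⟩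

/-- Decide whether the vertex in variable `9` is dominated, in variable `12`. -/
def domC : Cm :=
  .loop 10 1 (.seq (.set 13 (.lit 1)) (.seq (.set 14 (.lit 1)) (.seq compareC
    (.ite (.mul (.var 13) (.add (.sub (.lit 1) (.var 14)) (.sub (.var 10) (.var 9))))
      (.set 12 (.lit 1)) .skip))))

theorem wp_domC (hg : GraphMem G s) (hnY : n ≤ Y) {u : Fin n} (h9 : s.v 9 = u)
    (h12 : s.v 12 = 0) :
    Wp Y domC (n * (n * (3 + 3 + 1) + 2 + 2 + 1 + 1 + 1) + 2) s fun s' =>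
      (s'.v 12 ≠ 0 ↔ Dominated G u) := by
  have hn : 0 < n := u.pos
  refine (Wp.loop (N := n) (fun j s' => (s'.v 12 ≠ 0 ↔ ∃ v : Fin n, v.1 < j ∧
      (∀ w, G.Adj u w → G.Adj v w) ∧ ((∃ w, G.Adj v w ∧ ¬ G.Adj u w) ∨ u < v)))
      rfl rfl (by norm_num) hg.v1 hnY (by simp [h12])
      fun j hj s₁ hI h10 hfr hmem => ?_).conseq fun s' h _ _ =>
        h.trans ⟨fun ⟨v, _, h⟩ => ⟨v, h⟩, fun ⟨v, h⟩ => ⟨v, v.2, h⟩⟩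
  have hY1 : 1 ≤ Y := by omega
  have hfr9 : s₁.v 9 = u := (hfr 9 (by norm_num) rfl).trans h9
  refine Wp.setSeq hY1 (Wp.setSeq hY1 ?_)
  refine Wp.seq (T := n * (3 + 3 + 1) + 2) (T' := 2) (wp_compareC (G := G) (u := u) (v := ⟨j, hj⟩)
    (hg.congr (by simpa using hfr 1 (by norm_num) rfl) fun p _ => by simp [hmem rfl]) hnY
    (by simpa using hfr9) (by simpa using h10) (by simp [Ex.eval]) (by simp [Ex.eval]))
    fun s₂ ⟨h13, h14⟩ hfr₂ _ => ?_
  have e9 : s₂.v 9 = u := (hfr₂ 9 rfl).trans (by simpa using hfr9)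
  have e10 : s₂.v 10 = j := (hfr₂ 10 rfl).trans (by simpa using h10)
  have e12 : s₂.v 12 = s₁.v 12 := (hfr₂ 12 rfl).trans (by simp)
  -- The inclusion is strict when the reverse comparison fails, and the truncated difference of the
  -- names is nonzero exactly for a larger name.
  have hcond : (Ex.mul (.var 13) (.add (.sub (.lit 1) (.var 14))
      (.sub (.var 10) (.var 9)))).eval s₂ ≠ 0 ↔ (∀ w, G.Adj u w → G.Adj ⟨j, hj⟩ w) ∧
        ((∃ w, G.Adj ⟨j, hj⟩ w ∧ ¬ G.Adj u w) ∨ u < ⟨j, hj⟩) := by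
    simp only [Ex.eval, e9, e10]
    rw [Nat.mul_ne_zero_iff, h13]
    refine and_congr Iff.rfl ?_
    have h14' : (∃ w, G.Adj ⟨j, hj⟩ w ∧ ¬ G.Adj u w) ↔ s₂.v 14 = 0 := by
      rw [← not_iff_not, ← ne_eq, h14]
      push Not
      exact Iff.rfl
    rw [h14', Fin.lt_def]
    simp only
    omega
  refine Wp.ite (fun he => Wp.set hY1 ?_) fun he => Wp.skip ?_
  · simp only [Ex.eval, St.set_v, show (12 : ℕ) ≠ 10 by norm_num, if_false, if_true]
    exact ⟨fun _ => ⟨⟨j, hj⟩, by simp, hcond.1 he⟩, fun _ => one_ne_zero⟩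
  · simp only [St.set_v, show (12 : ℕ) ≠ 10 by norm_num, if_false, e12]
    refine hI.trans ⟨fun ⟨v, hv, h⟩ => ⟨v, by omega, h⟩, fun ⟨v, hv, h⟩ => ⟨v, ?_, h⟩⟩
    rcases Nat.lt_succ_iff_lt_or_eq.1 hv with hv | hv
    · exact hv
    · rw [show v = ⟨j, hj⟩ from Fin.ext hv] at h
      exact (hcond.2 h he).elim

/-- Write down the list of vertices. -/
def buildC : Cm :=
  .seq (.set 4 (.lit 0)) (.loop 9 1 (.seq (.set 12 (.lit 0)) (.seq domC
    (.ite (.add (.sub (.lit 1) (.var 3)) (.sub (.lit 1) (.var 12)))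
      (.seq (.put (.add (.add (.mul (.var 1) (.var 1)) (.lit 1)) (.var 4)) (.var 9))
        (.set 4 (.add (.var 4) (.lit 1)))) .skip))))

def buildTime (n : ℕ) : ℕ :=
  n * (n * (n * (3 + 3 + 1) + 2 + 2 + 1 + 1 + 1) + 2 + 3 + 1 + 1) + 2 + 1

theorem wp_buildC (hg : GraphMem G s) (hnY : n ≤ Y) {q : ℕ} (h3 : s.v 3 = q) :
    Wp Y buildC (buildTime n) s fun s' => GraphMem G s' ∧
      s'.v 4 = (keptList G (q + 1)).length ∧
      ∀ (i : ℕ) (h : i < (keptList G (q + 1)).length),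
        s'.mem (n * n + 1 + i) = (keptList G (q + 1))[i] := by
  classical
  let K : ℕ → List (Fin n) := fun j =>
    ((List.finRange n).take j).filter fun u => q + 1 = 1 ∨ ¬ Dominated G u
  have hKn : K n = keptList G (q + 1) := by
    simp only [K, keptList]
    rw [List.take_of_length_le (by simp)]
  have hKlen : ∀ j, (K j).length ≤ j := fun j =>
    (List.length_filter_le _ _).trans (by simp)
  rw [← hKn]
  refine Wp.setSeq (Nat.zero_le _) ?_
  refine Wp.loop (N := n) (fun j s' => GraphMem G s' ∧ s'.v 4 = (K j).length ∧
      ∀ (i : ℕ) (h : i < (K j).length), s'.mem (n * n + 1 + i) = (K j)[i])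
      rfl rfl (by norm_num) (by simpa using hg.v1) hnY ⟨hg.congr (by simp) fun _ _ => rfl, by simp [K, Ex.eval], by simp [K]⟩
      fun j hj s₁ ⟨hg₁, h4, hname⟩ h9 hfr _ => ?_
  have h3₁ : s₁.v 3 = q := (hfr 3 (by norm_num) rfl).trans (by simpa using h3)
  refine Wp.setSeq (Nat.zero_le _) ?_
  refine Wp.seq (T := n * (n * (3 + 3 + 1) + 2 + 2 + 1 + 1 + 1) + 2) (T' := 3)
    (wp_domC (G := G) (s := s₁.set 12 ((Ex.lit 0).eval s₁)) (u := ⟨j, hj⟩)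
      (hg₁.congr (by simp) fun _ _ => rfl) hnY (by simpa using h9)
      (by simp [Ex.eval])) fun s₂ h12 hfr₂ hmem₂ => ?_
  have hg₂ : GraphMem G s₂ := hg₁.congr ((hfr₂ 1 rfl).trans (by simp)) fun p _ => by
    rw [hmem₂ rfl, St.set_mem]
  have h4₂ : s₂.v 4 = (K j).length := (hfr₂ 4 rfl).trans (by simpa using h4)
  have h9₂ : s₂.v 9 = j := (hfr₂ 9 rfl).trans (by simpa using h9)
  have h3₂ : s₂.v 3 = q := (hfr₂ 3 rfl).trans (by simpa using h3₁)
  have hmem₂' : s₂.mem = s₁.mem := hmem₂ rfl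
  -- `1 - q` is nonzero exactly for `q = 0`, the game with one cop, where every vertex is kept.
  have hcond : (Ex.add (.sub (.lit 1) (.var 3)) (.sub (.lit 1) (.var 12))).eval s₂ ≠ 0 ↔
      (q + 1 = 1 ∨ ¬ Dominated G ⟨j, hj⟩) := by
    rw [← h12]
    simp only [Ex.eval, h3₂]
    omega
  have htake : (List.finRange n).take (j + 1) = (List.finRange n).take j ++ [⟨j, hj⟩] := by
    rw [List.take_succ_eq_append_getElem (by simpa using hj)]
    simp
  have hjl := hKlen j
  refine Wp.ite (T := 2) (fun he => Wp.putSeq ?_ (Wp.set ?_ ?_)) fun he => Wp.skip ?_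
  · simp only [Ex.eval]; omega
  · simp only [Ex.eval, St.put_v]; omega
  · have hKs : K (j + 1) = K j ++ [⟨j, hj⟩] := by
      simp only [K, htake, List.filter_append]
      congr 1
      simpa using hcond.1 he
    simp only [Ex.eval, hg₂.v1, h4₂, h9₂]
    rw [hKs]
    refine ⟨hg₂.congr (by simp) fun p hp => ?_, by simp [h4₂], fun i hi => ?_⟩
    · simp only [St.set_mem, St.put_mem]
      rw [if_neg (by omega)]
    · simp only [St.set_mem, St.put_mem, hmem₂']
      simp only [List.length_append, List.length_singleton] at hi
      rcases Nat.lt_or_ge i (K j).length with hil | hil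
      · rw [if_neg (by omega), hname i hil, List.getElem_append_left hil]
      · obtain rfl : i = (K j).length := by omega
        simp
  · have hKs : K (j + 1) = K j := by
      simp only [K, htake, List.filter_append]
      have := mt hcond.2 (not_not.2 he)
      simpa using this
    rw [hKs]
    exact ⟨hg₂.congr (by simp) fun _ _ => rfl, by simpa using h4₂, fun i hi => by
      rw [St.set_mem, hmem₂']; exact hname i hi⟩

/-- Compute the parameters of the game. -/
def powersC : Cm :=
  .seq (.set 5 (.add (.var 3) (.lit 1))) (.seq (.set 6 (.lit 1))
    (.seq (.loop 9 5 (.set 6 (.mul (.var 6) (.var 4))))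
      (.seq (.set 7 (.mul (.var 6) (.var 4))) (.set 8 (.mul (.var 7) (.add (.var 5) (.lit 1)))))))

theorem wp_powersC {L : List (Fin n)} (hg : GraphMem G s) (hpos : 0 < L.length)
    (hLn : L.length ≤ n) (h4 : s.v 4 = L.length)
    (hname : ∀ (i : ℕ) (h : i < L.length), s.mem (n * n + 1 + i) = L[i]) {q : ℕ} (hq : q < n)
    (h3 : s.v 3 = q) (hY : L.length ^ (q + 1 + 1) * (q + 1 + 1) ≤ Y) (hnY : n ≤ Y) :
    Wp Y powersC ((q + 1) * (1 + 1) + 2 + 2 + 1 + 1) s fun s' => GameMem G L (q + 1) s' := by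
  have hle : ∀ j ≤ q + 1 + 1, L.length ^ j ≤ Y := fun j hj =>
    (Nat.pow_le_pow_right hpos hj).trans ((Nat.le_mul_of_pos_right _ (by omega)).trans hY)
  have h1Y : 1 ≤ Y := by omega
  refine Wp.setSeq (by simp only [Ex.eval]; omega) (Wp.setSeq h1Y ?_)
  refine Wp.seq (T := (q + 1) * (1 + 1) + 2) (T' := 2) (Wp.loop (N := q + 1)
    (fun j s' => s'.v 6 = L.length ^ j) rfl rfl (by norm_num) (by simp [Ex.eval, h3]) (by omega)
    (by simp [Ex.eval]) fun j hj s₁ h6 _ hfr _ => ?_) fun s₁ h6 hfr hmem => ?_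
  · have h4₁ : s₁.v 4 = L.length := (hfr 4 (by norm_num) rfl).trans (by simpa using h4)
    have hev : (Ex.mul (.var 6) (.var 4)).eval s₁ = L.length ^ (j + 1) := by
      simp only [Ex.eval, h6, h4₁, pow_succ]
    refine Wp.set ?_ ?_
    · rw [hev]; exact hle _ (by omega)
    · rw [hev]; simp
  · have h4₁ : s₁.v 4 = L.length := (hfr 4 rfl).trans (by simpa using h4)
    have h5₁ : s₁.v 5 = q + 1 := (hfr 5 rfl).trans (by simp [Ex.eval, h3])
    have h1₁ : s₁.v 1 = n := (hfr 1 rfl).trans (by simpa using hg.v1)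
    have hev : (Ex.mul (.var 6) (.var 4)).eval s₁ = L.length ^ (q + 1 + 1) := by
      simp only [Ex.eval, h6, h4₁, pow_succ]
    have hm : s₁.mem = s.mem := hmem rfl
    refine Wp.setSeq (by rw [hev]; exact hle _ le_rfl) ?_
    rw [hev]
    refine Wp.set (by simpa [Ex.eval, h5₁] using hY) ?_
    exact ⟨hg.congr (by simpa [hg.v1] using h1₁) fun p _ => by simp [hm],
      fun i hi => by simpa [hm] using hname i hi, hLn, by simpa using h4₁, by simpa using h5₁,
      by simpa using h6, by simp, by simp [Ex.eval, h5₁]⟩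

/-- Decide whether one cop more than variable `3` says has a winning strategy. -/
def solveC : Cm :=
  .seq buildC (.seq powersC (.seq clearC (.seq baseC (.seq workC finalC))))

def solveTime (n m k : ℕ) : ℕ :=
  buildTime n + (k * (1 + 1) + 2 + 2 + 1 + 1 + (m ^ (k + 1) * (k + 1) * 2 + 3 +
    (m ^ k * (m * (k * 4 + 10 + 1) + 2 + 1) + 2 + (workTime m (m ^ (k + 1) * (k + 1)) +
      (m ^ k * (m * (1 + 1 + 1) + 2 + 2 + 1 + 1) + 2)))))

theorem wp_solveC (hG : G.Connected) (hg : GraphMem G s) {q : ℕ} (hq : q < n) (h3 : s.v 3 = q)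
    (h0 : s.v 0 = 0) (hY : n ^ (n + 1) * (n + 1) ≤ Y) :
    Wp Y solveC (solveTime n (keptList G (q + 1)).length (q + 1)) s fun s' => GraphMem G s' ∧
      s'.v 0 ≤ 1 ∧ (s'.v 0 ≠ 0 ↔ CopWin G (q + 1)) := by
  have hn : 0 < n := by omega
  have hpos := keptList_pos hn G (q + 1)
  have hLn := length_keptList_le G (q + 1)
  rw [copWin_iff_nodeWin hG (by omega) (suffices_keptList G (q + 1))]
  set L := keptList G (q + 1) with hL
  have hnY : n ≤ Y := by
    have : n ≤ n ^ (n + 1) := Nat.le_self_pow (by omega) n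
    exact this.trans ((Nat.le_mul_of_pos_right _ (by omega)).trans hY)
  have hYL : L.length ^ (q + 1 + 1) * (q + 1 + 1) ≤ Y :=
    (Nat.mul_le_mul ((Nat.pow_le_pow_left hLn _).trans (Nat.pow_le_pow_right hn (by omega)))
      (by omega)).trans hY
  refine Wp.seq (wp_buildC hg hnY h3) fun s₁ ⟨hg₁, h4, hname⟩ hfr₁ _ => ?_
  refine Wp.seq (wp_powersC hg₁ hpos hLn h4 hname hq ((hfr₁ 3 rfl).trans h3) hYL hnY)
    fun s₂ hg₂ hfr₂ _ => ?_
  refine Wp.seq (wp_clearC hg₂ hYL) fun s₃ ⟨hq₃, hg₃⟩ hfr₃ _ => ?_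
  refine Wp.seq (wp_baseC hg₃ hq₃ hpos hq hnY hYL) fun s₄ ⟨hg₄, l, hl, hs, hbase⟩ hfr₄ _ => ?_
  refine Wp.seq (wp_workC hg₄ hl hnY hq hYL hs hpos hbase) fun s₅ ⟨hg₅, hmark⟩ hfr₅ _ => ?_
  refine (wp_finalC hg₅ hpos hnY hYL ?_ hmark).conseq fun s₆ ⟨h, h'⟩ hfr₆ hmem₆ => ⟨?_, h, h'⟩
  · rw [hfr₅ 0 rfl, hfr₄ 0 rfl, hfr₃ 0 rfl, hfr₂ 0 rfl, hfr₁ 0 rfl, h0]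
  · exact hg₅.toGraphMem.congr (hfr₆ 1 rfl) fun p _ => by rw [hmem₆ rfl]

/-- The main term comes from the worklist: `m ^ (k + 1) * (k + 1)` nodes, `m` candidate predecessors
each, and a check linear in `m`, with `m, k ≤ n`. -/
theorem solveTime_le {m : ℕ} (hm : 0 < m) (hmn : m ≤ n) (hkn : k ≤ n) :
    solveTime n m k ≤ 200 * n ^ 3 * m ^ (k + 1) := by
  have hN : 0 < m ^ (k + 1) := Nat.pow_pos hm
  have hMN : m ^ k * m = m ^ (k + 1) := (pow_succ m k).symm
  have hMle : m ^ k ≤ m ^ (k + 1) := Nat.pow_le_pow_right hm (Nat.le_succ k)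
  have e : m ^ k * (m * (k * 4 + 10 + 1) + 2 + 1) = m ^ (k + 1) * (k * 4 + 11) + 3 * m ^ k := by
    rw [← hMN]; ring
  have e' : m ^ k * (m * (1 + 1 + 1) + 2 + 2 + 1 + 1) = 3 * m ^ (k + 1) + 6 * m ^ k := by
    rw [← hMN]; ring
  simp only [solveTime, buildTime, workTime, e, e']
  generalize m ^ (k + 1) = N at *
  generalize m ^ k = M at *
  have hn : 1 ≤ n := by omega
  have h2 : n ≤ n ^ 2 := Nat.le_self_pow (by omega) n
  have h3 : n ^ 2 ≤ n ^ 3 := Nat.pow_le_pow_right hn (by omega)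
  have hA : n * (n * (n * (3 + 3 + 1) + 2 + 2 + 1 + 1 + 1) + 2 + 3 + 1 + 1) + 2 + 1 ≤
      24 * n ^ 3 := by
    have : n * (n * (n * (3 + 3 + 1) + 2 + 2 + 1 + 1 + 1) + 2 + 3 + 1 + 1) + 2 + 1 =
      7 * n ^ 3 + 7 * n ^ 2 + 7 * n + 3 := by ring
    omega
  have hB : m * (m * (1 + 1 + 1) + 2 + 1 + 5 + 1 + 1 + 1 + 1) + 2 + 1 + 1 + 1 + 1 + 1 + 1 + 1 + 1
      ≤ 25 * n ^ 2 := by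
    have h1 : m * (m * (1 + 1 + 1) + 2 + 1 + 5 + 1 + 1 + 1 + 1) ≤ n * (n * 3 + 12) :=
      Nat.mul_le_mul hmn (by omega)
    have : n * (n * 3 + 12) = 3 * n ^ 2 + 12 * n := by ring
    omega
  have hC : N * (k + 1) * (m * (m * (1 + 1 + 1) + 2 + 1 + 5 + 1 + 1 + 1 + 1) + 2 + 1 + 1 + 1 + 1 +
      1 + 1 + 1 + 1) ≤ 50 * n ^ 3 * N := by
    calc _ ≤ N * (2 * n) * (25 * n ^ 2) :=
          Nat.mul_le_mul (Nat.mul_le_mul_left _ (by omega)) hB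
      _ = _ := by ring
  have hD : N * (k + 1) * 2 ≤ 4 * n ^ 3 * N := by
    calc _ ≤ N * (2 * n ^ 3) * 2 := Nat.mul_le_mul_right _ (Nat.mul_le_mul_left _ (by omega))
      _ = _ := by ring
  have hE : N * (k * 4 + 11) ≤ 15 * n ^ 3 * N := by
    calc _ ≤ N * (15 * n ^ 3) := Nat.mul_le_mul_left _ (by omega)
      _ = _ := by ring
  have hF : n ^ 3 ≤ n ^ 3 * N := Nat.le_mul_of_pos_right _ hN
  have hG : N ≤ n ^ 3 * N := Nat.le_mul_of_pos_left _ (by omega)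
  have e1 : 50 * n ^ 3 * N = 50 * (n ^ 3 * N) := by ring
  have e2 : 4 * n ^ 3 * N = 4 * (n ^ 3 * N) := by ring
  have e3 : 15 * n ^ 3 * N = 15 * (n ^ 3 * N) := by ring
  have e4 : 200 * n ^ 3 * N = 200 * (n ^ 3 * N) := by ring
  omega

end Build


/-! ### Reading the instance -/

section Input

theorem length_flatMap_of_length {α : Type*} (f : α → List ℕ) {w : ℕ}
    (hf : ∀ a, (f a).length = w) (l : List α) : (l.flatMap f).length = l.length * w := by
  induction l with
  | nil => simp
  | cons a l ih => rw [List.flatMap_cons, List.length_append, hf, ih, List.length_cons]; ring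

theorem getElem?_flatMap_of_length {α : Type*} (f : α → List ℕ) {w : ℕ}
    (hf : ∀ a, (f a).length = w) (l : List α) {i j : ℕ} (hi : i < l.length) (hj : j < w) :
    (l.flatMap f)[i * w + j]? = (f l[i])[j]? := by
  induction l generalizing i with
  | nil => simp at hi
  | cons a l ih =>
    rw [List.flatMap_cons]
    cases i with
    | zero =>
      rw [Nat.zero_mul, Nat.zero_add, List.getElem?_append_left (by rwa [hf])]
      rfl
    | succ i =>
      rw [List.getElem?_append_right (by rw [hf, Nat.succ_mul]; omega), hf,
        show (i + 1) * w + j - w = i * w + j by rw [Nat.succ_mul]; omega,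
        ih (by simpa using hi)]
      rfl

open Classical in
/-- The adjacency matrix, row by row. -/
noncomputable def matrixList {n : ℕ} (G : SimpleGraph (Fin n)) : List ℕ :=
  (List.finRange n).flatMap fun u => (List.finRange n).map fun v => if G.Adj u v then 1 else 0

variable (I : CnRInstance)

theorem CnRInstance.encode_eq :
    I.encode = I.n :: (matrixList I.G ++ (I.k.bits.map Bool.toNat ++ [2])) := by
  simp [CnRInstance.encode, matrixList]

theorem length_matrixList {n : ℕ} (G : SimpleGraph (Fin n)) :
    (matrixList G).length = n * n := by
  rw [matrixList, length_flatMap_of_length _ (w := n) (by simp), List.length_finRange]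

open Classical in
theorem CnRInstance.encode_adj (u v : Fin I.n) :
    I.encode.getD (1 + u * I.n + v) 0 = if I.G.Adj u v then 1 else 0 := by
  have h : (u : ℕ) * I.n + v < I.n * I.n := by
    have := adj_addr_lt u v
    omega
  rw [I.encode_eq, show 1 + (u : ℕ) * I.n + v = u * I.n + v + 1 by ring, List.getD_cons_succ,
    List.getD_eq_getElem?_getD, List.getElem?_append_left (by rwa [length_matrixList]),
    matrixList, getElem?_flatMap_of_length _ (w := I.n) (by simp) _ (by simp) v.2]
  simp

theorem CnRInstance.encode_bit {i : ℕ} (hi : i < I.k.size) :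
    I.encode.getD (I.n * I.n + 1 + i) 0 = (I.k.testBit i).toNat := by
  have hl : i < I.k.bits.length := by rwa [Nat.size_eq_bits_len]
  rw [I.encode_eq, show I.n * I.n + 1 + i = I.n * I.n + i + 1 by ring, List.getD_cons_succ,
    List.getD_eq_getElem?_getD, List.getElem?_append_right (by rw [length_matrixList]; omega),
    length_matrixList, Nat.add_sub_cancel_left, List.getElem?_append_left (by simpa using hl),
    List.getElem?_map, Nat.testBit_eq_inth, List.getI_eq_getElem _ hl,
    List.getElem?_eq_getElem hl]
  rfl

theorem CnRInstance.encode_end : I.encode.getD (I.n * I.n + 1 + I.k.size) 0 = 2 := by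
  rw [I.encode_eq, show I.n * I.n + 1 + I.k.size = I.n * I.n + I.k.size + 1 by ring,
    List.getD_cons_succ, List.getD_eq_getElem?_getD,
    List.getElem?_append_right (by rw [length_matrixList]; omega),
    length_matrixList, Nat.add_sub_cancel_left,
    List.getElem?_append_right (by simp [Nat.size_eq_bits_len])]
  simp [Nat.size_eq_bits_len]

theorem CnRInstance.n_pos : 0 < I.n := by
  obtain ⟨v⟩ := I.connected.nonempty
  exact v.pos

/-- The end mark `2` exceeds `n` if `n = 1`; hence the summand `1`. -/
theorem CnRInstance.le_of_mem_encode {a : ℕ} (ha : a ∈ I.encode) : a ≤ I.n + 1 := by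
  classical
  have hn := I.n_pos
  rw [I.encode_eq] at ha
  simp only [matrixList, List.mem_cons, List.mem_append, List.mem_flatMap, List.mem_map,
    List.not_mem_nil, or_false] at ha
  rcases ha with rfl | ⟨u, _, v, _, rfl⟩ | ⟨b, _, rfl⟩ | rfl
  · omega
  · split_ifs <;> omega
  · cases b <;> simp
  · omega

theorem CnRInstance.n_le_size : I.n ≤ cnr.size I := by
  have h : I.n ≤ I.encode.length := by
    rw [I.encode_eq, List.length_cons, List.length_append, length_matrixList]
    nlinarith [I.n_pos]
  have h' : ∀ l : List ℕ, l.length ≤ (l.map len).sum := by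
    intro l
    induction l with
    | nil => simp
    | cons a l ih =>
      have := one_le_len a
      simp only [List.length_cons, List.map_cons, List.sum_cons]
      omega
  exact h.trans (h' _)

/-- Read the number of vertices and the number of cops. -/
def decodeC : Cm :=
  .seq (.set 1 (.get (.lit 0))) (.seq (.set 2 (.lit 0)) (.seq (.set 9 (.lit 1))
    (.seq (.set 10 (.lit 0)) (.seq (.set 11 (.add (.var 1) (.lit 1)))
      (.seq (.loop 12 11 (.ite (.var 10) .skip
          (.seq (.set 13 (.get (.add (.add (.mul (.var 1) (.var 1)) (.lit 1)) (.var 12))))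
            (.ite (neE (.var 13) (.lit 2))
              (.seq (.set 2 (.add (.var 2) (.mul (.var 13) (.var 9))))
                (.set 9 (.mul (.lit 2) (.var 9)))) (.set 10 (.lit 1))))))
        (.ite (.var 10) .skip (.set 2 (.var 1))))))))

/-- `k` may have far more digits than `n`. At most `n + 1` cells are read; if the end mark is not
among them, then `k ≥ 2 ^ n > n`, and `k` may be replaced by `n`. Thus the time does not depend on
the length of `k`. -/
theorem wp_decodeC {Y : ℕ} (hY : 2 ^ (I.n + 1) ≤ Y) :
    Wp Y decodeC ((I.n + 1) * (3 + 1 + 1 + 1) + 2 + 2 + 1 + 1 + 1 + 1 + 1)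
      ⟨fun _ => 0, fun i => I.encode.getD i 0⟩ fun s' =>
        GraphMem I.G s' ∧
          ∀ q < I.n, q < s'.v 2 ↔ q < I.k := by
  have hnY : I.n + 1 < Y := (Nat.lt_two_pow_self (n := I.n + 1)).trans_le hY
  have hn := I.n_pos
  have h0 : I.encode.getD 0 0 = I.n := by rw [I.encode_eq]; rfl
  have h0' : I.encode[0]?.getD 0 = I.n := by rw [I.encode_eq]; rfl
  refine Wp.setSeq (by simp only [Ex.eval, h0]; omega) ?_
  refine Wp.setSeq (Nat.zero_le _) ?_
  refine Wp.setSeq (by simp only [Ex.eval]; omega) ?_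
  refine Wp.setSeq (Nat.zero_le _) ?_
  refine Wp.setSeq (by simp [Ex.eval, h0']; omega) ?_
  refine Wp.seq (T := (I.n + 1) * (3 + 1 + 1 + 1) + 2) (T' := 2) (Wp.loop (N := I.n + 1)
    (fun j s' => (s'.v 10 = 0 ∧ j ≤ I.k.size ∧ s'.v 2 = I.k % 2 ^ j ∧ s'.v 9 = 2 ^ j) ∨
      (s'.v 10 ≠ 0 ∧ s'.v 2 = I.k)) rfl rfl (by norm_num) (by simp [Ex.eval, h0']) (by omega)
    (.inl (by simp [Ex.eval, Nat.mod_one])) fun j hj s₁ hI h12 hfr hmem => ?_)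
    fun s₁ hI hfr hmem => ?_
  · have h1 : s₁.v 1 = I.n := (hfr 1 (by norm_num) rfl).trans (by simp [Ex.eval, h0'])
    have hm : s₁.mem = fun i => I.encode.getD i 0 := hmem rfl
    refine Wp.ite (T := 3 + 1) (fun he => Wp.skip ?_) fun he => ?_
    · rcases hI with ⟨h, _⟩ | ⟨h, h'⟩
      · exact (he h).elim
      · exact .inr ⟨by simpa using h, by simpa using h'⟩
    · rcases hI with ⟨h10, hjk, h2, h9⟩ | ⟨h, _⟩
      swap
      · exact (h he).elim
      have h13 : (Ex.get (.add (.add (.mul (.var 1) (.var 1)) (.lit 1)) (.var 12))).eval s₁ =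
          I.encode.getD (I.n * I.n + 1 + j) 0 := by
        simp only [Ex.eval, h1, h12, hm]
      rcases hjk.lt_or_eq with hjk | rfl
      · rw [I.encode_bit hjk] at h13
        have hb := Bool.toNat_le (I.k.testBit j)
        have hj2 : 2 ^ (j + 1) ≤ Y := (Nat.pow_le_pow_right (by norm_num) (by omega)).trans hY
        have hmod := Nat.mod_pow_succ (x := I.k) (b := 2) (k := j)
        rw [← Nat.toNat_testBit] at hmod
        have hlt : I.k % 2 ^ (j + 1) < 2 ^ (j + 1) := Nat.mod_lt _ (Nat.two_pow_pos _)
        refine Wp.setSeq (by rw [h13]; omega) ?_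
        rw [h13]
        refine Wp.ite (T := 2) (fun he' => ?_) fun he' => ?_
        · have e2 : (Ex.add (.var 2) (.mul (.var 13) (.var 9))).eval
              (s₁.set 13 (I.k.testBit j).toNat) = I.k % 2 ^ (j + 1) := by
            simp only [Ex.eval, St.set_v]
            simp only [if_true, show (2 : ℕ) ≠ 13 by norm_num, show (9 : ℕ) ≠ 13 by norm_num,
              if_false, h2, h9, hmod]
            ring
          refine Wp.setSeq (by rw [e2]; omega) ?_
          rw [e2]
          refine Wp.set ?_ (.inl ⟨by simpa using h10, hjk, by simp, by simp [Ex.eval, h9, pow_succ']⟩)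
          simpa [Ex.eval, h9, ← pow_succ'] using hj2
        · exfalso
          simp only [neE, Ex.eval, St.set_v, if_true] at he'
          omega
      · rw [I.encode_end] at h13
        refine Wp.setSeq (by rw [h13]; omega) ?_
        rw [h13]
        refine Wp.ite (T := 2) (fun he' => ?_) fun he' => ?_
        · simp [neE, Ex.eval] at he'
        · refine (Wp.set (by simp only [Ex.eval]; omega) (.inr ⟨by simp [Ex.eval], ?_⟩)).mono
            (by norm_num) fun _ h => h
          simpa [h2] using Nat.mod_eq_of_lt (Nat.lt_size_self I.k)
  · have h1 : s₁.v 1 = I.n := (hfr 1 rfl).trans (by simp [Ex.eval, h0'])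
    have hg : GraphMem I.G s₁ := ⟨h1, fun u v => by rw [hmem rfl]; exact I.encode_adj u v⟩
    refine Wp.ite (fun he => Wp.skip ?_) fun he => Wp.set (by simp only [Ex.eval]; omega) ?_
    · rcases hI with ⟨h, _⟩ | ⟨_, h⟩
      · exact (he h).elim
      · exact ⟨hg, by simp [h]⟩
    · rcases hI with ⟨_, h, _⟩ | ⟨h, _⟩
      · have hk : I.n < I.k := Nat.lt_two_pow_self.trans_le (Nat.lt_size.1 h)
        refine ⟨hg.congr (by simp) fun _ _ => rfl, fun q hq => ?_⟩
        simp only [Ex.eval, h1, St.set_v, if_true]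
        omega
      · exact (h he).elim

/-- Try the numbers of cops one after the other. -/
def mainC : Cm :=
  .seq decodeC (.seq (.set 0 (.lit 0)) (.loop 3 1
    (.ite (.mul (.sub (.lit 1) (.var 0)) (.sub (.var 2) (.var 3))) solveC .skip)))

/-- After the first success nothing is solved any more, so `X` has to bound only attempts for which
no smaller positive number of cops wins. This is how the cop number limits the exponent. Numbers of
cops above `n` need no attempt, since one cop per vertex wins. -/
theorem wp_mainC {X Y : ℕ} (hY : 2 ^ (I.n + 1) ≤ Y) (hY' : I.n ^ (I.n + 1) * (I.n + 1) ≤ Y)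
    (hX : ∀ q < I.n, (∀ q' < q, ¬ CopWin I.G (q' + 1)) →
      solveTime I.n (keptList I.G (q + 1)).length (q + 1) ≤ X) :
    Wp Y mainC ((I.n + 1) * (3 + 1 + 1 + 1) + 2 + 2 + 1 + 1 + 1 + 1 + 1 +
      (I.n * (X + 1 + 1) + 2 + 1)) ⟨fun _ => 0, fun i => I.encode.getD i 0⟩ fun s' =>
        (s'.v 0 = 1 ↔ CopWin I.G I.k) := by
  have hn := I.n_pos
  have hnY : I.n ≤ Y := (Nat.lt_two_pow_self (n := I.n)).le.trans
    ((Nat.pow_le_pow_right (by norm_num) (by omega)).trans hY)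
  refine Wp.seq (wp_decodeC I hY) fun s ⟨hg, h2⟩ _ _ => ?_
  refine Wp.setSeq (Nat.zero_le _) ?_
  let J : ℕ → St → Prop := fun j s' => GraphMem I.G s' ∧ s'.v 0 ≤ 1 ∧
    (s'.v 0 ≠ 0 ↔ ∃ q < j, q < I.k ∧ CopWin I.G (q + 1))
  refine Wp.mono (T := I.n * (X + 1 + 1) + 2) (Q := J I.n) ?_ le_rfl fun s' ⟨_, hle, hI⟩ => ?_
  · refine Wp.loop (N := I.n) J rfl rfl (by norm_num)
      (by simpa using hg.v1) hnY ⟨hg.congr (by simp) fun _ _ => rfl, by simp [Ex.eval],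
        by simp [Ex.eval]⟩ fun j hj s₁ ⟨hg₁, hle, hI⟩ h3 hfr _ => ?_
    have h2₁ : s₁.v 2 = s.v 2 := (hfr 2 (by norm_num) rfl).trans (by simp)
    have hcond : (Ex.mul (.sub (.lit 1) (.var 0)) (.sub (.var 2) (.var 3))).eval s₁ ≠ 0 ↔
        s₁.v 0 = 0 ∧ j < I.k := by
      rw [← h2 j hj]
      simp only [Ex.eval, h3, h2₁, Nat.mul_ne_zero_iff]
      omega
    refine Wp.ite (fun he => ?_) fun he => Wp.skip ?_
    · obtain ⟨h0, hjk⟩ := hcond.1 he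
      have hno : ∀ q' < j, ¬ CopWin I.G (q' + 1) := fun q' hq' hw =>
        hI.2 ⟨q', hq', by omega, hw⟩ h0
      refine (wp_solveC I.connected hg₁ hj h3 h0 hY').mono (hX j hj hno)
        fun s₂ ⟨hg₂, hle₂, h⟩ => ⟨hg₂.congr (by simp) fun _ _ => rfl, by simpa using hle₂, ?_⟩
      simp only [St.set_v, show (0 : ℕ) ≠ 3 by norm_num, if_false]
      rw [h]
      refine ⟨fun hw => ⟨j, by omega, hjk, hw⟩, fun ⟨q, hq, _, hw⟩ => ?_⟩
      rcases Nat.lt_succ_iff_lt_or_eq.1 hq with hq | rfl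
      · exact (hno q hq hw).elim
      · exact hw
    · refine ⟨hg₁.congr (by simp) fun _ _ => rfl, by simpa using hle, ?_⟩
      simp only [St.set_v, show (0 : ℕ) ≠ 3 by norm_num, if_false]
      refine hI.trans ⟨fun ⟨q, hq, h⟩ => ⟨q, by omega, h⟩, fun ⟨q, hq, hqk, hw⟩ => ?_⟩
      rcases Nat.lt_succ_iff_lt_or_eq.1 hq with hq | rfl
      · exact ⟨q, hq, hqk, hw⟩
      · exact hI.1 fun h0 => hcond.2 ⟨h0, hqk⟩ he
  · rw [show s'.v 0 = 1 ↔ s'.v 0 ≠ 0 by omega, hI]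
    have := I.connected.nonempty
    constructor
    · rintro ⟨q, _, hqk, hw⟩
      exact hw.mono hqk
    · intro hw
      have hk : 0 < I.k := by
        rcases Nat.eq_zero_or_pos I.k with h0 | h0
        · rw [h0] at hw
          obtain ⟨σ, _, h⟩ := hw
          obtain ⟨v⟩ := this
          obtain ⟨_, j, _⟩ := h (fun _ => v) fun _ => .inl rfl
          exact j.elim0
        · exact h0
      rcases Nat.lt_or_ge I.n I.k with h | h
      · refine ⟨I.n - 1, by omega, by omega, ?_⟩
        rw [Nat.sub_add_cancel hn]
        simpa using copWin_card (G := I.G)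
      · refine ⟨I.k - 1, by omega, by omega, ?_⟩
        rwa [Nat.sub_add_cancel hk]

end Input


/-! ### The running time -/

section Time

/-- The factor `3 * n + 1` is what makes the induction close, by `(3n + 4)(2n + 1)² ≤ 4(n + 1)²(3n +
1)`. -/
theorem centralBinom_sq_le (n : ℕ) : (3 * n + 1) * n.centralBinom ^ 2 ≤ 16 ^ n := by
  induction n with
  | zero => simp
  | succ n ih =>
    have h := Nat.succ_mul_centralBinom_succ n
    refine Nat.le_of_mul_le_mul_left ?_ (Nat.pow_pos (n := 2) n.succ_pos)
    calc (n + 1) ^ 2 * ((3 * (n + 1) + 1) * (n + 1).centralBinom ^ 2)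
        = (3 * n + 4) * ((n + 1) * (n + 1).centralBinom) ^ 2 := by ring
      _ = 4 * ((3 * n + 4) * (2 * n + 1) ^ 2) * n.centralBinom ^ 2 := by rw [h]; ring
      _ ≤ 4 * (4 * (n + 1) ^ 2 * (3 * n + 1)) * n.centralBinom ^ 2 := by
        refine Nat.mul_le_mul_right _ (Nat.mul_le_mul_left _ ?_)
        nlinarith
      _ = 16 * (n + 1) ^ 2 * ((3 * n + 1) * n.centralBinom ^ 2) := by ring
      _ ≤ 16 * (n + 1) ^ 2 * 16 ^ n := Nat.mul_le_mul_left _ ih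
      _ = (n + 1) ^ 2 * 16 ^ (n + 1) := by ring

/-- For odd `t = 2 * a + 1` the coefficient is half of the central one for `a + 1`. -/
theorem choose_half_sq_le (t : ℕ) : max t 1 * t.choose (t / 2) ^ 2 ≤ 4 ^ t := by
  obtain ⟨a, rfl | rfl⟩ := Nat.even_or_odd' t
  · rw [Nat.mul_div_cancel_left _ two_pos, ← Nat.centralBinom_eq_two_mul_choose, pow_mul]
    exact (Nat.mul_le_mul_right _ (by omega)).trans (centralBinom_sq_le a)
  · rw [show (2 * a + 1) / 2 = a by omega, max_eq_left (by omega)]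
    have h : (a + 1).centralBinom = 2 * (2 * a + 1).choose a := by
      rw [Nat.centralBinom_eq_two_mul_choose, show 2 * (a + 1) = 2 * a + 1 + 1 by ring,
        Nat.choose_succ_succ', Nat.choose_symm_half]
      ring
    have h' := centralBinom_sq_le (a + 1)
    rw [h] at h'
    have e : (16 : ℕ) ^ (a + 1) = 4 * 4 ^ (2 * a + 1) := by
      rw [show (16 : ℕ) = 4 ^ 2 by norm_num, ← pow_mul, ← pow_succ']
      congr 1
    have : 4 * ((2 * a + 1) * (2 * a + 1).choose a ^ 2) ≤
        (3 * (a + 1) + 1) * (2 * (2 * a + 1).choose a) ^ 2 := by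
      calc _ = (2 * a + 1) * (2 * (2 * a + 1).choose a) ^ 2 := by ring
        _ ≤ _ := Nat.mul_le_mul_right _ (by omega)
    omega

theorem choose_half_le (t : ℕ) :
    (t.choose (t / 2) : ℝ) ≤ 2 ^ t / Real.sqrt (max (t : ℝ) 1) := by
  have hpos : (0 : ℝ) < max (t : ℝ) 1 := lt_max_of_lt_right one_pos
  rw [le_div_iff₀ (Real.sqrt_pos.2 hpos)]
  refine le_of_sq_le_sq ?_ (by positivity)
  have h : ((max t 1 * t.choose (t / 2) ^ 2 : ℕ) : ℝ) ≤ ((4 ^ t : ℕ) : ℝ) :=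
    Nat.cast_le.2 (choose_half_sq_le t)
  push_cast at h
  rw [mul_pow, Real.sq_sqrt hpos.le, ← pow_mul, mul_comm t 2, pow_mul]
  norm_num
  linarith

/-- The base of the running time. -/
noncomputable def gameBase (t : ℕ) : ℝ := (t : ℝ) + (2 : ℝ) ^ t / Real.sqrt (max (t : ℝ) 1)

theorem add_choose_half_le (t : ℕ) : ((t + t.choose (t / 2) : ℕ) : ℝ) ≤ gameBase t := by
  rw [Nat.cast_add, gameBase]
  gcongr
  exact choose_half_le t

theorem one_le_gameBase (t : ℕ) : 1 ≤ gameBase t := by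
  refine le_trans ?_ (add_choose_half_le t)
  have : 0 < t.choose (t / 2) := Nat.choose_pos (Nat.div_le_self t 2)
  exact_mod_cast (by omega : 1 ≤ t + t.choose (t / 2))

theorem gameBase_le (t : ℕ) : gameBase t ≤ ((t + 2 ^ t : ℕ) : ℝ) := by
  push_cast
  rw [gameBase]
  gcongr
  exact div_le_self (by positivity) (Real.one_le_sqrt.2 (le_max_right _ _))

variable (I : CnRInstance)

theorem CnRInstance.exists_cover :
    ∃ U : Finset (Fin I.n), U.card = I.vcn ∧ ∀ u v, I.G.Adj u v → u ∈ U ∨ v ∈ U := by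
  classical
  obtain ⟨c, hc, hcov⟩ := I.G.vertexCoverNum_exists
  refine ⟨c.toFinset, ?_, fun u v h => by simpa using hcov h⟩
  rw [CnRInstance.vcn, ← hc, Set.encard_eq_coe_toFinset_card, ENat.toNat_natCast]

/-- For `q = 0` all vertices are kept, but the exponent is two. Otherwise three factors are
estimated by `n`, and the remaining exponent `q - 1` is at most `vcn / 3 + 2`, because some `k` with
`3 * k ≤ vcn + 12` wins and `q < k`. -/
theorem CnRInstance.length_keptList_pow_le {q : ℕ} (hno : ∀ q' < q, ¬ CopWin I.G (q' + 1)) :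
    ((keptList I.G (q + 1)).length : ℝ) ^ (q + 2) ≤
      (I.n : ℝ) ^ 3 * gameBase I.vcn ^ ((I.vcn : ℝ) / 3 + 2) := by
  have hB := one_le_gameBase I.vcn
  have hn : (1 : ℝ) ≤ I.n := by exact_mod_cast I.n_pos
  have hL : ((keptList I.G (q + 1)).length : ℝ) ≤ I.n := by
    exact_mod_cast length_keptList_le I.G (q + 1)
  have hBe : 1 ≤ gameBase I.vcn ^ ((I.vcn : ℝ) / 3 + 2) :=
    Real.one_le_rpow hB (by positivity)
  rcases q with _ | q
  · calc ((keptList I.G (0 + 1)).length : ℝ) ^ (0 + 2) ≤ (I.n : ℝ) ^ (0 + 2) := by gcongr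
      _ ≤ (I.n : ℝ) ^ 3 := pow_le_pow_right₀ hn (by norm_num)
      _ ≤ _ := le_mul_of_one_le_right (by positivity) hBe
  obtain ⟨U, hUc, hU⟩ := I.exists_cover
  have hKB : ((keptList I.G (q + 1 + 1)).length : ℝ) ≤ gameBase I.vcn := by
    refine le_trans ?_ (add_choose_half_le I.vcn)
    have hnd := (suffices_keptList I.G (q + 1 + 1)).nodup
    have h := card_undominated_le U hU (keptList I.G (q + 1 + 1)).toFinset fun u hu => by
      have := ((suffices_keptList I.G (q + 1 + 1)).mem u).1 (List.mem_toFinset.1 hu)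
      exact this.resolve_left (by omega)
    rw [List.toFinset_card_of_nodup hnd, hUc] at h
    exact_mod_cast h
  obtain ⟨k, hk, hw⟩ := exists_copWin_of_cover I.connected U hU
  have hk0 : k ≠ 0 := by
    rintro rfl
    have := I.connected.nonempty
    exact hno 0 (by omega) (hw.mono (Nat.zero_le _))
  have hqk : q + 1 ≤ k - 1 := by
    by_contra h
    refine hno (k - 1) (by omega) ?_
    rwa [Nat.sub_add_cancel (by omega)]
  have hq : (q : ℝ) ≤ (I.vcn : ℝ) / 3 + 2 := by
    have : 3 * q ≤ I.vcn + 6 := by omega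
    have : (3 : ℝ) * q ≤ I.vcn + 6 := by exact_mod_cast this
    linarith
  calc ((keptList I.G (q + 1 + 1)).length : ℝ) ^ (q + 1 + 2)
      = ((keptList I.G (q + 1 + 1)).length : ℝ) ^ 3 *
        ((keptList I.G (q + 1 + 1)).length : ℝ) ^ q := by ring
    _ ≤ (I.n : ℝ) ^ 3 * gameBase I.vcn ^ q := by gcongr
    _ ≤ _ := by
      gcongr
      rw [← Real.rpow_natCast]
      exact Real.rpow_le_rpow_of_exponent_le hB hq

theorem len_succ_le {n : ℕ} (hn : 0 < n) : len (n + 1) ≤ 2 * n := by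
  have h : n + 1 < 2 ^ (n + 1) := Nat.lt_two_pow_self
  have := Nat.log_lt_of_lt_pow (b := 2) (by omega) h
  rw [len]
  omega

theorem mainC_runs : ∃ (t : ℕ) (s : Config),
    Runs (mainC.code 0) (start I.encode) t s ∧ Halted (mainC.code 0) s ∧
      (s.reg 0 = 1 ↔ CopWin I.G I.k) ∧
      (t : ℝ) ≤ ((2000 * mainC.unit : ℕ) : ℝ) *
        gameBase I.vcn ^ ((I.vcn : ℝ) / 3 + 2) * (I.n : ℝ) ^ 9 := by
  have hn := I.n_pos
  have hn' : (1 : ℝ) ≤ I.n := by exact_mod_cast hn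
  have hBe : 1 ≤ gameBase I.vcn ^ ((I.vcn : ℝ) / 3 + 2) :=
    Real.one_le_rpow (one_le_gameBase _) (by positivity)
  set E := gameBase I.vcn ^ ((I.vcn : ℝ) / 3 + 2) with hE
  -- Large enough for the powers of two formed while reading and for the number of nodes, yet of
  -- length quadratic in `n`.
  set Y := (I.n + 1) ^ (I.n + 2) with hYdef
  have hY1 : 2 ^ (I.n + 1) ≤ Y :=
    (Nat.pow_le_pow_left (by omega) _).trans (Nat.pow_le_pow_right (by omega) (by omega))
  have hY2 : I.n ^ (I.n + 1) * (I.n + 1) ≤ Y := by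
    rw [hYdef, pow_succ _ (I.n + 1)]
    exact Nat.mul_le_mul_right _ (Nat.pow_le_pow_left (by omega) _)
  have hY3 : I.n + 1 ≤ Y := Nat.le_self_pow (by omega) _
  -- `200 * n ^ 3` comes from `solveTime_le` and `n ^ 3 * E` from `length_keptList_pow_le`.
  set X := ⌊200 * (I.n : ℝ) ^ 6 * E⌋₊ with hX
  have hXle : (X : ℝ) ≤ 200 * (I.n : ℝ) ^ 6 * E := Nat.floor_le (by positivity)
  obtain ⟨t, s', hev, ht, hs'⟩ := wp_mainC I (X := X) hY1 hY2 fun q hq hno => by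
    refine Nat.le_floor ?_
    have h := solveTime_le (keptList_pos hn I.G (q + 1)) (length_keptList_le I.G (q + 1))
      (by omega : q + 1 ≤ I.n)
    calc (solveTime I.n (keptList I.G (q + 1)).length (q + 1) : ℝ)
        ≤ ((200 * I.n ^ 3 * (keptList I.G (q + 1)).length ^ (q + 1 + 1) : ℕ) : ℝ) := by
          exact_mod_cast h
      _ = 200 * (I.n : ℝ) ^ 3 * ((keptList I.G (q + 1)).length : ℝ) ^ (q + 2) := by push_cast; ring
      _ ≤ 200 * (I.n : ℝ) ^ 3 * ((I.n : ℝ) ^ 3 * E) := by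
          gcongr
          exact I.length_keptList_pow_le hno
      _ = _ := by ring
  obtain ⟨T, g, hr, hh, hg, hT⟩ := hev.runs_start (by omega)
    fun a ha => (I.le_of_mem_encode ha).trans hY3
  refine ⟨T, g, hr, hh, by rw [hg]; exact hs', ?_⟩
  have hlen : len Y ≤ 6 * I.n ^ 2 := by
    calc len Y ≤ (I.n + 2) * len (I.n + 1) := len_pow_le _ _ (by omega)
      _ ≤ (3 * I.n) * (2 * I.n) := Nat.mul_le_mul (by omega) (len_succ_le hn)
      _ = _ := by ring
  -- The overhead besides the attempts is `8 * n + 18`.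
  have htX : t ≤ I.n * X + 26 * I.n := by
    refine ht.trans ?_
    nlinarith
  have htR : (t : ℝ) ≤ 226 * (I.n : ℝ) ^ 7 * E := by
    have h1 : (t : ℝ) ≤ I.n * X + 26 * I.n := by exact_mod_cast htX
    have h2 : (I.n : ℝ) * X ≤ I.n * (200 * (I.n : ℝ) ^ 6 * E) := by gcongr
    have h3 : (I.n : ℝ) ≤ (I.n : ℝ) ^ 7 * E :=
      (le_self_pow₀ hn' (by norm_num)).trans (le_mul_of_one_le_right (by positivity) hBe)
    linarith
  calc (T : ℝ) ≤ ((t * (mainC.unit * len Y) : ℕ) : ℝ) := by exact_mod_cast hT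
    _ ≤ ((t * (mainC.unit * (6 * I.n ^ 2)) : ℕ) : ℝ) := by
        exact_mod_cast Nat.mul_le_mul_left _ (Nat.mul_le_mul_left _ hlen)
    _ = t * (6 * mainC.unit * (I.n : ℝ) ^ 2) := by push_cast; ring
    _ ≤ 226 * (I.n : ℝ) ^ 7 * E * (6 * mainC.unit * (I.n : ℝ) ^ 2) := by gcongr
    _ = 1356 * (mainC.unit * E * (I.n : ℝ) ^ 9) := by ring
    _ ≤ 2000 * (mainC.unit * E * (I.n : ℝ) ^ 9) := by
        gcongr
        norm_num
    _ = _ := by push_cast; ring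

theorem primrec₂_pow : Primrec₂ fun a b : ℕ => a ^ b := by
  refine (Primrec.nat_rec (f := fun _ : ℕ => 1) (g := fun (a : ℕ) (p : ℕ × ℕ) => p.2 * a)
    (Primrec.const 1) (Primrec.nat_mul.comp (Primrec.snd.comp Primrec.snd) Primrec.fst)).of_eq
    fun a b => ?_
  induction b with
  | zero => rfl
  | succ b ih => rw [pow_succ, ← ih]

theorem computable_bound (C : ℕ) : Computable fun t : ℕ => C * (t + 2 ^ t) ^ (t + 2) := by
  have h : Primrec fun t : ℕ => t + 2 ^ t :=
    Primrec.nat_add.comp Primrec.id (primrec₂_pow.comp (Primrec.const 2) Primrec.id)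
  exact (Primrec.nat_mul.comp (Primrec.const C) (primrec₂_pow.comp h
    (Primrec.nat_add.comp Primrec.id (Primrec.const 2)))).to_comp

/-- For the computable function `f` a natural-number bound is needed: the square root is dropped and
the exponent is rounded up generously. -/
theorem gameBase_rpow_le (t : ℕ) :
    gameBase t ^ ((t : ℝ) / 3 + 2) ≤ (((t + 2 ^ t) ^ (t + 2) : ℕ) : ℝ) := by
  have hB := one_le_gameBase t
  calc gameBase t ^ ((t : ℝ) / 3 + 2) ≤ gameBase t ^ ((t + 2 : ℕ) : ℝ) := by
        refine Real.rpow_le_rpow_of_exponent_le hB ?_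
        push_cast
        have : (0 : ℝ) ≤ t := t.cast_nonneg
        linarith
    _ = gameBase t ^ (t + 2) := Real.rpow_natCast _ _
    _ ≤ ((t + 2 ^ t : ℕ) : ℝ) ^ (t + 2) := by
        gcongr
        exact gameBase_le t
    _ = _ := by push_cast; rfl

end Time

end CopsRobber

theorem corollary1 :
    CopsRobber.cnr.FPT ∧
    ∃ (P : CopsRobber.Program) (C c : ℕ),
      CopsRobber.SolvesInTime P CopsRobber.cnr (fun I : CopsRobber.CnRInstance =>
        (C : ℝ) *
          ((I.vcn : ℝ) + (2 : ℝ) ^ I.vcn / Real.sqrt (max (I.vcn : ℝ) 1)) ^ ((I.vcn : ℝ) / 3 + 2) *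
          (I.n : ℝ) ^ c) := by
  refine ⟨⟨CopsRobber.mainC.code 0, _, 9,
    CopsRobber.computable_bound (2000 * CopsRobber.mainC.unit), fun I => ?_⟩,
    CopsRobber.mainC.code 0, 2000 * CopsRobber.mainC.unit, 9, CopsRobber.mainC_runs⟩
  obtain ⟨t, s, hr, hh, hs, ht⟩ := CopsRobber.mainC_runs I
  refine ⟨t, s, hr, hh, hs, ht.trans ?_⟩
  -- The same program serves both claims; its time bound involves only `n` and `vcn`, and `n` is at
  -- most the input size.
  have h1 := CopsRobber.gameBase_rpow_le I.vcn
  have h2 : (I.n : ℝ) ≤ CopsRobber.cnr.size I := by exact_mod_cast I.n_le_size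
  refine (mul_le_mul (mul_le_mul_of_nonneg_left h1 (Nat.cast_nonneg _))
    (pow_le_pow_left₀ (Nat.cast_nonneg _) h2 9) (by positivity) (by positivity)).trans
    (le_of_eq ?_)
  rw [← Nat.cast_mul]
  rfl
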